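/- **Conventions.** A matrix $U=(u_1,\dots,u_n)\in\mathbb R^{d\times n}$ is a *frame* if it has full row rank. For $z\in\mathbb R^n_{++}$ (all entries positive) and $Z=\mathrm{diag}(z)$, the leverage scores are $\mathrm{lev}^U_j(z)=z_j\,u_j^{\mathsf T}(UZU^{\mathsf T})^{-1}u_j$, $j=1,\dots,n$. The bit complexity of a rational number $p/q$ in lowest terms is $1$ plus the number of binary digits of $|p|$ plus that of $q$; "$x$ has bit complexity at most $b$" means that $x$ is rational and its bit complexity is at most $b$. *Model of computation.* A program is one finite text, independent of $d$ and $n$, for a random access machine over the reals, which can read $d$ and $n$ as indices and has index registers (with addition, truncated subtraction, comparison and for-loops on indices) and arrays of real cells. On real cells it can perform exact $+,-,\times,\div$, copying, loading of natural-number constants, comparisons of two reals, and calls of a rounding oracle, which rounds a real to the nearest multiple of $2^{-e}$, $e\in\mathbb N$ given by an index. It can also perform matrix operations on $d\times d$ and $d\times n$ matrices: the products $AB$ with $A$ of size $d\times d$ and $B$ of size $d\times d$ or $d\times n$, the products $AB^{\mathsf T}$ with $A,B$ of size $d\times n$, the inverse of a $d\times d$ matrix, and Gram–Schmidt orthogonalization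 (without normalization) of the columns of a $d\times n$ matrix. Division by zero and inversion of a singular matrix are illegal. Every instruction, test and loop iteration (a matrix operation included) counts as one step. **Corollary.** There are a program $P$ and constants $C>0$ and $K\in\mathbb N$ such that the following holds for all $d,n,b\in\mathbb N$, every frame $U\in\mathbb R^{d\times n}$ all of whose entries have bit complexity at most $b$, every $z\in\mathbb R^n_{++}$ and every real $0<\delta<1/2$. On input $(U,z,\delta)$ the program performs no illegal operation and outputs a vector $\hat z\in\mathbb R^n_{++}$ such that 1. every entry of $\hat z$ has bit complexity at most $C\,n\,(db+\log n+\log(1/\delta))$; 2. $\|\mathrm{lev}^U(z)-\mathrm{lev}^U(\hat z)\|_1\le C\,n\,d\,\delta$; 3. the program uses at most $C\,n\log n$ comparisons of real numbers, at most $C\,n$ matrix operations, at most $C\,n$ calls of the rounding oracle, and at most $C\,(n+1)^2(d+1)^2$ steps in total; 4. if for some $B\in\mathbb N$ the entries of $U$ and of $z$ and the number $\delta$ all have bit complexity at most $B$, then every real number written to memory during the computation has bit complexity at most $C\,(n+d+B+1)^K$. (For $n=0$ read $n\log n=0$ and $\log n=0$.) -/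

import Mathlib

noncomputable section

namespace FrameScaling

/-! ### Frames, leverage scores, bit complexity -/

/-- A `d × n` matrix (with columns `u₁, …, uₙ`) is a frame if it has full row rank. -/
def IsFrame {d n : ℕ} (U : Matrix (Fin d) (Fin n) ℝ) : Prop :=
  U.rank = d

/-- Leverage scores `lev_j(z) = z_j u_jᵀ (U Z Uᵀ)⁻¹ u_j`, where `Z = diag z`. -/
def lev {d n : ℕ} (U : Matrix (Fin d) (Fin n) ℝ) (z : Fin n → ℝ) (j : Fin n) : ℝ :=
  z j * ((fun i => U i j) ⬝ᵥ
    Matrix.mulVec ((U * Matrix.diagonal z * U.transpose)⁻¹) (fun i => U i j))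

/-- Encoding length of a rational number in lowest terms: one bit for the sign, and the
binary lengths of the numerator and of the denominator. -/
def ratBits (q : ℚ) : ℕ :=
  1 + Nat.size q.num.natAbs + Nat.size q.den

/-- The real number `x` is rational and has encoding length at most `b`. -/
def HasBitComplexity (x : ℝ) (b : ℝ) : Prop :=
  ∃ q : ℚ, (q : ℝ) = x ∧ (ratBits q : ℝ) ≤ b

/-! ### Programs

A random access machine over the reals.  It has index registers holding natural numbers and
arrays `mem r` of real cells `mem r i j`.  Real numbers are accessible only through exact
arithmetic, comparison, rounding to a multiple of `2⁻ᵇ`, and matrix operations; they influence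
the control flow only through comparisons.  A program is one finite text; it is not allowed to
depend on the numbers `d` of rows and `n` of columns, which it can read as indices. -/

/-- Index expressions. -/
inductive IExpr where
  | const (k : ℕ)
  | rows
  | cols
  | var (v : ℕ)
  | add (e f : IExpr)
  | sub (e f : IExpr)

/-- Value of an index expression (`sub` is truncated subtraction). -/
def IExpr.eval (d n : ℕ) (idx : ℕ → ℕ) : IExpr → ℕ
  | .const k => k
  | .rows => d
  | .cols => n
  | .var v => idx v
  | .add e f => e.eval d n idx + f.eval d n idx
  | .sub e f => e.eval d n idx - f.eval d n idx

/-- The address of a real cell: an array and two index expressions. -/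
structure Cell where
  arr : ℕ
  row : IExpr
  col : IExpr

/-- The four exact arithmetic operations. -/
inductive ArithOp where
  | add
  | sub
  | mul
  | div

/-- Value of an arithmetic operation. -/
def ArithOp.eval : ArithOp → ℝ → ℝ → ℝ
  | .add, x, y => x + y
  | .sub, x, y => x - y
  | .mul, x, y => x * y
  | .div, x, y => x / y

/-- Operands for which an arithmetic operation is defined. -/
def ArithOp.Legal : ArithOp → ℝ → ℝ → Prop
  | .div, _, y => y ≠ 0
  | _, _, _ => True

/-- Programs. -/
inductive Prog where
  | skip
  | seq (s t : Prog)
  /-- index register `v` := value of `e` -/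
  | setIdx (v : ℕ) (e : IExpr)
  /-- `if e ≤ f then s else t`, on indices -/
  | ifIdx (e f : IExpr) (s t : Prog)
  /-- `for v = 0, …, e - 1 do s`, where `e` is evaluated once, at the start -/
  | loop (v : ℕ) (e : IExpr) (s : Prog)
  /-- `dst` := the natural number `k` -/
  | const (dst : Cell) (k : ℕ)
  | copy (dst a : Cell)
  | arith (op : ArithOp) (dst a b : Cell)
  /-- rounding oracle: `dst` := the multiple of `2 ^ (-e)` nearest to `a` -/
  | round (dst a : Cell) (e : IExpr)
  /-- `if a ≤ b then s else t`, on real cells -/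
  | ifLe (a b : Cell) (s t : Prog)
  /-- product of the `d × d` matrices in arrays `a` and `b` -/
  | mulSquare (dst a b : ℕ)
  /-- product of the `d × d` matrix in array `a` with the `d × n` matrix in array `b` -/
  | mulRect (dst a b : ℕ)
  /-- product of the `d × n` matrix in array `a` with the transpose of that in array `b` -/
  | mulTranspose (dst a b : ℕ)
  /-- inverse of the `d × d` matrix in array `a` -/
  | inverse (dst a : ℕ)
  /-- Gram-Schmidt orthogonalization (no normalization) of the columns of the `d × n`
  matrix in array `a` -/
  | gramSchmidt (dst a : ℕ)

/-- Configurations: the memory, a record of whether all operations so far were legal (no division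
by zero, no inversion of a singular matrix), the operation counts so far, and the set of all
real numbers written to memory so far. -/
structure Conf where
  idx : ℕ → ℕ
  mem : ℕ → ℕ → ℕ → ℝ
  legal : Prop
  /-- all executed instructions, tests and loop iterations, of every kind -/
  steps : ℕ
  /-- comparisons of real numbers -/
  comparisons : ℕ
  /-- calls of the rounding oracle -/
  roundings : ℕ
  /-- matrix operations -/
  matrixOps : ℕ
  written : Set ℝ

namespace Conf

/-- Count one step. -/
def tick (c : Conf) : Conf :=
  { c with steps := c.steps + 1 }

/-- Set an index register. -/
def setIdx (c : Conf) (v k : ℕ) : Conf :=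
  { c with idx := Function.update c.idx v k }

/-- Content of a cell. -/
def read (d n : ℕ) (c : Conf) (l : Cell) : ℝ :=
  c.mem l.arr (l.row.eval d n c.idx) (l.col.eval d n c.idx)

/-- Write a real number to a cell. -/
def write (d n : ℕ) (c : Conf) (l : Cell) (x : ℝ) : Conf :=
  { c with
    mem := fun r i j =>
      if r = l.arr ∧ i = l.row.eval d n c.idx ∧ j = l.col.eval d n c.idx then x
      else c.mem r i j
    written := insert x c.written }

/-- The `p × q` matrix in the upper left corner of array `r`. -/
def readMat (p q : ℕ) (c : Conf) (r : ℕ) : Matrix (Fin p) (Fin q) ℝ :=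
  Matrix.of fun i j => c.mem r i j

/-- Write a matrix to the upper left corner of array `r`. -/
def writeMat {p q : ℕ} (c : Conf) (r : ℕ) (A : Matrix (Fin p) (Fin q) ℝ) : Conf :=
  { c with
    mem := fun s i j =>
      if h : s = r ∧ i < p ∧ j < q then A ⟨i, h.2.1⟩ ⟨j, h.2.2⟩ else c.mem s i j
    written := c.written ∪ {x | ∃ i j, x = A i j} }

/-- Count one step, which is a matrix operation. -/
def tickMat (c : Conf) : Conf :=
  { c with steps := c.steps + 1, matrixOps := c.matrixOps + 1 }

/-- Require `p` for the run to be legal. -/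
def require (c : Conf) (p : Prop) : Conf :=
  { c with legal := c.legal ∧ p }

end Conf

/-- Gram-Schmidt orthogonalization of the columns of a matrix. -/
def gramSchmidtCols {d n : ℕ} (A : Matrix (Fin d) (Fin n) ℝ) : Matrix (Fin d) (Fin n) ℝ :=
  Matrix.of fun i j =>
    InnerProductSpace.gramSchmidt ℝ
      (fun k : Fin n => (WithLp.toLp 2 (fun l : Fin d => A l k) : EuclideanSpace ℝ (Fin d))) j i

/-- Nearest multiple of `2 ^ (-e)`. -/
def roundTo (x : ℝ) (e : ℕ) : ℝ :=
  (round (x * 2 ^ e) : ℝ) / 2 ^ e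

/-- Execution of a program. -/
def Prog.exec (d n : ℕ) : Prog → Conf → Conf
  | .skip, c => c
  | .seq s t, c => t.exec d n (s.exec d n c)
  | .setIdx v e, c => (c.setIdx v (e.eval d n c.idx)).tick
  | .ifIdx e f s t, c =>
      if e.eval d n c.idx ≤ f.eval d n c.idx then s.exec d n c.tick else t.exec d n c.tick
  | .loop v e s, c =>
      (List.range (e.eval d n c.idx)).foldl (fun c' k => s.exec d n (c'.setIdx v k).tick) c.tick
  | .const dst k, c => (c.write d n dst (k : ℝ)).tick
  | .copy dst a, c => (c.write d n dst (c.read d n a)).tick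
  | .arith op dst a b, c =>
      ((c.write d n dst (op.eval (c.read d n a) (c.read d n b))).require
        (op.Legal (c.read d n a) (c.read d n b))).tick
  | .round dst a e, c =>
      { (c.write d n dst (roundTo (c.read d n a) (e.eval d n c.idx))).tick with
        roundings := c.roundings + 1 }
  | .ifLe a b s t, c =>
      if c.read d n a ≤ c.read d n b then
        s.exec d n { c.tick with comparisons := c.comparisons + 1 }
      else
        t.exec d n { c.tick with comparisons := c.comparisons + 1 }
  | .mulSquare dst a b, c =>
      (c.writeMat dst (c.readMat d d a * c.readMat d d b)).tickMat
  | .mulRect dst a b, c =>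
      (c.writeMat dst (c.readMat d d a * c.readMat d n b)).tickMat
  | .mulTranspose dst a b, c =>
      (c.writeMat dst (c.readMat d n a * (c.readMat d n b).transpose)).tickMat
  | .inverse dst a, c =>
      ((c.writeMat dst (c.readMat d d a)⁻¹).require (IsUnit (c.readMat d d a).det)).tickMat
  | .gramSchmidt dst a, c =>
      (c.writeMat dst (gramSchmidtCols (c.readMat d n a))).tickMat

/-- Initial configuration: `U` is in array `0`, `z` in row `0` of array `1`, `δ` in cell `(0, 0)`
of array `2`, and all other cells and index registers are zero. -/
def initialConf {d n : ℕ} (U : Matrix (Fin d) (Fin n) ℝ) (z : Fin n → ℝ) (δ : ℝ) : Conf where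
  idx := fun _ => 0
  mem := fun r i j =>
    if r = 0 then (if h : i < d ∧ j < n then U ⟨i, h.1⟩ ⟨j, h.2⟩ else 0)
    else if r = 1 then (if h : i = 0 ∧ j < n then z ⟨j, h.2⟩ else 0)
    else if r = 2 then (if i = 0 ∧ j = 0 then δ else 0)
    else 0
  legal := True
  steps := 0
  comparisons := 0
  roundings := 0
  matrixOps := 0
  written := ∅

/-- Final configuration of a program on input `(U, z, δ)`. -/
def Prog.run {d n : ℕ} (P : Prog) (U : Matrix (Fin d) (Fin n) ℝ) (z : Fin n → ℝ) (δ : ℝ) : Conf :=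
  P.exec d n (initialConf U z δ)

/-- The output vector of length `n`: row `0` of array `3`. -/
def Conf.output (n : ℕ) (c : Conf) : Fin n → ℝ :=
  fun j => c.mem 3 0 j

end FrameScaling

end

noncomputable section

namespace FrameScaling

/-! ### A program logic with operation counts -/

/-! Leverage scores do not change when all scale factors are multiplied by a common number, so after
sorting `z` in descending order only the ratios of consecutive entries matter. If the scale factors
after the first k columns are tiny compared with what the first k columns achieve on their own span,
the exact size of that gap hardly matters, so large gaps may be truncated.

The truncation level comes from Gram-Schmidt. Let e_0, e_1, ... be the Gram-Schmidt vectors of the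
sorted columns, R the sum of the squared entries of U, and F_k the product of |e_i|² δ / (5nR) over
the i < k with e_i ≠ 0. Put y_0 = 1 and y_k = max(y_{k-1} z_k / z_{k-1}, F_k). On the span of the
first k columns, the frame operator with weights y is at least nRF_k/δ times the identity
(`floors_mul_norm_sq_le`, by induction, with `quad_step` for one Gram-Schmidt step). At a truncated
gap the remaining weights are at most F_k, so by `sum_abs_lev_sub_le_of_gap` the scores move by at
most 2n · F_k R / (nRF_k/δ) = 2δ. At most n gaps cost at most 2nδ in total
(`sum_abs_lev_scales_le`). Since y ≥ F_n, the numbers y/(F_n δ) are at least 1/δ; rounding them to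
integers is a relative error of at most δ/2, which costs another 3dδ
(`sum_abs_lev_sub_le_of_close`).

The outputs are positive integers of size at most 2/(F_n δ), so their length is governed by F_n. The
product of the nonzero |e_i|² is the square of a nonzero maximal minor of U
(`IsFrame.exists_minor`), and such a minor has a denominator of at most 2^(d²b). Together with d ≤ n
this gives the bound on the bit complexity (`neg_log_floors_le`, `rounded_hasBitComplexity`).

Intermediate numbers stay polynomial because Gram-Schmidt vectors are given by Cramer's rule with
determinants of size at most d (`isFrac_gramSchmidtCols`), and the remaining quantities are short
sums and products (`allValues_isFrac`).

The program uses binary insertion sort, one Gram-Schmidt call, linear scans, and a second round of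
binary searches to undo the sorting. The judgement `Ensures` tracks correctness, legality, operation
counts and written numbers together. At most one column is a separate case, since then log n = 0
permits no comparison. -/

/-- The counts of steps, real comparisons, roundings and matrix operations. -/
def Conf.counts (c : Conf) : ℕ × ℕ × ℕ × ℕ :=
  (c.steps, c.comparisons, c.roundings, c.matrixOps)

/-- The memory `mem` with cell `(r, i, j)` overwritten by `x`. -/
def setCell (mem : ℕ → ℕ → ℕ → ℝ) (r i j : ℕ) (x : ℝ) : ℕ → ℕ → ℕ → ℝ :=
  fun r' i' j' => if r' = r ∧ i' = i ∧ j' = j then x else mem r' i' j'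

/-- Content of a cell for given index registers and memory. -/
def Cell.val (d n : ℕ) (idx : ℕ → ℕ) (mem : ℕ → ℕ → ℕ → ℝ) (l : Cell) : ℝ :=
  mem l.arr (l.row.eval d n idx) (l.col.eval d n idx)

/-- The memory after writing `x` to the cell `l`. -/
def Cell.set (d n : ℕ) (idx : ℕ → ℕ) (mem : ℕ → ℕ → ℕ → ℝ) (l : Cell) (x : ℝ) :
    ℕ → ℕ → ℕ → ℝ :=
  setCell mem l.arr (l.row.eval d n idx) (l.col.eval d n idx) x

/-- Started with registers `idx` and memory `mem`, the program `s` performs no illegal operation,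
stays within the operation counts `κ`, writes only numbers satisfying `w`, and ends with registers
and memory satisfying `Q`. -/
def Ensures (d n : ℕ) (w : ℝ → Prop) (s : Prog) (idx : ℕ → ℕ) (mem : ℕ → ℕ → ℕ → ℝ)
    (κ : ℕ × ℕ × ℕ × ℕ) (Q : (ℕ → ℕ) → (ℕ → ℕ → ℕ → ℝ) → Prop) : Prop :=
  ∀ x : Conf, x.idx = idx → x.mem = mem →
    Q (s.exec d n x).idx (s.exec d n x).mem ∧ (x.legal → (s.exec d n x).legal) ∧
    (s.exec d n x).counts ≤ x.counts + κ ∧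
    ∀ v ∈ (s.exec d n x).written, v ∈ x.written ∨ w v

namespace Ensures

variable {d n : ℕ} {w : ℝ → Prop} {s t : Prog} {idx : ℕ → ℕ} {mem : ℕ → ℕ → ℕ → ℝ}
  {κ κ' κ₁ κ₂ : ℕ × ℕ × ℕ × ℕ} {Q Q' : (ℕ → ℕ) → (ℕ → ℕ → ℕ → ℝ) → Prop}

theorem conseq (h : Ensures d n w s idx mem κ Q) (hκ : κ ≤ κ')
    (hQ : ∀ idx' mem', Q idx' mem' → Q' idx' mem') : Ensures d n w s idx mem κ' Q' := by
  intro x hx hm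
  obtain ⟨h1, h2, h3, h4⟩ := h x hx hm
  exact ⟨hQ _ _ h1, h2, h3.trans (by gcongr), h4⟩

theorem mono (hκ : κ ≤ κ') (h : Ensures d n w s idx mem κ Q) :
    Ensures d n w s idx mem κ' Q :=
  h.conseq hκ fun _ _ h => h

theorem skip (h : Q idx mem) : Ensures d n w .skip idx mem 0 Q := by
  rintro x rfl rfl
  exact ⟨h, id, le_of_eq (add_zero _).symm, fun v hv => Or.inl hv⟩

/-- The postcondition of the first program is itself an `Ensures` about the second one, so proofs
about long programs nest and no intermediate assertions have to be named. -/
theorem seq (h : Ensures d n w s idx mem κ₁ fun idx' mem' => Ensures d n w t idx' mem' κ₂ Q) :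
    Ensures d n w (.seq s t) idx mem (κ₁ + κ₂) Q := by
  intro x hx hm
  obtain ⟨h1, h2, h3, h4⟩ := h x hx hm
  obtain ⟨g1, g2, g3, g4⟩ := h1 _ rfl rfl
  refine ⟨g1, fun h => g2 (h2 h), g3.trans ?_, fun v hv => ?_⟩
  · rw [← add_assoc]; gcongr
  · rcases g4 v hv with h | h
    · exact h4 v h
    · exact Or.inr h

theorem setIdx {v : ℕ} {e : IExpr} (h : Q (Function.update idx v (e.eval d n idx)) mem) :
    Ensures d n w (.setIdx v e) idx mem (1, 0, 0, 0) Q := by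
  rintro x rfl rfl
  exact ⟨h, id, le_rfl, fun v hv => Or.inl hv⟩

theorem ifIdx {e f : IExpr}
    (hs : e.eval d n idx ≤ f.eval d n idx → Ensures d n w s idx mem κ Q)
    (ht : f.eval d n idx < e.eval d n idx → Ensures d n w t idx mem κ Q) :
    Ensures d n w (.ifIdx e f s t) idx mem ((1, 0, 0, 0) + κ) Q := by
  rintro x rfl rfl
  by_cases h : e.eval d n x.idx ≤ f.eval d n x.idx
  · have := hs h x.tick rfl rfl
    simp only [Prog.exec, h, if_true]
    rw [← add_assoc]
    exact this
  · have := ht (not_le.mp h) x.tick rfl rfl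
    simp only [Prog.exec, h, if_false]
    rw [← add_assoc]
    exact this

theorem loop {v : ℕ} {e : IExpr} (I : ℕ → (ℕ → ℕ) → (ℕ → ℕ → ℕ → ℝ) → Prop)
    (h0 : I 0 idx mem)
    (hstep : ∀ k < e.eval d n idx, ∀ idx' mem', I k idx' mem' →
      Ensures d n w s (Function.update idx' v k) mem' κ (I (k + 1)))
    (hQ : ∀ idx' mem', I (e.eval d n idx) idx' mem' → Q idx' mem') :
    Ensures d n w (.loop v e s) idx mem
      ((1, 0, 0, 0) + (e.eval d n idx) • ((1, 0, 0, 0) + κ)) Q := by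
  rintro x rfl rfl
  suffices H : ∀ N ≤ e.eval d n x.idx,
      let y := (List.range N).foldl (fun c' k => s.exec d n (c'.setIdx v k).tick) x.tick
      I N y.idx y.mem ∧ (x.legal → y.legal) ∧
      y.counts ≤ x.counts + ((1, 0, 0, 0) + N • ((1, 0, 0, 0) + κ)) ∧
      ∀ u ∈ y.written, u ∈ x.written ∨ w u by
    obtain ⟨h1, h2, h3, h4⟩ := H _ le_rfl
    exact ⟨hQ _ _ h1, h2, h3, h4⟩
  intro N
  induction N with
  | zero =>
    intro _
    refine ⟨h0, id, ?_, fun v hv => Or.inl hv⟩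
    simp only [zero_smul, add_zero]
    exact le_rfl
  | succ N ih =>
    intro hN
    obtain ⟨h1, h2, h3, h4⟩ := ih (by omega)
    simp only [List.range_succ, List.foldl_append, List.foldl_cons, List.foldl_nil]
    set y := (List.range N).foldl (fun c' k => s.exec d n (c'.setIdx v k).tick) x.tick
    obtain ⟨g1, g2, g3, g4⟩ := hstep N (by omega) _ _ h1 (y.setIdx v N).tick rfl rfl
    refine ⟨g1, fun h => g2 (h2 h), g3.trans ?_, fun u hu => ?_⟩
    · have : (y.setIdx v N).tick.counts = y.counts + (1, 0, 0, 0) := rfl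
      rw [this, succ_nsmul, add_assoc y.counts, ← add_assoc (1, 0, 0, 0) (N • _) _,
        ← add_assoc x.counts]
      gcongr
    · rcases g4 u hu with h | h
      · exact h4 u h
      · exact Or.inr h

theorem const {dst : Cell} {k : ℕ} (hw : w k) (h : Q idx (dst.set d n idx mem k)) :
    Ensures d n w (.const dst k) idx mem (1, 0, 0, 0) Q := by
  rintro x rfl rfl
  refine ⟨h, id, le_rfl, fun v hv => ?_⟩
  rcases hv with rfl | hv
  · exact Or.inr hw
  · exact Or.inl hv

theorem copy {dst a : Cell} (hw : w (a.val d n idx mem))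
    (h : Q idx (dst.set d n idx mem (a.val d n idx mem))) :
    Ensures d n w (.copy dst a) idx mem (1, 0, 0, 0) Q := by
  rintro x rfl rfl
  refine ⟨h, id, le_rfl, fun v hv => ?_⟩
  rcases hv with rfl | hv
  · exact Or.inr hw
  · exact Or.inl hv

theorem arith {op : ArithOp} {dst a b : Cell}
    (hl : op.Legal (a.val d n idx mem) (b.val d n idx mem))
    (hw : w (op.eval (a.val d n idx mem) (b.val d n idx mem)))
    (h : Q idx (dst.set d n idx mem (op.eval (a.val d n idx mem) (b.val d n idx mem)))) :
    Ensures d n w (.arith op dst a b) idx mem (1, 0, 0, 0) Q := by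
  rintro x rfl rfl
  refine ⟨h, fun hx => ⟨hx, hl⟩, le_rfl, fun v hv => ?_⟩
  rcases hv with rfl | hv
  · exact Or.inr hw
  · exact Or.inl hv

theorem round {dst a : Cell} {e : IExpr} (hw : w (roundTo (a.val d n idx mem) (e.eval d n idx)))
    (h : Q idx (dst.set d n idx mem (roundTo (a.val d n idx mem) (e.eval d n idx)))) :
    Ensures d n w (.round dst a e) idx mem (1, 0, 1, 0) Q := by
  rintro x rfl rfl
  refine ⟨h, id, le_rfl, fun v hv => ?_⟩
  rcases hv with rfl | hv
  · exact Or.inr hw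
  · exact Or.inl hv

theorem ifLe {a b : Cell}
    (hs : a.val d n idx mem ≤ b.val d n idx mem → Ensures d n w s idx mem κ Q)
    (ht : b.val d n idx mem < a.val d n idx mem → Ensures d n w t idx mem κ Q) :
    Ensures d n w (.ifLe a b s t) idx mem ((1, 1, 0, 0) + κ) Q := by
  rintro x rfl rfl
  by_cases h : x.read d n a ≤ x.read d n b
  · have := hs h { x.tick with comparisons := x.comparisons + 1 } rfl rfl
    simp only [Prog.exec, h, if_true]
    rw [← add_assoc]
    exact this
  · have := ht (not_le.mp h) { x.tick with comparisons := x.comparisons + 1 } rfl rfl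
    simp only [Prog.exec, h, if_false]
    rw [← add_assoc]
    exact this

theorem gramSchmidt {dst a : ℕ}
    (hw : ∀ i j, w (gramSchmidtCols (Matrix.of fun (i : Fin d) (j : Fin n) => mem a i j) i j))
    (h : Q idx (fun r i j => if h : r = dst ∧ i < d ∧ j < n then
      gramSchmidtCols (Matrix.of fun (i : Fin d) (j : Fin n) => mem a i j) ⟨i, h.2.1⟩ ⟨j, h.2.2⟩
      else mem r i j)) :
    Ensures d n w (.gramSchmidt dst a) idx mem (1, 0, 0, 1) Q := by
  rintro x rfl rfl
  refine ⟨h, id, le_rfl, fun v hv => ?_⟩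
  rcases hv with hv | ⟨i, j, rfl⟩
  · exact Or.inl hv
  · exact Or.inr (hw i j)

end Ensures

/-! ### Binary insertion sort -/

/-- Register `0` becomes a number `L` with `n < 2 ^ L ≤ 2 * n`. -/
def levelsProg : Prog :=
  .seq (.setIdx 1 (.const 1))
    (.loop 2 .cols (.ifIdx (.var 1) .cols
      (.seq (.setIdx 1 (.add (.var 1) (.var 1))) (.setIdx 0 (.add (.var 0) (.const 1)))) .skip))

/-- Register `6` becomes the number of entries at least `x` among the first `len` entries, which
are in descending order, of row `d` of array `4`. -/
def searchProg (x : Cell) (len : IExpr) : Prog :=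
  .seq (.setIdx 6 (.const 0))
    (.loop 3 (.var 0)
      (.seq (.setIdx 5 (.const 1))
        (.seq (.loop 4 (.sub (.sub (.var 0) (.const 1)) (.var 3))
            (.setIdx 5 (.add (.var 5) (.var 5))))
          (.ifIdx (.add (.var 6) (.var 5)) len
            (.ifLe x ⟨4, .rows, .sub (.add (.var 6) (.var 5)) (.const 1)⟩
              (.setIdx 6 (.add (.var 6) (.var 5))) .skip)
            .skip))))

/-- In array `4`, move the columns with numbers from register `6` up to, but excluding, register
`2` to the right by one. -/
def shiftProg : Prog :=
  .loop 7 (.sub (.var 2) (.var 6))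
    (.loop 8 (.add .rows (.const 1))
      (.copy ⟨4, .var 8, .sub (.var 2) (.var 7)⟩
        ⟨4, .var 8, .sub (.sub (.var 2) (.var 7)) (.const 1)⟩))

/-- Column number (register `2`) of `U` and its scale factor are copied to column number
(register `6`) of array `4`. -/
def placeProg : Prog :=
  .seq (.loop 8 .rows (.copy ⟨4, .var 8, .var 6⟩ ⟨0, .var 8, .var 2⟩))
    (.copy ⟨4, .rows, .var 6⟩ ⟨1, .const 0, .var 2⟩)

/-- Sort the columns of `U`, with their scale factors as an additional row, into array `4`. -/
def sortProg : Prog :=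
  .loop 2 .cols (.seq (searchProg ⟨1, .const 0, .var 2⟩ (.var 2)) (.seq shiftProg placeProg))

section

variable {d n : ℕ} {w : ℝ → Prop}

theorem levelsProg_ensures {idx : ℕ → ℕ} {mem : ℕ → ℕ → ℕ → ℝ} (hn : 1 ≤ n) (h0 : idx 0 = 0) :
    Ensures d n w levelsProg idx mem (2 + 4 * n, 0, 0, 0) fun idx' mem' =>
      mem' = mem ∧ n < 2 ^ idx' 0 ∧ 2 ^ idx' 0 ≤ 2 * n := by
  -- Every pass doubles register 1 until it exceeds n. If it never did, the exponent would be at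
  -- least n after n passes, and n < 2 ^ n.
  refine Ensures.mono ?_ (Ensures.seq (Ensures.setIdx (Ensures.loop
    (fun k idx' mem' => mem' = mem ∧ idx' 1 = 2 ^ idx' 0 ∧ 2 ^ idx' 0 ≤ 2 * n ∧
      (n < idx' 1 ∨ k ≤ idx' 0)) ?_ ?_ ?_ (κ := (1, 0, 0, 0) + (2, 0, 0, 0)))))
  · simp only [IExpr.eval, Prod.mk_add_mk, Prod.smul_mk, smul_eq_mul, Prod.mk_le_mk]
    omega
  · simp only [IExpr.eval, Function.update_apply]
    simp [h0]
    omega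
  · rintro k - idx' mem' ⟨h1, h2, h3, h4⟩
    refine Ensures.ifIdx (fun h => Ensures.seq (κ₁ := (1, 0, 0, 0)) (κ₂ := (1, 0, 0, 0))
      (Ensures.setIdx (Ensures.setIdx ?_)))
      (fun h => Ensures.mono (by simp) (Ensures.skip ?_))
    · simp only [IExpr.eval, Function.update_apply] at h ⊢
      simp only [h1, true_and, one_ne_zero, if_true, if_false, zero_ne_one,
        OfNat.one_ne_ofNat] at h ⊢
      simp only [pow_succ]
      split_ifs at * <;> omega
    · simp only [IExpr.eval, Function.update_apply] at h ⊢
      simp only [h1, true_and, OfNat.one_ne_ofNat, OfNat.zero_ne_ofNat, if_false] at h ⊢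
      omega
  · rintro idx' mem' ⟨h1, h2, h3, h4⟩
    refine ⟨h1, ?_, h3⟩
    rcases h4 with h4 | h4
    · omega
    · exact (Nat.lt_two_pow_self).trans_le (Nat.pow_le_pow_right (by norm_num) h4)

/-- The position grows by decreasing powers of two. Invariant: all entries before the position are
at least `X`, and the last of the next 2 ^ (L - k) entries, if it exists, is below `X`. This is
vacuous at the start because m < 2 ^ L, and at the end it concerns the entry at the position itself.
Index expressions cannot halve, so each power is recomputed by doubling, hence the term quadratic in
L. Hypothesis `hm` says that length and key do not depend on the registers 3 to 6 used by the
search. -/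
theorem searchProg_ensures {x : Cell} {len : IExpr} {m : ℕ} {X : ℝ} {idx : ℕ → ℕ}
    {mem : ℕ → ℕ → ℕ → ℝ}
    (hm : ∀ idx' : ℕ → ℕ, (∀ v, v < 3 ∨ 6 < v → idx' v = idx v) →
      len.eval d n idx' = m ∧ x.val d n idx' mem = X)
    (hL : m < 2 ^ idx 0) (hmono : ∀ c c', c ≤ c' → c' < m → mem 4 d c' ≤ mem 4 d c) :
    Ensures d n w (searchProg x len) idx mem (2 + idx 0 * (2 * idx 0 + 6), idx 0, 0, 0)
      fun idx' mem' => mem' = mem ∧ (∀ v, v < 3 ∨ 6 < v → idx' v = idx v) ∧ idx' 6 ≤ m ∧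
        (∀ c < idx' 6, X ≤ mem 4 d c) ∧ ∀ c, idx' 6 ≤ c → c < m → mem 4 d c < X := by
  refine Ensures.mono ?_ (Ensures.seq (Ensures.setIdx (Ensures.loop
    (fun k idx' mem' => mem' = mem ∧ (∀ v, v < 3 ∨ 6 < v → idx' v = idx v) ∧ idx' 6 ≤ m ∧
        (∀ c < idx' 6, X ≤ mem 4 d c) ∧ (idx' 6 + 2 ^ (idx 0 - k) ≤ m →
          mem 4 d (idx' 6 + 2 ^ (idx 0 - k) - 1) < X)) ?_ ?_ ?_ (κ := (5 + 2 * idx 0, 1, 0, 0)))))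
  · simp only [IExpr.eval, Prod.mk_add_mk, Prod.smul_mk, smul_eq_mul, Prod.mk_le_mk,
      Function.update_apply]
    simp
    apply le_of_eq
    ring
  · refine ⟨rfl, fun v hv => Function.update_of_ne (by omega) _ _, ?_⟩
    simp [IExpr.eval]
    omega
  · rintro k hk idx' mem' ⟨rfl, h2, h3, h4, h5⟩
    have hk : k < idx 0 := by simpa [IExpr.eval] using hk
    have h20 := h2 0 (by omega)
    refine Ensures.mono (κ := (1, 0, 0, 0) + (((1, 0, 0, 0) +
      (idx 0 - 1 - k) • ((1, 0, 0, 0) + (1, 0, 0, 0))) +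
        ((1, 0, 0, 0) + ((1, 1, 0, 0) + (1, 0, 0, 0))))) ?_
      (Ensures.seq (Ensures.setIdx (Ensures.seq ?_)))
    · simp only [Prod.mk_add_mk, Prod.smul_mk, smul_eq_mul, Prod.mk_le_mk]
      omega
    · have he : (IExpr.sub (.sub (.var 0) (.const 1)) (.var 3)).eval d n
          (Function.update (Function.update idx' 3 k) 5 ((IExpr.const 1).eval d n
            (Function.update idx' 3 k))) = idx 0 - 1 - k := by
        simp [IExpr.eval, h20]
      rw [← he]
      refine Ensures.loop (fun p idx'' mem'' => mem'' = mem' ∧ idx'' 5 = 2 ^ p ∧ idx'' 6 = idx' 6 ∧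
        (∀ v, v < 3 ∨ 6 < v → idx'' v = idx v)) ?_ ?_ ?_
      · refine ⟨rfl, by simp [IExpr.eval], by simp, fun v hv => ?_⟩
        rw [Function.update_of_ne (by omega), Function.update_of_ne (by omega), h2 v hv]
      · rintro p - idx'' mem'' ⟨rfl, g2, g3, g4⟩
        refine Ensures.setIdx ⟨rfl, ?_, ?_, fun v hv => ?_⟩
        · simp [IExpr.eval, g2, pow_succ]
          ring
        · simp [g3]
        · rw [Function.update_of_ne (by omega), Function.update_of_ne (by omega), g4 v hv]
      · rintro idx'' mem'' ⟨rfl, g2, g3, g4⟩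
        rw [he] at g2
        have hq : idx 0 - 1 - k = idx 0 - (k + 1) := by omega
        rw [hq] at g2
        have hpow : 2 ^ (idx 0 - k) = 2 ^ (idx 0 - (k + 1)) + 2 ^ (idx 0 - (k + 1)) := by
          rw [← two_mul, ← pow_succ']
          congr 1
          omega
        rw [hpow] at h5
        set q := 2 ^ (idx 0 - (k + 1))
        have hq1 : 1 ≤ q := Nat.one_le_two_pow
        obtain ⟨e1, e2⟩ := hm idx'' g4
        refine Ensures.ifIdx (fun h => Ensures.ifLe (fun h' => Ensures.setIdx ?_)
          (fun h' => Ensures.mono (by simp) (Ensures.skip ?_)))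
          (fun h => Ensures.mono (by simp) (Ensures.skip ?_))
        · simp only [IExpr.eval, e1, g2, g3] at h
          rw [e2] at h'
          simp only [Cell.val, IExpr.eval, g2, g3] at h'
          refine ⟨rfl, fun v hv => ?_, ?_, ?_, ?_⟩
          · rw [Function.update_of_ne (by omega), g4 v hv]
          · simpa [IExpr.eval, g2, g3] using h
          · simp only [IExpr.eval, g2, g3, Function.update_self]
            intro c hc
            exact h'.trans (hmono _ _ (by omega) (by omega))
          · simp only [IExpr.eval, g2, g3, Function.update_self]
            intro hc
            rw [add_assoc] at hc ⊢
            exact h5 hc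
        · rw [e2] at h'
          simp only [Cell.val, IExpr.eval, g2, g3] at h'
          refine ⟨rfl, g4, g3 ▸ h3, g3 ▸ h4, fun _ => ?_⟩
          rwa [g3]
        · simp only [IExpr.eval, e1, g2, g3] at h
          refine ⟨rfl, g4, g3 ▸ h3, g3 ▸ h4, fun hc => ?_⟩
          rw [g3] at hc
          omega
  · rintro idx' mem' ⟨rfl, h2, h3, h4, h5⟩
    refine ⟨rfl, h2, h3, h4, fun c hc hcm => ?_⟩
    simp [IExpr.eval] at h5
    exact (hmono _ _ hc hcm).trans_lt (h5 (by omega))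

/-- The columns are moved starting from the right, so each one is copied before it is overwritten.
-/
theorem shiftProg_ensures {idx : ℕ → ℕ} {mem : ℕ → ℕ → ℕ → ℝ} {k p : ℕ} (hk : idx 2 = k)
    (hp : idx 6 = p) (hpk : p ≤ k) (hw : ∀ i ≤ d, ∀ c < k, w (mem 4 i c)) :
    Ensures d n w shiftProg idx mem (1 + (k - p) * (2 + (d + 1) * 2), 0, 0, 0)
      fun idx' mem' => (∀ v < 7, idx' v = idx v) ∧ (∀ r ≠ 4, mem' r = mem r) ∧
        ∀ i ≤ d, ∀ c ≤ k, mem' 4 i c = if p < c then mem 4 i (c - 1) else mem 4 i c := by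
  have he : (IExpr.sub (.var 2) (.var 6)).eval d n idx = k - p := by simp [IExpr.eval, hk, hp]
  refine Ensures.mono ?_ (Ensures.loop (fun t idx' mem' => (∀ v < 7, idx' v = idx v) ∧
    (∀ r ≠ 4, mem' r = mem r) ∧
    ∀ i ≤ d, ∀ c ≤ k, mem' 4 i c = if k - t < c then mem 4 i (c - 1) else mem 4 i c) ?_ ?_ ?_
    (κ := (1, 0, 0, 0) + (d + 1) • ((1, 0, 0, 0) + (1, 0, 0, 0))))
  · rw [he]
    simp only [Prod.mk_add_mk, Prod.smul_mk, smul_eq_mul, Prod.mk_le_mk]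
    simp
    apply le_of_eq
    ring
  · refine ⟨fun _ _ => rfl, fun _ _ => rfl, fun i _ c hc => ?_⟩
    rw [if_neg (by omega)]
  · rintro t ht idx' mem' ⟨h1, h2, h3⟩
    rw [he] at ht
    refine Ensures.loop (fun s idx'' mem'' => idx'' 7 = t ∧ (∀ v < 7, idx'' v = idx v) ∧
      (∀ r ≠ 4, mem'' r = mem r) ∧
      ∀ i ≤ d, ∀ c ≤ k, mem'' 4 i c =
        if k - t < c ∨ (c = k - t ∧ i < s) then mem 4 i (c - 1) else mem 4 i c) ?_ ?_ ?_
    · refine ⟨by simp, fun v hv => ?_, h2, fun i hi c hc => ?_⟩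
      · rw [Function.update_of_ne (by omega), h1 v hv]
      · rw [h3 i hi c hc]
        simp
    · rintro s hs idx'' mem'' ⟨g1, g2, g3, g4⟩
      have hs : s < d + 1 := by simpa [IExpr.eval] using hs
      have hval : Cell.val d n (Function.update idx'' 8 s) mem''
          ⟨4, .var 8, .sub (.sub (.var 2) (.var 7)) (.const 1)⟩ = mem 4 s (k - t - 1) := by
        simp only [Cell.val, IExpr.eval, Function.update_apply]
        simp only [Nat.reduceEqDiff, if_true, if_false, g1, g2 2 (by omega),
          hk]
        rw [g4 _ (by omega) _ (by omega), if_neg (by omega)]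
      have hset : ∀ y, Cell.set d n (Function.update idx'' 8 s) mem''
          ⟨4, .var 8, .sub (.var 2) (.var 7)⟩ y = setCell mem'' 4 s (k - t) y := by
        intro y
        simp only [Cell.set, IExpr.eval, Function.update_apply]
        simp only [Nat.reduceEqDiff, if_true, if_false, g1, g2 2 (by omega),
          hk]
      refine Ensures.copy ?_ ?_
      · rw [hval]
        exact hw _ (by omega) _ (by omega)
      · rw [hval, hset]
        refine ⟨by simp [g1], fun v hv => ?_, fun r hr => ?_, fun i hi c hc => ?_⟩
        · rw [Function.update_of_ne (by omega), g2 v hv]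
        · rw [← g3 r hr]
          ext i j
          simp [setCell, hr]
        · simp only [setCell, true_and]
          split_ifs with h h' h'
          · rw [h.1, h.2]
          · omega
          · rw [g4 i hi c hc, if_pos (by omega)]
          · rw [g4 i hi c hc, if_neg (by omega)]
    · rintro idx'' mem'' ⟨-, g2, g3, g4⟩
      refine ⟨g2, g3, fun i hi c hc => ?_⟩
      rw [g4 i hi c hc]
      simp only [IExpr.eval]
      refine if_congr ?_ rfl rfl
      omega
  · rintro idx' mem' ⟨h1, h2, h3⟩
    refine ⟨h1, h2, fun i hi c hc => ?_⟩
    rw [h3 i hi c hc, he]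
    refine if_congr ?_ rfl rfl
    omega

theorem placeProg_ensures {idx : ℕ → ℕ} {mem : ℕ → ℕ → ℕ → ℝ} {k p : ℕ} (hk : idx 2 = k)
    (hp : idx 6 = p) (hw : ∀ i < d, w (mem 0 i k)) (hw' : w (mem 1 0 k)) :
    Ensures d n w placeProg idx mem (2 + d * 2, 0, 0, 0)
      fun idx' mem' => (∀ v < 7, idx' v = idx v) ∧ (∀ r ≠ 4, mem' r = mem r) ∧
        (∀ i < d, mem' 4 i p = mem 0 i k) ∧ mem' 4 d p = mem 1 0 k ∧
        ∀ i ≤ d, ∀ c ≠ p, mem' 4 i c = mem 4 i c := by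
  refine Ensures.mono ?_ (Ensures.seq (Ensures.loop (fun s idx' mem' => (∀ v < 7, idx' v = idx v) ∧
    (∀ r ≠ 4, mem' r = mem r) ∧ (∀ i < s, mem' 4 i p = mem 0 i k) ∧
    ∀ i ≤ d, ∀ c ≠ p, mem' 4 i c = mem 4 i c) ?_ ?_ ?_ (κ := (1, 0, 0, 0)))
    (κ₂ := (1, 0, 0, 0)))
  · simp only [IExpr.eval, Prod.mk_add_mk, Prod.smul_mk, smul_eq_mul, Prod.mk_le_mk]
    omega
  · exact ⟨fun _ _ => rfl, fun _ _ => rfl, fun i hi => absurd hi (by omega), fun _ _ _ _ => rfl⟩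
  · rintro s hs idx' mem' ⟨h1, h2, h3, h4⟩
    have hs : s < d := hs
    have hval : Cell.val d n (Function.update idx' 8 s) mem' ⟨0, .var 8, .var 2⟩ = mem 0 s k := by
      simp only [Cell.val, IExpr.eval, Function.update_apply]
      simp [h1 2 (by omega), hk, h2 0]
    have hset : ∀ y, Cell.set d n (Function.update idx' 8 s) mem'
        ⟨4, .var 8, .var 6⟩ y = setCell mem' 4 s p y := by
      intro y
      simp only [Cell.set, IExpr.eval, Function.update_apply]
      simp [h1 6 (by omega), hp]
    refine Ensures.copy ?_ ?_
    · rw [hval]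
      exact hw s hs
    · rw [hval, hset]
      refine ⟨fun v hv => ?_, fun r hr => ?_, fun i hi => ?_, fun i hi c hc => ?_⟩
      · rw [Function.update_of_ne (by omega), h1 v hv]
      · rw [← h2 r hr]
        ext i j
        simp [setCell, hr]
      · simp only [setCell, true_and, and_true]
        split_ifs with h
        · rw [h]
        · exact h3 i (by omega)
      · rw [← h4 i hi c hc]
        simp [setCell, hc]
  · rintro idx' mem' ⟨h1, h2, h3, h4⟩
    have hval : Cell.val d n idx' mem' ⟨1, .const 0, .var 2⟩ = mem 1 0 k := by
      simp only [Cell.val, IExpr.eval]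
      simp [h1 2 (by omega), hk, h2 1]
    have hset : ∀ y, Cell.set d n idx' mem' ⟨4, .rows, .var 6⟩ y = setCell mem' 4 d p y := by
      intro y
      simp only [Cell.set, IExpr.eval]
      simp [h1 6 (by omega), hp]
    refine Ensures.copy ?_ ?_
    · rw [hval]
      exact hw'
    · rw [hval, hset]
      refine ⟨h1, fun r hr => ?_, fun i hi => ?_, ?_, fun i hi c hc => ?_⟩
      · rw [← h2 r hr]
        ext i j
        simp [setCell, hr]
      · rw [← h3 i hi]
        simp [setCell, hi.ne]
      · simp [setCell]
      · rw [← h4 i hi c hc]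
        simp [setCell, hc]

/-- The first `k` columns of array `4` are the first `k` columns of `U` and entries of `z`, in
the order `σ`, which is descending in `z`. -/
structure SortedPrefix (d k : ℕ) (mem : ℕ → ℕ → ℕ → ℝ) (σ : ℕ → ℕ) : Prop where
  lt : ∀ c < k, σ c < k
  ne : ∀ c c', c < c' → c' < k → σ c ≠ σ c'
  col : ∀ c < k, ∀ i < d, mem 4 i c = mem 0 i (σ c)
  key : ∀ c < k, mem 4 d c = mem 1 0 (σ c)
  anti : ∀ c c', c ≤ c' → c' < k → mem 4 d c' ≤ mem 4 d c

theorem SortedPrefix.insert {k p : ℕ} {mem mem' : ℕ → ℕ → ℕ → ℝ} {σ : ℕ → ℕ}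
    (h : SortedPrefix d k mem σ) (hp : p ≤ k) (hlo : ∀ c < p, mem 1 0 k ≤ mem 4 d c)
    (hhi : ∀ c, p ≤ c → c < k → mem 4 d c < mem 1 0 k)
    (h0 : mem' 0 = mem 0) (h1 : mem' 1 = mem 1) (hcol : ∀ i < d, mem' 4 i p = mem 0 i k)
    (hkey : mem' 4 d p = mem 1 0 k)
    (hother : ∀ i ≤ d, ∀ c ≤ k, c ≠ p →
      mem' 4 i c = if p < c then mem 4 i (c - 1) else mem 4 i c) :
    SortedPrefix d (k + 1) mem' fun c => if c < p then σ c else if c = p then k else σ (c - 1) where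
  lt c hc := by
    have := h.lt c
    have := h.lt (c - 1)
    split_ifs <;> omega
  ne c c' hc hc' := by
    have h1 := h.ne c c'
    have h2 := h.ne c (c' - 1)
    have h3 := h.ne (c - 1) (c' - 1)
    have h4 := h.lt c
    have h5 := h.lt (c' - 1)
    split_ifs <;> omega
  col c hc i hi := by
    rcases lt_trichotomy c p with hcp | rfl | hcp
    · rw [hother i hi.le c (by omega) (by omega), if_neg (by omega), if_pos hcp, h0,
        h.col c (by omega) i hi]
    · rw [hcol i hi, if_neg (by omega), if_pos rfl, h0]
    · rw [hother i hi.le c (by omega) (by omega), if_pos hcp, if_neg (by omega),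
        if_neg (by omega), h0, h.col _ (by omega) i hi]
  key c hc := by
    rcases lt_trichotomy c p with hcp | rfl | hcp
    · rw [hother d le_rfl c (by omega) (by omega), if_neg (by omega), if_pos hcp, h1,
        h.key c (by omega)]
    · rw [hkey, if_neg (by omega), if_pos rfl, h1]
    · rw [hother d le_rfl c (by omega) (by omega), if_pos hcp, if_neg (by omega),
        if_neg (by omega), h1, h.key _ (by omega)]
  anti c c' hc hc' := by
    rcases lt_trichotomy c p with hcp | rfl | hcp
    · rw [hother d le_rfl c (by omega) (by omega), if_neg (by omega)]
      rcases lt_trichotomy c' p with hcp' | rfl | hcp'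
      · rw [hother d le_rfl c' (by omega) (by omega), if_neg (by omega)]
        exact h.anti _ _ hc (by omega)
      · rw [hkey]
        exact hlo c hcp
      · rw [hother d le_rfl c' (by omega) (by omega), if_pos hcp']
        exact h.anti _ _ (by omega) (by omega)
    · rcases hc.eq_or_lt with rfl | hcp'
      · exact le_rfl
      · rw [hkey, hother d le_rfl c' (by omega) (by omega), if_pos hcp']
        exact (hhi _ (by omega) (by omega)).le
    · rw [hother d le_rfl c (by omega) (by omega), hother d le_rfl c' (by omega) (by omega),
        if_pos hcp, if_pos (by omega)]
      exact h.anti _ _ (by omega) (by omega)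

theorem sortProg_ensures {idx : ℕ → ℕ} {mem : ℕ → ℕ → ℕ → ℝ} {L : ℕ} (h0 : idx 0 = L)
    (hL : n < 2 ^ L) (hw : ∀ i < d, ∀ j < n, w (mem 0 i j)) (hw' : ∀ j < n, w (mem 1 0 j)) :
    Ensures d n w sortProg idx mem
      (1 + n * (6 + L * (2 * L + 6) + n * (2 + (d + 1) * 2) + d * 2), n * L, 0, 0)
      fun idx' mem' => idx' 0 = L ∧ (∀ r ≠ 4, mem' r = mem r) ∧ ∃ σ, SortedPrefix d n mem' σ := by
  refine Ensures.mono ?_ (Ensures.loop (fun k idx' mem' => idx' 0 = L ∧ (∀ r ≠ 4, mem' r = mem r) ∧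
    ∃ σ, SortedPrefix d k mem' σ) ?_ ?_ ?_
    (κ := (2 + L * (2 * L + 6), L, 0, 0) + ((1 + n * (2 + (d + 1) * 2), 0, 0, 0) +
      (2 + d * 2, 0, 0, 0))))
  · simp only [IExpr.eval, Prod.mk_add_mk, Prod.smul_mk, smul_eq_mul, Prod.mk_le_mk]
    simp
    apply le_of_eq
    ring
  · exact ⟨h0, fun _ _ => rfl, id, by constructor <;> intros <;> omega⟩
  · rintro k hk idx' mem' ⟨h1, h2, σ, h3⟩
    have hk : k < n := hk
    refine Ensures.seq (Ensures.conseq (searchProg_ensures (m := k) (X := mem' 1 0 k) ?_ ?_ h3.anti)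
      ?_ ?_)
    · intro idx'' h
      have := h 2 (by omega)
      simp [IExpr.eval, Cell.val, this]
    · simp [h1]
      omega
    · simp [h1]
    rintro idx'' mem'' ⟨rfl, g2, g3, g4, g5⟩
    have hk2 : idx'' 2 = k := by rw [g2 2 (by omega)]; simp
    have h00 : idx'' 0 = L := by rw [g2 0 (by omega)]; simp [h1]
    refine Ensures.seq (Ensures.conseq (shiftProg_ensures hk2 rfl g3 fun i hi c hc => ?_) ?_ ?_)
    · rcases hi.lt_or_eq with hi | rfl
      · rw [h3.col c hc i hi, h2 0 (by omega)]
        exact hw i hi _ ((h3.lt c hc).trans hk)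
      · rw [h3.key c hc, h2 1 (by omega)]
        exact hw' _ ((h3.lt c hc).trans hk)
    · simp only [Prod.mk_le_mk]
      refine ⟨?_, le_rfl, le_rfl, le_rfl⟩
      gcongr
      omega
    rintro idx₃ mem₃ ⟨e1, e2, e3⟩
    refine Ensures.conseq (placeProg_ensures (k := k) (p := idx'' 6) ?_ ?_ ?_ ?_) le_rfl ?_
    · rw [e1 2 (by omega), hk2]
    · rw [e1 6 (by omega)]
    · intro i hi
      rw [e2 0 (by omega), h2 0 (by omega)]
      exact hw i hi k hk
    · rw [e2 1 (by omega), h2 1 (by omega)]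
      exact hw' k hk
    rintro idx₄ mem₄ ⟨f1, f2, f3, f4, f5⟩
    refine ⟨by rw [f1 0 (by omega), e1 0 (by omega), h00],
      fun r hr => by rw [f2 r hr, e2 r hr, h2 r hr], _,
      h3.insert g3 g4 g5 (by rw [f2 0 (by omega), e2 0 (by omega)])
        (by rw [f2 1 (by omega), e2 1 (by omega)]) ?_ ?_ ?_⟩
    · intro i hi
      rw [f3 i hi, e2 0 (by omega)]
    · rw [f4, e2 1 (by omega)]
    · intro i hi c hc hcp
      rw [f5 i hi c hcp, e3 i hi c hc]
  · rintro idx' mem' h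
    exact h

end

/-! ### Computing the truncated scale factors -/

/-- The cell `(0, 0)` of array `a`. -/
def scalar (a : ℕ) : Cell := ⟨a, .const 0, .const 0⟩

/-- The squared norm of column `k`, which has `d` entries. -/
def colSq (d : ℕ) (g : ℕ → ℕ → ℝ) (k : ℕ) : ℝ :=
  ∑ i ∈ Finset.range d, g i k * g i k

/-- The sum of the squared norms of the first `n` columns. -/
def totalSq (d n : ℕ) (g : ℕ → ℕ → ℝ) : ℝ :=
  ∑ k ∈ Finset.range n, colSq d g k

/-- Lower bounds for the truncated scale factors; `e k` is the squared distance of the `k`-th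
column from the span of the columns before it. -/
def floorSeq (δ W : ℝ) (e : ℕ → ℝ) : ℕ → ℝ
  | 0 => 1
  | k + 1 => if e k ≤ 0 then floorSeq δ W e k else floorSeq δ W e k * (e k * δ / W)

/-- The truncated scale factors. -/
def scaleSeq (F z : ℕ → ℝ) : ℕ → ℝ
  | 0 => 1
  | k + 1 =>
    if scaleSeq F z k * z (k + 1) / z k ≤ F (k + 1) then F (k + 1)
    else scaleSeq F z k * z (k + 1) / z k

/-- Add the squared norm of column number (register `2`) of array `a` to a scalar. -/
def colSqProg (a dst : ℕ) : Prog :=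
  .loop 8 .rows
    (.seq (.arith .mul (scalar 8) ⟨a, .var 8, .var 2⟩ ⟨a, .var 8, .var 2⟩)
      (.arith .add (scalar dst) (scalar dst) (scalar 8)))

/-- Scalar `9` becomes `5 * n` times the sum of the squared entries of array `4`. -/
def normProg : Prog :=
  .seq (.loop 2 .cols (colSqProg 4 7))
    -- An index cannot be loaded into a real cell, so the factor n is produced by repeated addition.
    (.seq (.loop 2 .cols (.arith .add (scalar 9) (scalar 9) (scalar 7)))
      (.seq (.const (scalar 8) 5) (.arith .mul (scalar 9) (scalar 9) (scalar 8))))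

/-- Compute the next truncated scale factor. -/
def scaleStep : Prog :=
  .ifIdx (.var 2) (.const 0) (.const ⟨6, .const 0, .var 2⟩ 1)
    (.seq (.arith .mul (scalar 8) ⟨6, .const 0, .sub (.var 2) (.const 1)⟩ ⟨4, .rows, .var 2⟩)
      (.seq (.arith .div (scalar 8) (scalar 8) ⟨4, .rows, .sub (.var 2) (.const 1)⟩)
        (.ifLe (scalar 8) (scalar 10) (.copy ⟨6, .const 0, .var 2⟩ (scalar 10))
          (.copy ⟨6, .const 0, .var 2⟩ (scalar 8)))))

/-- Update the lower bound for the truncated scale factors. -/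
def floorStep : Prog :=
  .seq (.const (scalar 11) 0)
    (.seq (colSqProg 5 11)
      -- Array 12 is never written, so its cell serves as the constant 0.
      (.ifLe (scalar 11) (scalar 12) .skip
        (.seq (.arith .mul (scalar 8) (scalar 11) (scalar 2))
          (.seq (.arith .div (scalar 8) (scalar 8) (scalar 9))
            (.arith .mul (scalar 10) (scalar 10) (scalar 8))))))

/-- Compute the truncated scale factors. -/
def scaleProg : Prog :=
  .seq (.const (scalar 10) 1) (.loop 2 .cols (.seq scaleStep floorStep))

/-- Round the truncated scale factors, and write them in the original order. -/
def outputProg : Prog :=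
  .seq (.arith .mul (scalar 13) (scalar 10) (scalar 2))
    (.loop 2 .cols
      -- The sorting permutation is not stored: there are no arrays of indices. Instead each
      -- original key is searched among the sorted ones. Register 6 then counts the keys at least as
      -- large, so the position before it carries an equal key.
      (.seq (searchProg ⟨1, .const 0, .var 2⟩ .cols)
        (.seq (.arith .div (scalar 8) ⟨6, .const 0, .sub (.var 6) (.const 1)⟩ (scalar 13))
          (.round ⟨3, .const 0, .var 2⟩ (scalar 8) (.const 0)))))

section

variable {d n : ℕ} {w : ℝ → Prop}

theorem setCell_of_ne {mem : ℕ → ℕ → ℕ → ℝ} {r r' : ℕ} (h : r' ≠ r) (i j : ℕ) (x : ℝ) :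
    setCell mem r i j x r' = mem r' := by
  ext i' j'
  simp [setCell, h]

theorem setCell_self (mem : ℕ → ℕ → ℕ → ℝ) (r i j : ℕ) (x : ℝ) :
    setCell mem r i j x r i j = x := by
  simp [setCell]

theorem scalar_val (idx : ℕ → ℕ) (mem : ℕ → ℕ → ℕ → ℝ) (a : ℕ) :
    (scalar a).val d n idx mem = mem a 0 0 := rfl

theorem scalar_set (idx : ℕ → ℕ) (mem : ℕ → ℕ → ℕ → ℝ) (a : ℕ) (x : ℝ) :
    (scalar a).set d n idx mem x = setCell mem a 0 0 x := rfl

theorem colSqProg_ensures {idx : ℕ → ℕ} {mem : ℕ → ℕ → ℕ → ℝ} {a dst k : ℕ} {g : ℕ → ℕ → ℝ}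
    {s : ℝ} (hk : idx 2 = k) (ha : a ≠ 8) (ha' : a ≠ dst) (hdst : dst ≠ 8) (hg : ∀ i < d, mem a i k = g i k)
    (hs : mem dst 0 0 = s) (hw : ∀ i < d, w (g i k * g i k))
    (hw' : ∀ i ≤ d, w (s + colSq i g k)) :
    Ensures d n w (colSqProg a dst) idx mem (1 + d * 3, 0, 0, 0) fun idx' mem' =>
      (∀ v < 8, idx' v = idx v) ∧ (∀ r, r ≠ 8 → r ≠ dst → mem' r = mem r) ∧
      mem' dst 0 0 = s + colSq d g k := by
  refine Ensures.mono ?_ (Ensures.loop (fun i idx' mem' => (∀ v < 8, idx' v = idx v) ∧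
    (∀ r, r ≠ 8 → r ≠ dst → mem' r = mem r) ∧ mem' dst 0 0 = s + colSq i g k) ?_ ?_ ?_
    (κ := (1, 0, 0, 0) + (1, 0, 0, 0)))
  · simp only [IExpr.eval, Prod.mk_add_mk, Prod.smul_mk, smul_eq_mul, Prod.mk_le_mk]
    simp
  · exact ⟨fun _ _ => rfl, fun _ _ _ => rfl, by simp [hs, colSq]⟩
  · rintro i hi idx' mem' ⟨h1, h2, h3⟩
    have hi : i < d := hi
    have hval : Cell.val d n (Function.update idx' 8 i) mem' ⟨a, .var 8, .var 2⟩ = g i k := by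
      simp [Cell.val, IExpr.eval, h1 2, hk, h2 a ha ha', hg i hi]
    have hsum : s + colSq i g k + g i k * g i k = s + colSq (i + 1) g k := by
      rw [colSq, colSq, Finset.sum_range_succ, add_assoc]
    refine Ensures.seq (Ensures.arith trivial ?_ (Ensures.arith trivial ?_ ?_))
    · rw [hval]
      exact hw i hi
    · rw [hval, scalar_set, scalar_val, scalar_val, setCell_of_ne hdst, setCell_self, h3]
      simp only [ArithOp.eval]
      rw [hsum]
      exact hw' _ hi
    · rw [hval, scalar_set, scalar_set, scalar_val, scalar_val, setCell_of_ne hdst, setCell_self,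
        h3]
      simp only [ArithOp.eval]
      rw [hsum]
      refine ⟨fun v hv => ?_, fun r hr hr' => ?_, ?_⟩
      · rw [Function.update_of_ne (by omega), h1 v hv]
      · rw [setCell_of_ne hr', setCell_of_ne hr, h2 r hr hr']
      · rw [setCell_self]
  · rintro idx' mem' h
    exact h

theorem normProg_ensures {idx : ℕ → ℕ} {mem : ℕ → ℕ → ℕ → ℝ} {g : ℕ → ℕ → ℝ}
    (hg : ∀ k < n, ∀ i < d, mem 4 i k = g i k) (h7 : mem 7 0 0 = 0) (h9 : mem 9 0 0 = 0)
    (hw5 : w (5 : ℕ)) (hw : ∀ k < n, ∀ i < d, w (g i k * g i k))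
    (hw' : ∀ k < n, ∀ i ≤ d, w (totalSq d k g + colSq i g k))
    (hw'' : ∀ k ≤ n, w (k * totalSq d n g)) (hW : w (n * totalSq d n g * 5)) :
    Ensures d n w normProg idx mem (4 + n * (4 + d * 3), 0, 0, 0) fun idx' mem' =>
      idx' 0 = idx 0 ∧ (∀ r, r ≠ 7 → r ≠ 8 → r ≠ 9 → mem' r = mem r) ∧
      mem' 9 0 0 = n * totalSq d n g * 5 := by
  refine Ensures.mono ?_ (Ensures.seq (Ensures.loop (fun k idx' mem' => idx' 0 = idx 0 ∧
    (∀ r, r ≠ 7 → r ≠ 8 → mem' r = mem r) ∧ mem' 7 0 0 = totalSq d k g) ?_ ?_ ?_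
    (κ := (1 + d * 3, 0, 0, 0))) (κ₂ := (3 + n * 2, 0, 0, 0)))
  · simp only [IExpr.eval, Prod.mk_add_mk, Prod.smul_mk, smul_eq_mul, Prod.mk_le_mk]
    simp
    apply le_of_eq
    ring
  · exact ⟨rfl, fun _ _ _ => rfl, by simp [h7, totalSq]⟩
  · rintro k hk idx' mem' ⟨h1, h2, h3⟩
    refine Ensures.conseq (colSqProg_ensures (k := k) (g := g) (by simp) (by omega) (by omega)
      (by omega) (fun i hi => by rw [h2 4 (by omega) (by omega), hg k hk i hi]) h3 (hw k hk) (hw' k hk)) le_rfl ?_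
    rintro idx'' mem'' ⟨g1, g2, g3⟩
    refine ⟨by rw [g1 0 (by omega)]; simp [h1], fun r hr hr' => by rw [g2 r hr' hr, h2 r hr hr'],
      ?_⟩
    rw [g3, totalSq, totalSq, Finset.sum_range_succ]
  · rintro idx' mem' ⟨h1, h2, h3⟩
    refine Ensures.mono ?_ (Ensures.seq (Ensures.loop (fun k idx' mem' => idx' 0 = idx 0 ∧
      (∀ r, r ≠ 7 → r ≠ 8 → r ≠ 9 → mem' r = mem r) ∧ mem' 7 0 0 = totalSq d n g ∧
      mem' 9 0 0 = k * totalSq d n g) ?_ ?_ ?_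
      (κ := (1, 0, 0, 0))) (κ₂ := (1, 0, 0, 0) + (1, 0, 0, 0)))
    · simp only [IExpr.eval, Prod.mk_add_mk, Prod.smul_mk, smul_eq_mul, Prod.mk_le_mk]
      omega
    · exact ⟨h1, fun r hr hr' _ => h2 r hr hr', h3,
        by rw [h2 9 (by omega) (by omega), h9]; simp⟩
    · rintro k hk idx'' mem'' ⟨g1, g2, g3, g4⟩
      have hk : k < n := hk
      have hsum : (k : ℝ) * totalSq d n g + totalSq d n g = ((k + 1 : ℕ) : ℝ) * totalSq d n g := by
        push_cast
        ring
      refine Ensures.arith trivial ?_ ?_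
      · rw [scalar_val, scalar_val, g3, g4]
        simp only [ArithOp.eval]
        rw [hsum]
        exact hw'' _ hk
      · rw [scalar_val, scalar_val, g3, g4, scalar_set]
        simp only [ArithOp.eval]
        rw [hsum]
        refine ⟨by simp [g1], fun r hr hr' hr'' => ?_, ?_, ?_⟩
        · rw [setCell_of_ne hr'', g2 r hr hr' hr'']
        · rw [setCell_of_ne (by omega), g3]
        · rw [setCell_self]
    · rintro idx'' mem'' ⟨g1, g2, g3, g4⟩
      refine Ensures.seq (Ensures.const hw5 (Ensures.arith trivial ?_ ?_))
      · rw [scalar_val, scalar_val, scalar_set, setCell_of_ne (by omega), setCell_self, g4]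
        exact hW
      · rw [scalar_val, scalar_val, scalar_set, scalar_set, setCell_of_ne (by omega),
          setCell_self, g4]
        refine ⟨g1, fun r hr hr' hr'' => ?_, ?_⟩
        · rw [setCell_of_ne hr'', setCell_of_ne hr', g2 r hr hr' hr'']
        · rw [setCell_self]
          rfl

theorem scaleStep_ensures {idx : ℕ → ℕ} {mem : ℕ → ℕ → ℕ → ℝ} {k : ℕ} {F z : ℕ → ℝ}
    (hk : idx 2 = k) (hF : mem 10 0 0 = F k) (hz : ∀ c ≤ k, mem 4 d c = z c) (hz0 : ∀ c ≤ k, z c ≠ 0)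
    (hy : ∀ c < k, mem 6 0 c = scaleSeq F z c) (hw1 : w (1 : ℕ)) (hwF : w (F k))
    (hw : ∀ c < k, w (scaleSeq F z c * z (c + 1)))
    (hw' : ∀ c < k, w (scaleSeq F z c * z (c + 1) / z c)) :
    Ensures d n w scaleStep idx mem (5, 1, 0, 0) fun idx' mem' =>
      idx' = idx ∧ (∀ r, r ≠ 6 → r ≠ 8 → mem' r = mem r) ∧
      ∀ c ≤ k, mem' 6 0 c = scaleSeq F z c := by
  refine Ensures.mono (κ := (1, 0, 0, 0) + ((1, 0, 0, 0) + ((1, 0, 0, 0) +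
    ((1, 1, 0, 0) + (1, 0, 0, 0))))) (by simp) (Ensures.ifIdx (fun h => ?_) (fun h => ?_))
  · simp only [IExpr.eval, hk, Nat.le_zero] at h
    subst h
    refine Ensures.mono (by simp) (Ensures.const hw1 ⟨rfl, fun r hr hr' => ?_, fun c hc => ?_⟩)
    · exact setCell_of_ne hr _ _ _
    · obtain rfl : c = 0 := by omega
      simp [Cell.set, setCell, IExpr.eval, hk, scaleSeq]
  · simp only [IExpr.eval, hk] at h
    obtain ⟨k, rfl⟩ : ∃ m, k = m + 1 := ⟨k - 1, by omega⟩
    have v1 : Cell.val d n idx mem ⟨6, .const 0, .sub (.var 2) (.const 1)⟩ = scaleSeq F z k := by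
      simp [Cell.val, IExpr.eval, hk, hy]
    have v2 : Cell.val d n idx mem ⟨4, .rows, .var 2⟩ = z (k + 1) := by
      simp [Cell.val, IExpr.eval, hk, hz]
    have v3 : ∀ x, Cell.val d n idx (setCell mem 8 0 0 x)
        ⟨4, .rows, .sub (.var 2) (.const 1)⟩ = z k := by
      simp [Cell.val, IExpr.eval, hk, setCell_of_ne, hz k]
    have hset : ∀ mem x, Cell.set d n idx mem ⟨6, .const 0, .var 2⟩ x =
        setCell mem 6 0 (k + 1) x := by
      simp [Cell.set, IExpr.eval, hk]
    refine Ensures.seq (Ensures.arith trivial ?_ (Ensures.seq (Ensures.arith ?_ ?_ ?_)))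
    · rw [v1, v2]
      exact hw k (by omega)
    · rw [scalar_set, v3]
      exact hz0 k (by omega)
    · rw [scalar_set, v3, v1, v2, scalar_val, setCell_self]
      exact hw' k (by omega)
    · rw [scalar_set, scalar_set, v3, v1, v2, scalar_val, setCell_self]
      simp only [ArithOp.eval]
      have hpost : ∀ mem' : ℕ → ℕ → ℕ → ℝ, (∀ r, r ≠ 6 → r ≠ 8 → mem' r = mem r) →
          (∀ c ≤ k, mem' 6 0 c = mem 6 0 c) → mem' 6 0 (k + 1) = scaleSeq F z (k + 1) →
          ∀ c ≤ k + 1, mem' 6 0 c = scaleSeq F z c := by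
        intro mem' _ h2 h3 c hc
        rcases hc.eq_or_lt with rfl | hc
        · exact h3
        · rw [h2 c (by omega), hy c hc]
      refine Ensures.ifLe (fun h' => Ensures.copy ?_ ?_) (fun h' => Ensures.copy ?_ ?_)
      · rw [scalar_val, setCell_of_ne (by omega), setCell_of_ne (by omega), hF]
        exact hwF
      · rw [scalar_val, scalar_val, setCell_self, setCell_of_ne (by omega),
          setCell_of_ne (by omega), hF] at h'
        rw [scalar_val, hset, setCell_of_ne (r' := 10) (by omega),
          setCell_of_ne (r' := 10) (by omega), hF]
        have h1 : ∀ r, r ≠ 6 → r ≠ 8 → setCell (setCell (setCell mem 8 0 0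
          (scaleSeq F z k * z (k + 1))) 8 0 0 (scaleSeq F z k * z (k + 1) / z k)) 6 0 (k + 1)
            (F (k + 1)) r = mem r := fun r hr hr' => by
          rw [setCell_of_ne hr, setCell_of_ne hr', setCell_of_ne hr']
        refine ⟨rfl, h1, hpost _ h1 (fun c hc => ?_) ?_⟩
        · simp [setCell]
          omega
        · rw [setCell_self, scaleSeq, if_pos h']
      · rw [scalar_val, setCell_self]
        exact hw' k (by omega)
      · rw [scalar_val, scalar_val, setCell_self, setCell_of_ne (by omega),
          setCell_of_ne (by omega), hF] at h'
        rw [scalar_val, hset, setCell_self]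
        have h1 : ∀ r, r ≠ 6 → r ≠ 8 → setCell (setCell (setCell mem 8 0 0
          (scaleSeq F z k * z (k + 1))) 8 0 0 (scaleSeq F z k * z (k + 1) / z k)) 6 0 (k + 1)
            (scaleSeq F z k * z (k + 1) / z k) r = mem r := fun r hr hr' => by
          rw [setCell_of_ne hr, setCell_of_ne hr', setCell_of_ne hr']
        refine ⟨rfl, h1, hpost _ h1 (fun c hc => ?_) ?_⟩
        · simp [setCell]
          omega
        · rw [setCell_self, scaleSeq, if_neg (not_le.mpr h')]

theorem floorStep_ensures {idx : ℕ → ℕ} {mem : ℕ → ℕ → ℕ → ℝ} {k : ℕ} {g : ℕ → ℕ → ℝ} {δ W : ℝ}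
    (hk : idx 2 = k) (hF : mem 10 0 0 = floorSeq δ W (colSq d g) k)
    (hg : ∀ i < d, mem 5 i k = g i k)
    (hδ : mem 2 0 0 = δ) (hW : mem 9 0 0 = W) (h12 : mem 12 0 0 = 0)
    (hW0 : 0 < colSq d g k → W ≠ 0)
    (hw0 : w (0 : ℕ)) (hw : ∀ i < d, w (g i k * g i k)) (hw' : ∀ i ≤ d, w (colSq i g k))
    (hwδ : w (colSq d g k * δ)) (hwW : w (colSq d g k * δ / W))
    (hwF : w (floorSeq δ W (colSq d g) k * (colSq d g k * δ / W))) :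
    Ensures d n w floorStep idx mem (6 + d * 3, 1, 0, 0) fun idx' mem' =>
      (∀ v < 8, idx' v = idx v) ∧ (∀ r, r ≠ 8 → r ≠ 10 → r ≠ 11 → mem' r = mem r) ∧
      mem' 10 0 0 = floorSeq δ W (colSq d g) (k + 1) := by
  refine Ensures.mono (κ := (1, 0, 0, 0) + ((1 + d * 3, 0, 0, 0) + ((1, 1, 0, 0) + ((1, 0, 0, 0) +
    ((1, 0, 0, 0) + (1, 0, 0, 0)))))) ?_ (Ensures.seq (Ensures.const hw0 (Ensures.seq
    (Ensures.conseq (colSqProg_ensures (k := k) (g := g) (s := 0) hk ?_ ?_ ?_ ?_ ?_ hw ?_)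
      le_rfl ?_))))
  · simp only [Prod.mk_add_mk, Prod.mk_le_mk]
    omega
  · omega
  · omega
  · omega
  · intro i hi
    rw [scalar_set, setCell_of_ne (by omega), hg i hi]
  · rw [scalar_set, setCell_self]
    simp
  · simpa using hw'
  rintro idx' mem' ⟨h1, h2, h3⟩
  have hmem : ∀ r, r ≠ 8 → r ≠ 11 → mem' r = mem r := fun r hr hr' => by
    rw [h2 r hr hr', scalar_set, setCell_of_ne hr']
  rw [zero_add] at h3
  refine Ensures.ifLe (fun h => Ensures.mono (by simp) (Ensures.skip ?_))
    (fun h => Ensures.seq (Ensures.arith trivial ?_ (Ensures.seq (Ensures.arith ?_ ?_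
      (Ensures.arith trivial ?_ ?_)))))
  all_goals
    simp only [scalar_val, scalar_set, setCell_self, ne_eq, Nat.reduceEqDiff,
      not_false_eq_true, setCell_of_ne, ArithOp.Legal, ArithOp.eval, h3, hmem, h12, hδ, hW, hF]
      at h ⊢
  · refine ⟨h1, fun r hr _ hr' => hmem r hr hr', ?_⟩
    rw [floorSeq, if_pos h]
  · exact hwδ
  · exact hW0 h
  · exact hwW
  · exact hwF
  · refine ⟨h1, fun r hr hr' hr'' => ?_, ?_⟩
    · rw [setCell_of_ne hr', setCell_of_ne hr, setCell_of_ne hr, hmem r hr hr'']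
    · rw [floorSeq, if_neg (not_le.mpr h)]

theorem scaleProg_ensures {idx : ℕ → ℕ} {mem : ℕ → ℕ → ℕ → ℝ} {g : ℕ → ℕ → ℝ} {z F : ℕ → ℝ}
    {δ W : ℝ} (hF : F = floorSeq δ W (colSq d g)) (hz : ∀ c < n, mem 4 d c = z c)
    (hg : ∀ k < n, ∀ i < d, mem 5 i k = g i k)
    (hδ : mem 2 0 0 = δ) (hW : mem 9 0 0 = W) (h12 : mem 12 0 0 = 0)
    (hz0 : ∀ c < n, z c ≠ 0) (hW0 : ∀ k < n, 0 < colSq d g k → W ≠ 0)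
    (hw0 : w (0 : ℕ)) (hw1 : w (1 : ℕ))
    (hw : ∀ k < n, ∀ i < d, w (g i k * g i k)) (hw' : ∀ k < n, ∀ i ≤ d, w (colSq i g k))
    (hwδ : ∀ k < n, w (colSq d g k * δ)) (hwW : ∀ k < n, w (colSq d g k * δ / W))
    (hwF : ∀ k < n, w (F k)) (hwF' : ∀ k < n, w (F k * (colSq d g k * δ / W)))
    (hwz : ∀ c, c + 1 < n → w (scaleSeq F z c * z (c + 1)))
    (hwz' : ∀ c, c + 1 < n → w (scaleSeq F z c * z (c + 1) / z c)) :
    Ensures d n w scaleProg idx mem (2 + n * (12 + d * 3), 2 * n, 0, 0) fun idx' mem' =>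
      idx' 0 = idx 0 ∧ (∀ r, r ≠ 6 → r ≠ 8 → r ≠ 10 → r ≠ 11 → mem' r = mem r) ∧
      mem' 10 0 0 = F n ∧ ∀ c < n, mem' 6 0 c = scaleSeq F z c := by
  refine Ensures.mono ?_ (Ensures.seq (Ensures.const hw1 (Ensures.loop (fun k idx' mem' =>
    idx' 0 = idx 0 ∧ (∀ r, r ≠ 6 → r ≠ 8 → r ≠ 10 → r ≠ 11 → mem' r = mem r) ∧
    mem' 10 0 0 = F k ∧ ∀ c < k, mem' 6 0 c = scaleSeq F z c) ?_ ?_ ?_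
    (κ := (5, 1, 0, 0) + (6 + d * 3, 1, 0, 0)))))
  · simp only [IExpr.eval, Prod.mk_add_mk, Prod.smul_mk, smul_eq_mul, Prod.mk_le_mk]
    refine ⟨le_of_eq (by ring), le_of_eq (by ring), by simp, by simp⟩
  · refine ⟨rfl, fun r _ _ hr _ => ?_, ?_, fun c hc => absurd hc (by omega)⟩
    · rw [scalar_set, setCell_of_ne hr]
    · rw [scalar_set, setCell_self, hF, floorSeq, Nat.cast_one]
  · rintro k hk idx' mem' ⟨h1, h2, h3, h4⟩
    have hk : k < n := hk
    refine Ensures.seq (Ensures.conseq (scaleStep_ensures (k := k) (F := F) (z := z) (by simp) h3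
      (fun c hc => by rw [h2 4 (by omega) (by omega) (by omega) (by omega), hz c (by omega)])
      (fun c hc => hz0 c (by omega)) h4 hw1 (hwF k hk) (fun c hc => hwz c (by omega))
      (fun c hc => hwz' c (by omega))) le_rfl ?_)
    rintro idx'' mem'' ⟨rfl, g2, g3⟩
    have hm : ∀ r, r ≠ 6 → r ≠ 8 → r ≠ 10 → r ≠ 11 → mem'' r = mem r := fun r e1 e2 e3 e4 => by
      rw [g2 r e1 e2, h2 r e1 e2 e3 e4]
    refine Ensures.conseq (floorStep_ensures (k := k) (g := g) (δ := δ) (W := W) (by simp)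
      (by rw [g2 10 (by omega) (by omega), h3, hF])
      (fun i hi => by rw [hm 5 (by omega) (by omega) (by omega) (by omega), hg k hk i hi])
      (by rw [hm 2 (by omega) (by omega) (by omega) (by omega), hδ])
      (by rw [hm 9 (by omega) (by omega) (by omega) (by omega), hW])
      (by rw [hm 12 (by omega) (by omega) (by omega) (by omega), h12])
      (hW0 k hk) hw0 (hw k hk) (hw' k hk) (hwδ k hk) (hwW k hk) (by
        rw [← hF]
        exact hwF' k hk)) le_rfl ?_
    rintro idx₃ mem₃ ⟨f1, f2, f3⟩
    refine ⟨by rw [f1 0 (by omega)]; simp [h1],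
      fun r e1 e2 e3 e4 => by rw [f2 r e2 e3 e4, hm r e1 e2 e3 e4], by rw [f3, hF], fun c hc => ?_⟩
    rw [f2 6 (by omega) (by omega) (by omega), g3 c (by omega)]
  · rintro idx' mem' h
    exact h

/-- The value p = 0 is not excluded here; truncated subtraction then refers to `y 0`. That p is
positive follows only once the keys in row 0 of array 1 are known to occur among the sorted ones. -/
theorem outputProg_ensures {idx : ℕ → ℕ} {mem : ℕ → ℕ → ℕ → ℝ} {L : ℕ} {δ F : ℝ} {y z : ℕ → ℝ}
    (h0 : idx 0 = L) (hL : n < 2 ^ L) (hF : mem 10 0 0 = F) (hδ : mem 2 0 0 = δ)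
    (hy : ∀ c < n, mem 6 0 c = y c) (hz : ∀ c < n, mem 4 d c = z c) (hFδ : F * δ ≠ 0)
    (hmono : ∀ c c', c ≤ c' → c' < n → z c' ≤ z c)
    (hw : w (F * δ)) (hwy : ∀ c < n, w (y c / (F * δ)))
    (hwr : ∀ c < n, w (roundTo (y c / (F * δ)) 0)) :
    Ensures d n w outputProg idx mem (2 + n * (5 + L * (2 * L + 6)), n * L, n, 0)
      fun _ mem' => ∀ j < n, ∃ p ≤ n, (∀ c < p, mem 1 0 j ≤ z c) ∧
        (∀ c, p ≤ c → c < n → z c < mem 1 0 j) ∧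
        mem' 3 0 j = roundTo (y (p - 1) / (F * δ)) 0 := by
  refine Ensures.mono ?_ (Ensures.seq (Ensures.arith trivial ?_ (Ensures.loop (fun k idx' mem' =>
    idx' 0 = idx 0 ∧ (∀ r, r ≠ 3 → r ≠ 8 → r ≠ 13 → mem' r = mem r) ∧ mem' 13 0 0 = F * δ ∧
    ∀ j < k, ∃ p ≤ n, (∀ c < p, mem 1 0 j ≤ z c) ∧
        (∀ c, p ≤ c → c < n → z c < mem 1 0 j) ∧
        mem' 3 0 j = roundTo (y (p - 1) / (F * δ)) 0) ?_ ?_ ?_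
    (κ := (2 + L * (2 * L + 6), L, 0, 0) + ((1, 0, 0, 0) + (1, 0, 1, 0))))))
  · simp only [IExpr.eval, Prod.mk_add_mk, Prod.smul_mk, smul_eq_mul, Prod.mk_le_mk]
    refine ⟨le_of_eq (by ring), le_of_eq (by ring), by simp, by simp⟩
  · rw [scalar_val, scalar_val, hF, hδ]
    exact hw
  · refine ⟨rfl, fun r _ _ hr => ?_, ?_, fun c hc => absurd hc (by omega)⟩
    · rw [scalar_set, setCell_of_ne hr]
    · rw [scalar_set, setCell_self, scalar_val, scalar_val, hF, hδ]
      rfl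
  · rintro k hk idx' mem' ⟨h1, h2, h3, h4⟩
    have hk : k < n := hk
    have m1 := h2 1 (by omega) (by omega) (by omega)
    have m4 := h2 4 (by omega) (by omega) (by omega)
    have m6 := h2 6 (by omega) (by omega) (by omega)
    refine Ensures.seq (Ensures.conseq (searchProg_ensures (m := n) (X := mem 1 0 k) ?_ ?_ ?_)
      ?_ ?_)
    · intro idx'' h
      have := h 2 (by omega)
      simp [IExpr.eval, Cell.val, this, m1]
    · simp [h1, h0, hL]
    · intro c c' hc hc'
      rw [m4, hz c (by omega), hz c' hc']
      exact hmono c c' hc hc'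
    · simp [h1, h0]
    rintro idx'' mem'' ⟨rfl, g2, g3, g4, g5⟩
    have g4 : ∀ c < idx'' 6, mem 1 0 k ≤ z c := fun c hc => by
      rw [← hz c (by omega), ← m4]
      exact g4 c hc
    have g5 : ∀ c, idx'' 6 ≤ c → c < n → z c < mem 1 0 k := fun c hc hc' => by
      rw [← hz c hc', ← m4]
      exact g5 c hc hc'
    have hk2 : idx'' 2 = k := by rw [g2 2 (by omega)]; simp
    have hp : idx'' 6 - 1 < n := by omega
    have hval : Cell.val d n idx'' mem'' ⟨6, .const 0, .sub (.var 6) (.const 1)⟩ =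
        y (idx'' 6 - 1) := by
      simp only [Cell.val, IExpr.eval, m6]
      exact hy _ hp
    refine Ensures.seq (Ensures.arith ?_ ?_ (Ensures.round ?_ ?_))
    · rw [scalar_val, h3]
      exact hFδ
    · rw [scalar_val, h3, hval]
      exact hwy _ hp
    · rw [scalar_val, scalar_val, h3, hval, scalar_set, setCell_self]
      exact hwr _ hp
    · rw [scalar_val, scalar_val, h3, hval, scalar_set, setCell_self]
      have hset : ∀ mem x, Cell.set d n idx'' mem ⟨3, .const 0, .var 2⟩ x =
          setCell mem 3 0 k x := by
        simp [Cell.set, IExpr.eval, hk2]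
      rw [hset]
      refine ⟨by rw [g2 0 (by omega)]; simp [h1], fun r e1 e2 e3 => ?_, ?_, fun j hj => ?_⟩
      · rw [setCell_of_ne e1, setCell_of_ne e2, h2 r e1 e2 e3]
      · rw [setCell_of_ne (by omega), setCell_of_ne (by omega), h3]
      · rcases (Nat.lt_succ_iff.mp hj).eq_or_lt with rfl | hj
        · exact ⟨idx'' 6, g3, g4, g5, setCell_self _ _ _ _ _⟩
        · obtain ⟨p, q1, q2, q3, q4⟩ := h4 j hj
          refine ⟨p, q1, q2, q3, ?_⟩
          rw [← q4]
          simp [setCell, hj.ne]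
  · rintro idx' mem' h
    exact h.2.2.2

end

/-! ### The whole program -/

/-- The program for at least two columns. -/
def sortedProg : Prog :=
  .seq levelsProg (.seq sortProg (.seq (.gramSchmidt 5 4) (.seq normProg (.seq scaleProg outputProg))))

/-- The program. -/
def frameProg : Prog :=
  .ifIdx .cols (.const 1) (.loop 2 .cols (.const ⟨3, .const 0, .var 2⟩ 1)) sortedProg

/-- A matrix as an infinite array. -/
def extendMat {d n : ℕ} (A : Matrix (Fin d) (Fin n) ℝ) (i k : ℕ) : ℝ :=
  if h : i < d ∧ k < n then A ⟨i, h.1⟩ ⟨k, h.2⟩ else 0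

/-- A vector as an infinite sequence. -/
def extendVec {n : ℕ} (z : Fin n → ℝ) (k : ℕ) : ℝ :=
  -- The default 1 keeps every entry positive, so quotients need no range condition.
  if h : k < n then z ⟨k, h⟩ else 1

theorem extendMat_of_lt {d n : ℕ} (A : Matrix (Fin d) (Fin n) ℝ) {i k : ℕ} (hi : i < d)
    (hk : k < n) : extendMat A i k = A ⟨i, hi⟩ ⟨k, hk⟩ :=
  dif_pos ⟨hi, hk⟩

theorem extendVec_of_lt {n : ℕ} (z : Fin n → ℝ) {k : ℕ} (hk : k < n) :
    extendVec z k = z ⟨k, hk⟩ :=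
  dif_pos hk

/-- `5 n ‖U‖²`, for the Frobenius norm. -/
def normConst {d n : ℕ} (U : Matrix (Fin d) (Fin n) ℝ) : ℝ :=
  n * totalSq d n (extendMat U) * 5

/-- The squared norms of the Gram-Schmidt vectors of the columns of `U`. -/
def gsSq {d n : ℕ} (U : Matrix (Fin d) (Fin n) ℝ) : ℕ → ℝ :=
  colSq d (extendMat (gramSchmidtCols U))

/-- Lower bounds for the truncated scale factors of sorted columns. -/
def floors {d n : ℕ} (U : Matrix (Fin d) (Fin n) ℝ) (δ : ℝ) : ℕ → ℝ :=
  floorSeq δ (normConst U) (gsSq U)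

/-- The truncated scale factors of sorted columns. -/
def scales {d n : ℕ} (U : Matrix (Fin d) (Fin n) ℝ) (z : Fin n → ℝ) (δ : ℝ) : ℕ → ℝ :=
  scaleSeq (floors U δ) (extendVec z)

/-- All numbers computed from the sorted columns `U` with scale factors `z` satisfy `w`. -/
structure AllValues {d n : ℕ} (w : ℝ → Prop) (U : Matrix (Fin d) (Fin n) ℝ) (z : Fin n → ℝ)
    (δ : ℝ) : Prop where
  gs : ∀ i j, w (gramSchmidtCols U i j)
  sq : ∀ k < n, ∀ i < d, w (extendMat U i k * extendMat U i k)
  sum : ∀ k < n, ∀ i ≤ d, w (totalSq d k (extendMat U) + colSq i (extendMat U) k)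
  mul : ∀ k ≤ n, w (k * totalSq d n (extendMat U))
  norm : w (normConst U)
  gsSq : ∀ k < n, ∀ i < d,
    w (extendMat (gramSchmidtCols U) i k * extendMat (gramSchmidtCols U) i k)
  gsSum : ∀ k < n, ∀ i ≤ d, w (colSq i (extendMat (gramSchmidtCols U)) k)
  gsMul : ∀ k < n, w (FrameScaling.gsSq U k * δ)
  gsDiv : ∀ k < n, w (FrameScaling.gsSq U k * δ / normConst U)
  floor : ∀ k < n, w (floors U δ k)
  floorMul : ∀ k < n, w (floors U δ k * (FrameScaling.gsSq U k * δ / normConst U))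
  scaleMul : ∀ c, c + 1 < n → w (scales U z δ c * extendVec z (c + 1))
  scaleDiv : ∀ c, c + 1 < n → w (scales U z δ c * extendVec z (c + 1) / extendVec z c)
  last : w (floors U δ n * δ)
  quot : ∀ c < n, w (scales U z δ c / (floors U δ n * δ))
  out : ∀ c < n, w (roundTo (scales U z δ c / (floors U δ n * δ)) 0)

section

variable {d n : ℕ} {w : ℝ → Prop}

theorem SortedPrefix.exists_perm {mem : ℕ → ℕ → ℕ → ℝ} {σ : ℕ → ℕ} (h : SortedPrefix d n mem σ) :
    ∃ τ : Equiv.Perm (Fin n), ∀ c, (τ c : ℕ) = σ c := by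
  have hinj : Function.Injective fun c : Fin n => (⟨σ c, h.lt c c.2⟩ : Fin n) := by
    intro c c' hcc
    have hcc : σ c = σ c' := by simpa using hcc
    by_contra hne
    rcases lt_or_gt_of_ne hne with hlt | hlt
    · exact h.ne c c' hlt c'.2 hcc
    · exact h.ne c' c hlt c.2 hcc.symm
  exact ⟨Equiv.ofBijective _ (Finite.injective_iff_bijective.mp hinj), fun c => rfl⟩

/-- The hypotheses range over all permutations because the sorting order is only known after the
run. Ties make the position `p` ambiguous, so only the equality of scale factors is recorded. -/
theorem sortedProg_ensures (hn : 2 ≤ n) (U : Matrix (Fin d) (Fin n) ℝ) (z : Fin n → ℝ) (δ : ℝ)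
    (hz : ∀ j, 0 < z j) (hw0 : w (0 : ℕ)) (hw1 : w (1 : ℕ)) (hw5 : w (5 : ℕ))
    (hwU : ∀ i j, w (U i j)) (hwz : ∀ j, w (z j))
    (hw : ∀ σ : Equiv.Perm (Fin n), AllValues w (U.submatrix id σ) (z ∘ σ) δ)
    (hW : ∀ σ : Equiv.Perm (Fin n), ∀ k < n, 0 < gsSq (U.submatrix id σ) k →
      normConst (U.submatrix id σ) ≠ 0)
    (hF : ∀ σ : Equiv.Perm (Fin n), floors (U.submatrix id σ) δ n * δ ≠ 0) :
    ∃ L, n < 2 ^ L ∧ 2 ^ L ≤ 2 * n ∧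
    Ensures d n w sortedProg (initialConf U z δ).idx (initialConf U z δ).mem
      (13 + 12 * n + n * (4 + d * 3) + n * (6 + d * 3) +
        n * (11 + 2 * (L * (2 * L + 6)) + n * (2 + (d + 1) * 2) + d * 2),
        2 * n * L + 2 * n, n, 1)
      fun _ mem' => ∃ σ : Equiv.Perm (Fin n), Antitone (z ∘ σ) ∧ ∀ j : Fin n, ∃ p : Fin n,
        z (σ p) = z j ∧
        mem' 3 0 j = roundTo (scales (U.submatrix id σ) (z ∘ σ) δ p /
          (floors (U.submatrix id σ) δ n * δ)) 0 := by
  obtain ⟨L, hL⟩ : ∃ L, L = Nat.log 2 n + 1 := ⟨_, rfl⟩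
  have hL1 : n < 2 ^ L := hL ▸ Nat.lt_pow_succ_log_self (by omega) n
  have hL2 : 2 ^ L ≤ 2 * n := by
    rw [hL, pow_succ, mul_comm]
    exact Nat.mul_le_mul_left _ (Nat.pow_log_le_self 2 (by omega))
  -- The counts must be named before the run. The two inequalities determine the exponent, so the
  -- value found by `levelsProg` is the one fixed here.
  have hLu : ∀ M, n < 2 ^ M → 2 ^ M ≤ 2 * n → M = L := by
    intro M h1 h2
    have h3 : 2 ^ M < 2 ^ (L + 1) := by rw [pow_succ]; omega
    have h4 : 2 ^ L < 2 ^ (M + 1) := by rw [pow_succ]; omega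
    have h5 := (Nat.pow_lt_pow_iff_right (by norm_num : 1 < 2)).mp h3
    have h6 := (Nat.pow_lt_pow_iff_right (by norm_num : 1 < 2)).mp h4
    omega
  refine ⟨L, hL1, hL2, ?_⟩
  refine Ensures.mono (κ := (2 + 4 * n, 0, 0, 0) +
    ((1 + n * (6 + L * (2 * L + 6) + n * (2 + (d + 1) * 2) + d * 2), n * L, 0, 0) +
    ((1, 0, 0, 1) + ((4 + n * (4 + d * 3), 0, 0, 0) + ((2 + n * (12 + d * 3), 2 * n, 0, 0) +
      (2 + n * (5 + L * (2 * L + 6)), n * L, n, 0)))))) ?_ ?_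
  · simp only [Prod.mk_add_mk, Prod.mk_le_mk]
    refine ⟨?_, ?_, by simp, by simp⟩
    · nlinarith
    · nlinarith
  have i0 : ∀ i (hi : i < d) j (hj : j < n), (initialConf U z δ).mem 0 i j = U ⟨i, hi⟩ ⟨j, hj⟩ := by
    intro i hi j hj
    simp [initialConf, hi, hj]
  have i1 : ∀ j (hj : j < n), (initialConf U z δ).mem 1 0 j = z ⟨j, hj⟩ := by
    intro j hj
    simp [initialConf, hj]
  have i2 : (initialConf U z δ).mem 2 0 0 = δ := by simp [initialConf]
  have i3 : ∀ r, 3 ≤ r → (initialConf U z δ).mem r 0 0 = 0 := by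
    intro r hr
    simp [initialConf, show r ≠ 0 by omega, show r ≠ 1 by omega, show r ≠ 2 by omega]
  set mem := (initialConf U z δ).mem
  refine Ensures.seq (Ensures.conseq (levelsProg_ensures (by omega) rfl) le_rfl ?_)
  rintro idx₁ mem₁ ⟨rfl, h1, h2⟩
  have h0 := hLu _ h1 h2
  refine Ensures.seq (Ensures.conseq (sortProg_ensures h0 hL1 ?_ ?_) le_rfl ?_)
  · intro i hi j hj
    rw [i0 i hi j hj]
    exact hwU _ _
  · intro j hj
    rw [i1 j hj]
    exact hwz _
  rintro idx₂ mem₂ ⟨h20, h2m, σ', hσ'⟩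
  obtain ⟨σ, hσ⟩ := hσ'.exists_perm
  set V := U.submatrix id σ with hV
  have c4 : ∀ k < n, ∀ i < d, mem₂ 4 i k = extendMat V i k := by
    intro k hk i hi
    rw [hσ'.col k hk i hi, extendMat_of_lt V hi hk, h2m 0 (by omega),
      i0 i hi _ (hσ'.lt k hk)]
    simp only [hV, Matrix.submatrix_apply, id]
    congr 1
    ext
    exact (hσ ⟨k, hk⟩).symm
  have z4 : ∀ k < n, mem₂ 4 d k = extendVec (z ∘ σ) k := by
    intro k hk
    rw [hσ'.key k hk, extendVec_of_lt _ hk, h2m 1 (by omega), i1 _ (hσ'.lt k hk)]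
    simp only [Function.comp]
    congr 1
    ext
    exact (hσ ⟨k, hk⟩).symm
  have hVmat : (Matrix.of fun (i : Fin d) (j : Fin n) => mem₂ 4 i j) = V := by
    ext i j
    rw [Matrix.of_apply, c4 j j.2 i i.2, extendMat_of_lt V i.2 j.2]
  have hanti : ∀ c c', c ≤ c' → c' < n → extendVec (z ∘ σ) c' ≤ extendVec (z ∘ σ) c := by
    intro c c' hc hc'
    rw [← z4 c (by omega), ← z4 c' hc']
    exact hσ'.anti c c' hc hc'
  obtain ⟨w1, w2, w3, w4, w5, w6, w7, w8, w9, w10, w11, w12, w13, w14, w15, w16⟩ := hw σ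
  refine Ensures.seq (Ensures.gramSchmidt ?_ ?_)
  · rw [hVmat]
    exact w1
  rw [hVmat]
  set mem₃ : ℕ → ℕ → ℕ → ℝ := fun r i j => if h : r = 5 ∧ i < d ∧ j < n then
    gramSchmidtCols V ⟨i, h.2.1⟩ ⟨j, h.2.2⟩ else mem₂ r i j with hmem₃
  have e3 : ∀ r ≠ 5, mem₃ r = mem₂ r := by
    intro r hr
    ext i j
    simp [hmem₃, hr]
  have c5 : ∀ k < n, ∀ i < d, mem₃ 5 i k = extendMat (gramSchmidtCols V) i k := by
    intro k hk i hi
    rw [extendMat_of_lt _ hi hk]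
    simp [hmem₃, hi, hk]
  refine Ensures.seq (Ensures.conseq (normProg_ensures (g := extendMat V) ?_ ?_ ?_ hw5 w2 w3 w4 w5)
    le_rfl ?_)
  · rw [e3 4 (by omega)]
    exact c4
  · rw [e3 7 (by omega), h2m 7 (by omega), i3 7 (by omega)]
  · rw [e3 9 (by omega), h2m 9 (by omega), i3 9 (by omega)]
  rintro idx₄ mem₄ ⟨h40, h4m, h49⟩
  refine Ensures.seq (Ensures.conseq (scaleProg_ensures (F := floors V δ)
    (g := extendMat (gramSchmidtCols V)) (z := extendVec (z ∘ σ)) (W := normConst V) (δ := δ)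
    rfl ?_ ?_ ?_ h49 ?_ ?_ (hW σ) hw0 hw1 w6 w7 w8 w9 w10 w11 w12 w13) le_rfl ?_)
  · intro c hc
    rw [h4m 4 (by omega) (by omega) (by omega), e3 4 (by omega), z4 c hc]
  · intro k hk i hi
    rw [h4m 5 (by omega) (by omega) (by omega), c5 k hk i hi]
  · rw [h4m 2 (by omega) (by omega) (by omega), e3 2 (by omega), h2m 2 (by omega), i2]
  · rw [h4m 12 (by omega) (by omega) (by omega), e3 12 (by omega), h2m 12 (by omega),
      i3 12 (by omega)]
  · intro c hc
    rw [extendVec_of_lt _ hc]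
    exact (hz _).ne'
  rintro idx₅ mem₅ ⟨h50, h5m, h510, h56⟩
  have f5 : ∀ r, r ≠ 5 → r ≠ 7 → r ≠ 9 → r ≠ 6 → r ≠ 8 → r ≠ 10 → r ≠ 11 →
      mem₅ r = mem₂ r := fun r e1 e2 e4 e5 e6 e7 e8 => by
    rw [h5m r e5 e6 e7 e8, h4m r e2 e6 e4, e3 r e1]
  refine Ensures.conseq (outputProg_ensures (L := L) (δ := δ) (F := floors V δ n)
    (y := scales V (z ∘ σ) δ) (z := extendVec (z ∘ σ)) ?_ hL1 h510 ?_ h56 ?_ (hF σ) hanti w14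
    w15 w16) le_rfl ?_
  · rw [h50, h40, h20]
  · rw [f5 2 (by omega) (by omega) (by omega) (by omega) (by omega) (by omega) (by omega),
      h2m 2 (by omega), i2]
  · intro c hc
    rw [f5 4 (by omega) (by omega) (by omega) (by omega) (by omega) (by omega) (by omega),
      z4 c hc]
  rintro idx₆ mem₆ h6
  have hz1 : ∀ j (hj : j < n), mem₅ 1 0 j = z ⟨j, hj⟩ := by
    intro j hj
    rw [f5 1 (by omega) (by omega) (by omega) (by omega) (by omega) (by omega) (by omega),
      h2m 1 (by omega), i1 j hj]
  refine ⟨σ, fun c c' hc => ?_, fun j => ?_⟩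
  · have := hanti c c' hc c'.2
    rwa [extendVec_of_lt _ c.2, extendVec_of_lt _ c'.2] at this
  · obtain ⟨p, hp, hlo, hhi, hout⟩ := h6 j j.2
    have hj : extendVec (z ∘ σ) (σ.symm j : Fin n) = z j := by
      rw [extendVec_of_lt _ (σ.symm j).2]
      simp
    rw [hz1 j j.2] at hlo hhi
    -- The sorted position of `z j` itself is counted by the search, so p > 0.
    have hjp : ((σ.symm j : Fin n) : ℕ) < p := by
      by_contra hcon
      have := hhi _ (not_lt.mp hcon) (σ.symm j).2
      rw [hj] at this
      exact lt_irrefl _ this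
    refine ⟨⟨p - 1, by omega⟩, le_antisymm ?_ ?_, hout⟩
    · have := hanti _ (p - 1) (show ((σ.symm j : Fin n) : ℕ) ≤ p - 1 by omega) (by omega)
      rwa [hj, extendVec_of_lt _ (show p - 1 < n by omega)] at this
    · have := hlo (p - 1) (by omega)
      rwa [extendVec_of_lt _ (show p - 1 < n by omega)] at this

theorem frameProg_ensures (hn : n ≤ 1) (hw1 : w (1 : ℕ)) (idx : ℕ → ℕ)
    (mem : ℕ → ℕ → ℕ → ℝ) :
    Ensures d n w frameProg idx mem (2 + 2 * n, 0, 0, 0)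
      fun _ mem' => ∀ j < n, mem' 3 0 j = 1 := by
  refine Ensures.mono ?_ (Ensures.ifIdx
    (fun _ => Ensures.loop (fun k _ mem' => ∀ j < k, mem' 3 0 j = 1) ?_ ?_ ?_
      (κ := (1, 0, 0, 0))) (fun h => absurd h (not_lt.mpr hn)))
  · simp only [IExpr.eval, Prod.mk_add_mk, Prod.smul_mk, smul_eq_mul, Prod.mk_le_mk]
    omega
  · intro j hj
    omega
  · intro k _ idx' mem' h
    refine Ensures.const hw1 fun j hj => ?_
    simp only [Cell.set, setCell, IExpr.eval, Function.update_self, true_and, Nat.cast_one]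
    split_ifs with hjk
    · rfl
    · exact h j (by omega)
  · intro idx' mem' h
    exact h

end

/-! ### Leverage scores under changes of the scale factors -/

/-- The `j`-th column of a matrix, as a vector of Euclidean space. -/
def colVec {d n : ℕ} (U : Matrix (Fin d) (Fin n) ℝ) (j : Fin n) : EuclideanSpace ℝ (Fin d) :=
  WithLp.toLp 2 fun i => U i j

section

variable {d n : ℕ} {U : Matrix (Fin d) (Fin n) ℝ} {z w w' : Fin n → ℝ}

open scoped RealInnerProductSpace

theorem inner_colVec (U : Matrix (Fin d) (Fin n) ℝ) (j : Fin n) (x : EuclideanSpace ℝ (Fin d)) :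
    ⟪colVec U j, x⟫ = (fun i => U i j) ⬝ᵥ WithLp.ofLp x := by
  rw [dotProduct_comm]
  simp [colVec, EuclideanSpace.inner_eq_star_dotProduct]

theorem dotProduct_frameMatrix_mulVec (U : Matrix (Fin d) (Fin n) ℝ) (z : Fin n → ℝ)
    (x y : EuclideanSpace ℝ (Fin d)) :
    WithLp.ofLp x ⬝ᵥ ((U * Matrix.diagonal z * U.transpose).mulVec (WithLp.ofLp y)) =
      ∑ j, z j * (⟪colVec U j, x⟫ * ⟪colVec U j, y⟫) := by
  rw [← Matrix.mulVec_mulVec, ← Matrix.mulVec_mulVec, Matrix.dotProduct_mulVec]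
  simp only [dotProduct, Matrix.mulVec_diagonal, inner_colVec]
  refine Finset.sum_congr rfl fun j _ => ?_
  simp only [Matrix.vecMul, Matrix.mulVec, Matrix.transpose_apply, dotProduct]
  rw [Finset.sum_congr rfl fun i _ => mul_comm (x.ofLp i) (U i j)]
  ring

theorem IsFrame.eq_zero_of_inner_eq_zero (hU : IsFrame U) {x : EuclideanSpace ℝ (Fin d)}
    (hx : ∀ j, ⟪colVec U j, x⟫ = 0) : x = 0 := by
  have htop : LinearMap.range U.mulVecLin = ⊤ := by
    apply Submodule.eq_top_of_finrank_eq
    rw [Module.finrank_fin_fun]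
    exact hU
  obtain ⟨c, hc⟩ : WithLp.ofLp x ∈ LinearMap.range U.mulVecLin := htop ▸ Submodule.mem_top
  have h0 : WithLp.ofLp x ⬝ᵥ WithLp.ofLp x = 0 := by
    nth_rewrite 2 [← hc]
    rw [Matrix.mulVecLin_apply, Matrix.dotProduct_mulVec]
    have : Matrix.vecMul (WithLp.ofLp x) U = 0 := by
      ext j
      rw [Matrix.vecMul, dotProduct_comm, ← inner_colVec]
      exact hx j
    rw [this, zero_dotProduct]
  have := dotProduct_self_eq_zero.mp h0
  ext i
  exact congrFun this i

theorem frameMatrix_posDef (hU : IsFrame U) (hz : ∀ j, 0 < z j) :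
    (U * Matrix.diagonal z * U.transpose).PosDef := by
  refine Matrix.PosDef.of_dotProduct_mulVec_pos ?_ ?_
  · rw [Matrix.IsHermitian, Matrix.conjTranspose_eq_transpose_of_trivial, Matrix.transpose_mul,
      Matrix.transpose_mul, Matrix.transpose_transpose, Matrix.diagonal_transpose, Matrix.mul_assoc]
  · intro x hx
    have hquad := dotProduct_frameMatrix_mulVec U z (WithLp.toLp 2 x) (WithLp.toLp 2 x)
    simp only [star_trivial] at hquad ⊢
    rw [hquad]
    have hnn : ∀ j ∈ Finset.univ, 0 ≤ z j *
        (⟪colVec U j, WithLp.toLp 2 x⟫ * ⟪colVec U j, WithLp.toLp 2 x⟫) :=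
      fun j _ => mul_nonneg (hz j).le (mul_self_nonneg _)
    refine (Finset.sum_nonneg hnn).lt_of_ne' fun h => hx ?_
    have h0 := hU.eq_zero_of_inner_eq_zero (x := WithLp.toLp 2 x) fun j => by
      have := (Finset.sum_eq_zero_iff_of_nonneg hnn).mp h j (Finset.mem_univ j)
      simpa [(hz j).ne'] using this
    simpa using congrArg WithLp.ofLp h0

/-- The vector is p = (U Z Uᵀ)⁻¹ u_j, described as the representer of x ↦ ⟨u_j, x⟩ for the frame
form. Later estimates use this description and no longer mention the inverse. -/
theorem lev_attained (hU : IsFrame U) (hz : ∀ j, 0 < z j) (j : Fin n) :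
    ∃ p : EuclideanSpace ℝ (Fin d), lev U z j = z j * ⟪colVec U j, p⟫ ∧
      ∀ x, ⟪colVec U j, x⟫ = ∑ i, z i * (⟪colVec U i, x⟫ * ⟪colVec U i, p⟫) := by
  set M := U * Matrix.diagonal z * U.transpose with hM
  have hdet := (Matrix.isUnit_iff_isUnit_det _).mp (frameMatrix_posDef hU hz).isUnit
  refine ⟨WithLp.toLp 2 (M⁻¹.mulVec fun i => U i j), ?_, fun x => ?_⟩
  · rw [lev, inner_colVec]
  · rw [← dotProduct_frameMatrix_mulVec, Matrix.mulVec_mulVec, Matrix.mul_nonsing_inv _ hdet,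
      Matrix.one_mulVec, inner_colVec, dotProduct_comm]

/-- One half of the variational formula for leverage scores: complete the square around the
representer p. Any test vector x therefore yields a lower bound. -/
theorem lev_lower (hU : IsFrame U) (hz : ∀ j, 0 < z j) (j : Fin n)
    (x : EuclideanSpace ℝ (Fin d)) :
    z j * (2 * ⟪colVec U j, x⟫ - ∑ i, z i * ⟪colVec U i, x⟫ ^ 2) ≤ lev U z j := by
  obtain ⟨p, hp, hpx⟩ := lev_attained hU hz j
  rw [hp]
  refine mul_le_mul_of_nonneg_left ?_ (hz j).le
  have h0 : 0 ≤ ∑ i, z i * (⟪colVec U i, x⟫ - ⟪colVec U i, p⟫) ^ 2 :=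
    Finset.sum_nonneg fun i _ => mul_nonneg (hz i).le (sq_nonneg _)
  have h1 : ∑ i, z i * (⟪colVec U i, x⟫ - ⟪colVec U i, p⟫) ^ 2 =
      ∑ i, z i * ⟪colVec U i, x⟫ ^ 2 - 2 * ∑ i, z i * (⟪colVec U i, x⟫ * ⟪colVec U i, p⟫) +
        ∑ i, z i * (⟪colVec U i, p⟫ * ⟪colVec U i, p⟫) := by
    rw [Finset.mul_sum, ← Finset.sum_sub_distrib, ← Finset.sum_add_distrib]
    exact Finset.sum_congr rfl fun i _ => by ring
  rw [← hpx, ← hpx] at h1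
  linarith

theorem lev_nonneg (hU : IsFrame U) (hz : ∀ j, 0 < z j) (j : Fin n) : 0 ≤ lev U z j := by
  simpa using lev_lower hU hz j 0

/-- The sum is the trace of M⁻¹ M for the frame matrix M, by cyclicity. -/
theorem sum_lev (hU : IsFrame U) (hz : ∀ j, 0 < z j) : ∑ j, lev U z j = d := by
  set M := U * Matrix.diagonal z * U.transpose with hM
  have hdet := (Matrix.isUnit_iff_isUnit_det _).mp (frameMatrix_posDef hU hz).isUnit
  have h1 : (M⁻¹ * M).trace = d := by
    rw [Matrix.nonsing_inv_mul _ hdet, Matrix.trace_one, Fintype.card_fin]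
  rw [← h1]
  nth_rewrite 2 [hM]
  rw [← Matrix.mul_assoc, ← Matrix.mul_assoc, Matrix.trace_mul_comm, Matrix.trace]
  refine Finset.sum_congr rfl fun j _ => ?_
  rw [Matrix.diag_apply, ← Matrix.mul_assoc, Matrix.mul_diagonal, mul_comm]
  rfl

/-- The frame matrix for w' dominates 1/b times the one for w, so inversion reverses this up to the
factor b. In terms of vectors, b⁻¹ p is the test vector for w, where p is the representer for w'. -/
theorem lev_le_of_le (hU : IsFrame U) (hw : ∀ j, 0 < w j) (hw' : ∀ j, 0 < w' j) {a b : ℝ}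
    (hb : 0 < b) {j : Fin n} (hj : w' j ≤ a * w j) (hi : ∀ i, w i ≤ b * w' i) :
    lev U w' j ≤ a * b * lev U w j := by
  obtain ⟨p, hp, hpx⟩ := lev_attained hU hw' j
  set q := ⟪colVec U j, p⟫ with hq
  have h1 := lev_lower hU hw j (b⁻¹ • p)
  simp only [inner_smul_right] at h1
  have h2 : ∑ i, w i * (b⁻¹ * ⟪colVec U i, p⟫) ^ 2 ≤ b⁻¹ * q := by
    rw [hq, hpx, Finset.mul_sum]
    refine Finset.sum_le_sum fun i _ => ?_
    have : w i * (b⁻¹ * ⟪colVec U i, p⟫) ^ 2 = (b⁻¹ * w i) * b⁻¹ * ⟪colVec U i, p⟫ ^ 2 := by ring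
    have h3 : b⁻¹ * w i ≤ w' i := by
      rw [inv_mul_le_iff₀ hb]
      exact hi i
    rw [this]
    calc (b⁻¹ * w i) * b⁻¹ * ⟪colVec U i, p⟫ ^ 2 ≤ w' i * b⁻¹ * ⟪colVec U i, p⟫ ^ 2 := by gcongr
      _ = _ := by ring
  have h4 : w j * (b⁻¹ * q) ≤ lev U w j := by
    refine le_trans ?_ h1
    refine mul_le_mul_of_nonneg_left ?_ (hw j).le
    rw [← hq]
    linarith
  have hq0 : 0 ≤ q := by
    rw [hq, hpx]
    exact Finset.sum_nonneg fun i _ => mul_nonneg (hw' i).le (mul_self_nonneg _)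
  have ha : 0 ≤ a := by
    by_contra h
    have := mul_neg_of_neg_of_pos (not_le.mp h) (hw j)
    linarith [hw' j]
  rw [hp]
  calc w' j * q ≤ a * w j * q := by gcongr
    _ = a * b * (w j * (b⁻¹ * q)) := by field_simp
    _ ≤ _ := by gcongr

theorem lev_smul (hU : IsFrame U) (hw : ∀ j, 0 < w j) {t : ℝ} (ht : 0 < t) (j : Fin n) :
    lev U (fun i => t * w i) j = lev U w j := by
  have hw' : ∀ j, 0 < t * w j := fun j => mul_pos ht (hw j)
  apply le_antisymm
  · have := lev_le_of_le hU hw hw' (a := t) (b := t⁻¹) (inv_pos.mpr ht) (j := j) le_rfl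
      (fun i => by rw [inv_mul_cancel_left₀ ht.ne'])
    rwa [mul_inv_cancel₀ ht.ne', one_mul] at this
  · have := lev_le_of_le hU hw' hw (a := t⁻¹) (b := t) ht (j := j)
      (by rw [inv_mul_cancel_left₀ ht.ne']) (fun i => le_rfl)
    rwa [inv_mul_cancel₀ ht.ne', one_mul] at this

/-- Multiplying each scale factor by at most `1 + δ`, up or down, changes the leverage scores by
at most `3 d δ` in total. -/
theorem sum_abs_lev_sub_le_of_close (hU : IsFrame U) (hw : ∀ j, 0 < w j) (hw' : ∀ j, 0 < w' j)
    {δ : ℝ} (hδ : 0 ≤ δ) (hδ1 : δ ≤ 1) (h : ∀ j, w' j ≤ (1 + δ) * w j)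
    (h' : ∀ j, w j ≤ (1 + δ) * w' j) :
    ∑ j, |lev U w j - lev U w' j| ≤ 3 * d * δ := by
  have hsum : ∑ j, 3 * δ * lev U w j = 3 * d * δ := by
    rw [← Finset.mul_sum, sum_lev hU hw]
    ring
  rw [← hsum]
  refine Finset.sum_le_sum fun j _ => ?_
  have h1 := lev_le_of_le hU hw hw' (by linarith) (h j) h'
  have h2 := lev_le_of_le hU hw' hw (by linarith) (h' j) h
  have h3 := lev_nonneg hU hw j
  have h4 := lev_nonneg hU hw' j
  have h5 : (1 + δ) * (1 + δ) ≤ 1 + 3 * δ := by nlinarith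
  have h6 : lev U w' j ≤ (1 + 3 * δ) * lev U w j := h1.trans (by gcongr)
  have h7 : lev U w j ≤ (1 + 3 * δ) * lev U w' j := h2.trans (by gcongr)
  rw [abs_le]
  constructor
  · linarith
  · rcases le_total (lev U w j) (lev U w' j) with h8 | h8
    · have : 0 ≤ 3 * δ * lev U w j := by positivity
      linarith
    · have : 3 * δ * lev U w' j ≤ 3 * δ * lev U w j := by gcongr
      linarith

/-- The frame operator of the vectors in S maps their span to itself. The lower bound on its
quadratic form makes it injective, hence surjective in finite dimension, and p is a preimage of u_j.
-/
theorem exists_preimage_of_quad_le {ι : Type*} {E : Type*} [NormedAddCommGroup E]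
    [InnerProductSpace ℝ E] [FiniteDimensional ℝ E] (S : Finset ι) (u : ι → E) (w : ι → ℝ) {μ : ℝ}
    (hμ : 0 < μ)
    (h : ∀ p ∈ Submodule.span ℝ (u '' S), μ * ‖p‖ ^ 2 ≤ ∑ i ∈ S, w i * ⟪u i, p⟫ ^ 2) {j : ι}
    (hj : j ∈ S) :
    ∃ p ∈ Submodule.span ℝ (u '' S), ∀ x, ⟪u j, x⟫ = ∑ i ∈ S, w i * (⟪u i, x⟫ * ⟪u i, p⟫) := by
  set V := Submodule.span ℝ (u '' S)
  have hu : ∀ i ∈ S, u i ∈ V := fun i hi => Submodule.subset_span ⟨i, hi, rfl⟩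
  let f : V →ₗ[ℝ] V :=
    { toFun := fun p => ⟨∑ i ∈ S, (w i * ⟪u i, (p : E)⟫) • u i,
        Submodule.sum_mem _ fun i hi => Submodule.smul_mem _ _ (hu i hi)⟩
      map_add' := fun p q => by
        ext
        simp [inner_add_right, mul_add, add_smul, Finset.sum_add_distrib]
      map_smul' := fun c p => by
        ext
        simp only [Submodule.coe_smul, inner_smul_right, RingHom.id_apply, Finset.smul_sum,
          smul_smul]
        exact Finset.sum_congr rfl fun i _ => by ring_nf }
  have hf : ∀ (p : V) (x : E), ⟪x, (f p : E)⟫ = ∑ i ∈ S, w i * (⟪u i, x⟫ * ⟪u i, (p : E)⟫) := by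
    intro p x
    change ⟪x, ∑ i ∈ S, (w i * ⟪u i, (p : E)⟫) • u i⟫ = _
    rw [inner_sum]
    refine Finset.sum_congr rfl fun i _ => ?_
    rw [inner_smul_right, real_inner_comm x (u i)]
    ring
  have hinj : Function.Injective f := by
    rw [injective_iff_map_eq_zero]
    intro p hp
    have h1 := hf p p
    rw [hp] at h1
    simp only [Submodule.coe_zero, inner_zero_right, ← sq] at h1
    have h2 := h p p.2
    rw [← h1] at h2
    have h3 : ‖(p : E)‖ ^ 2 = 0 :=
      le_antisymm (nonpos_of_mul_nonpos_right h2 hμ) (sq_nonneg _)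
    simpa using h3
  obtain ⟨p, hp⟩ := LinearMap.injective_iff_surjective.mp hinj ⟨u j, hu j hj⟩
  refine ⟨p, p.2, fun x => ?_⟩
  rw [← hf, hp, real_inner_comm]

/-- If the scale factors outside `S` are small, then decreasing them further by a common factor
hardly changes the leverage scores. -/
theorem sum_abs_lev_sub_le_of_gap (hU : IsFrame U) (hw : ∀ j, 0 < w j) (hw' : ∀ j, 0 < w' j)
    (S : Finset (Fin n)) {t μ τ : ℝ} (ht : 1 ≤ t) (hS : ∀ j ∈ S, w j = w' j)
    (hT : ∀ j ∉ S, w j = t * w' j) (hμ : 0 < μ) (hτ : 0 ≤ τ)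
    (hquad : ∀ p ∈ Submodule.span ℝ (colVec U '' S),
      μ * ‖p‖ ^ 2 ≤ ∑ i ∈ S, w i * ⟪colVec U i, p⟫ ^ 2)
    (hle : ∀ j ∉ S, w j ≤ τ) :
    ∑ j, |lev U w' j - lev U w j| ≤ 2 * (n * (τ * (∑ j, ‖colVec U j‖ ^ 2) / μ)) := by
  set R := ∑ j, ‖colVec U j‖ ^ 2
  have hR : 0 ≤ R := by positivity
  have ht0 : 0 < t := by linarith
  have hmono : ∀ i, w' i ≤ w i := fun i => by
    by_cases hi : i ∈ S
    · exact (hS i hi).ge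
    · rw [hT i hi]
      exact le_mul_of_one_le_left (hw' i).le ht
  have hmono' : ∀ i, w i ≤ t * w' i := fun i => by
    by_cases hi : i ∈ S
    · rw [hS i hi]
      exact le_mul_of_one_le_left (hw' i).le ht
    · rw [hT i hi]
  have hdec : ∀ j ∈ S, lev U w j ≤ lev U w' j := fun j hj => by
    have := lev_le_of_le hU hw' hw (a := 1) (b := 1) one_pos (j := j) (by rw [hS j hj, one_mul])
      (fun i => by rw [one_mul]; exact hmono i)
    simpa using this
  have hinc : ∀ j ∉ S, lev U w' j ≤ lev U w j := fun j hj => by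
    have := lev_le_of_le hU hw hw' (a := t⁻¹) (b := t) ht0 (j := j)
      (by rw [hT j hj, inv_mul_cancel_left₀ ht0.ne']) hmono'
    rwa [inv_mul_cancel₀ ht0.ne', one_mul] at this
  -- Passing from w to w' raises the scores in S and lowers the others. Both vectors of scores sum
  -- to d, so the total change is twice the rise in S.
  have hsum : ∑ j, |lev U w' j - lev U w j| = 2 * ∑ j ∈ S, (lev U w' j - lev U w j) := by
    have h0 : ∑ j, (lev U w' j - lev U w j) = 0 := by
      rw [Finset.sum_sub_distrib, sum_lev hU hw, sum_lev hU hw', sub_self]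
    rw [← Finset.sum_add_sum_compl S] at h0 ⊢
    have h1 : ∑ j ∈ S, |lev U w' j - lev U w j| = ∑ j ∈ S, (lev U w' j - lev U w j) :=
      Finset.sum_congr rfl fun j hj => abs_of_nonneg (sub_nonneg.mpr (hdec j hj))
    have h2 : ∑ j ∈ Sᶜ, |lev U w' j - lev U w j| = - ∑ j ∈ Sᶜ, (lev U w' j - lev U w j) := by
      rw [← Finset.sum_neg_distrib]
      exact Finset.sum_congr rfl fun j hj =>
        abs_of_nonpos (sub_nonpos.mpr (hinc j (Finset.mem_compl.mp hj)))
    rw [h1, h2]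
    linarith
  rw [hsum]
  -- Both scores are compared with w_j q, the score of column j in the frame formed by S alone.
  have hterm : ∀ j ∈ S, lev U w' j - lev U w j ≤ τ * R / μ := by
    intro j hj
    obtain ⟨p, hpV, hp⟩ := exists_preimage_of_quad_le S (colVec U) w hμ hquad hj
    set q := ⟪colVec U j, p⟫ with hq
    have hqS : q = ∑ i ∈ S, w i * ⟪colVec U i, p⟫ ^ 2 := by
      rw [hq, hp p]
      exact Finset.sum_congr rfl fun i _ => by ring
    -- Discard the terms outside S in the form for w' and complete the square on S around p.
    have hup : lev U w' j ≤ w j * q := by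
      obtain ⟨x, hx, hxx⟩ := lev_attained hU hw' j
      rw [hx, ← hS j hj]
      refine mul_le_mul_of_nonneg_left ?_ (hw j).le
      have h1 : ∑ i ∈ S, w i * ⟪colVec U i, x⟫ ^ 2 ≤ ⟪colVec U j, x⟫ := by
        rw [hxx x, ← Finset.sum_add_sum_compl S]
        have h2 : 0 ≤ ∑ i ∈ Sᶜ, w' i * (⟪colVec U i, x⟫ * ⟪colVec U i, x⟫) :=
          Finset.sum_nonneg fun i _ => mul_nonneg (hw' i).le (mul_self_nonneg _)
        have h3 : ∑ i ∈ S, w i * ⟪colVec U i, x⟫ ^ 2 =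
            ∑ i ∈ S, w' i * (⟪colVec U i, x⟫ * ⟪colVec U i, x⟫) :=
          Finset.sum_congr rfl fun i hi => by rw [hS i hi, sq]
        linarith
      have h4 : 0 ≤ ∑ i ∈ S, w i * (⟪colVec U i, x⟫ - ⟪colVec U i, p⟫) ^ 2 :=
        Finset.sum_nonneg fun i _ => mul_nonneg (hw i).le (sq_nonneg _)
      have h5 : ∑ i ∈ S, w i * (⟪colVec U i, x⟫ - ⟪colVec U i, p⟫) ^ 2 =
          ∑ i ∈ S, w i * ⟪colVec U i, x⟫ ^ 2 -
          2 * ∑ i ∈ S, w i * (⟪colVec U i, x⟫ * ⟪colVec U i, p⟫) +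
          ∑ i ∈ S, w i * ⟪colVec U i, p⟫ ^ 2 := by
        rw [Finset.mul_sum, ← Finset.sum_sub_distrib, ← Finset.sum_add_distrib]
        exact Finset.sum_congr rfl fun i _ => by ring
      rw [← hp x, ← hqS] at h5
      linarith
    -- Test with p: the terms outside S contribute at most τ R |p|².
    have hlow : w j * (q - τ * R * ‖p‖ ^ 2) ≤ lev U w j := by
      refine le_trans ?_ (lev_lower hU hw j p)
      refine mul_le_mul_of_nonneg_left ?_ (hw j).le
      rw [← Finset.sum_add_sum_compl S, ← hqS, ← hq]
      have h1 : ∑ i ∈ Sᶜ, w i * ⟪colVec U i, p⟫ ^ 2 ≤ τ * R * ‖p‖ ^ 2 := by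
        calc ∑ i ∈ Sᶜ, w i * ⟪colVec U i, p⟫ ^ 2
            ≤ ∑ i ∈ Sᶜ, τ * (‖colVec U i‖ ^ 2 * ‖p‖ ^ 2) := by
              refine Finset.sum_le_sum fun i hi => ?_
              have h2 : ⟪colVec U i, p⟫ ^ 2 ≤ ‖colVec U i‖ ^ 2 * ‖p‖ ^ 2 := by
                rw [← mul_pow, sq_le_sq]
                exact (abs_real_inner_le_norm _ _).trans (le_abs_self _)
              exact mul_le_mul (hle i (Finset.mem_compl.mp hi)) h2 (sq_nonneg _) hτ
          _ ≤ ∑ i, τ * (‖colVec U i‖ ^ 2 * ‖p‖ ^ 2) :=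
              Finset.sum_le_sum_of_subset_of_nonneg (Finset.subset_univ _)
                fun i _ _ => by positivity
          _ = τ * R * ‖p‖ ^ 2 := by
              rw [← Finset.mul_sum, ← Finset.sum_mul, mul_assoc]
      linarith
    -- The j-th summand of q = ∑ w_i ⟨u_i, p⟩² is w_j q², so w_j q² ≤ q.
    have hwq : w j * q ≤ 1 := by
      have h1 : w j * q ^ 2 ≤ q := by
        nth_rewrite 2 [hqS]
        exact Finset.single_le_sum (f := fun i => w i * ⟪colVec U i, p⟫ ^ 2)
          (fun i _ => mul_nonneg (hw i).le (sq_nonneg _)) hj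
      have h2 : 0 ≤ q := le_trans (mul_nonneg (hw j).le (sq_nonneg _)) h1
      rcases h2.eq_or_lt with h2 | h2
      · rw [← h2]
        simp
      · by_contra hcon
        have := mul_lt_mul_of_pos_right (not_le.mp hcon) h2
        nlinarith
    have hpq : μ * ‖p‖ ^ 2 ≤ q := (hquad p hpV).trans hqS.ge
    have hfin : w j * ‖p‖ ^ 2 ≤ 1 / μ := by
      rw [le_div_iff₀ hμ]
      calc w j * ‖p‖ ^ 2 * μ = w j * (μ * ‖p‖ ^ 2) := by ring
        _ ≤ w j * q := mul_le_mul_of_nonneg_left hpq (hw j).le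
        _ ≤ 1 := hwq
    calc lev U w' j - lev U w j ≤ τ * R * (w j * ‖p‖ ^ 2) := by linarith
      _ ≤ τ * R * (1 / μ) := by gcongr
      _ = τ * R / μ := by ring
  have hcard : ∑ j ∈ S, (lev U w' j - lev U w j) ≤ S.card • (τ * R / μ) :=
    Finset.sum_le_card_nsmul _ _ _ hterm
  rw [nsmul_eq_mul] at hcard
  have hSn : (S.card : ℝ) ≤ n := by
    exact_mod_cast (Finset.card_le_univ S).trans (Fintype.card_fin n).le
  have : (S.card : ℝ) * (τ * R / μ) ≤ n * (τ * R / μ) := by gcongr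
  linarith

end

/-! ### Truncation of the scale factors of sorted columns -/

section

variable {d n : ℕ}

open scoped RealInnerProductSpace
open InnerProductSpace (gramSchmidt)

theorem colSq_extendMat (A : Matrix (Fin d) (Fin n) ℝ) {k : ℕ} (hk : k < n) :
    colSq d (extendMat A) k = ‖colVec A ⟨k, hk⟩‖ ^ 2 := by
  rw [EuclideanSpace.real_norm_sq_eq, colSq, Finset.sum_range]
  refine Finset.sum_congr rfl fun i _ => ?_
  rw [extendMat_of_lt A i.2 hk, sq]
  rfl

theorem gsSq_eq (U : Matrix (Fin d) (Fin n) ℝ) {k : ℕ} (hk : k < n) :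
    gsSq U k = ‖gramSchmidt ℝ (colVec U) ⟨k, hk⟩‖ ^ 2 := by
  rw [gsSq, colSq_extendMat _ hk]
  rfl

theorem gsSq_of_le (U : Matrix (Fin d) (Fin n) ℝ) {k : ℕ} (hk : n ≤ k) : gsSq U k = 0 := by
  rw [gsSq, colSq]
  refine Finset.sum_eq_zero fun i _ => ?_
  rw [extendMat, dif_neg (by omega), mul_zero]

theorem gsSq_nonneg (U : Matrix (Fin d) (Fin n) ℝ) (k : ℕ) : 0 ≤ gsSq U k := by
  rw [gsSq, colSq]
  exact Finset.sum_nonneg fun _ _ => mul_self_nonneg _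

theorem normConst_eq (U : Matrix (Fin d) (Fin n) ℝ) :
    normConst U = n * (∑ j, ‖colVec U j‖ ^ 2) * 5 := by
  rw [normConst, totalSq, Finset.sum_range]
  congr 2
  exact Finset.sum_congr rfl fun j _ => colSq_extendMat U j.2

theorem norm_sq_colVec_le (U : Matrix (Fin d) (Fin n) ℝ) (j : Fin n) :
    ‖colVec U j‖ ^ 2 ≤ ∑ j, ‖colVec U j‖ ^ 2 :=
  Finset.single_le_sum (f := fun j => ‖colVec U j‖ ^ 2) (fun _ _ => sq_nonneg _)
    (Finset.mem_univ j)

/-- A vector is its Gram-Schmidt vector plus an orthogonal vector from the span of its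
predecessors. -/
theorem exists_gramSchmidt_decomp {E : Type*} [NormedAddCommGroup E] [InnerProductSpace ℝ E]
    (u : Fin n → E) (k : Fin n) :
    ∃ v ∈ Submodule.span ℝ (u '' Set.Iio k), u k = gramSchmidt ℝ u k + v ∧
      ∀ a ∈ Submodule.span ℝ (u '' Set.Iio k), ⟪gramSchmidt ℝ u k, a⟫ = 0 := by
  refine ⟨∑ i ∈ Finset.Iio k, (⟪gramSchmidt ℝ u i, u k⟫ / (‖gramSchmidt ℝ u i‖ : ℝ) ^ 2) •
    gramSchmidt ℝ u i, ?_, ?_, ?_⟩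
  · rw [← InnerProductSpace.span_gramSchmidt_Iio ℝ u k]
    exact Submodule.sum_mem _ fun i hi => Submodule.smul_mem _ _
      (Submodule.subset_span ⟨i, Finset.mem_Iio.mp hi, rfl⟩)
  · exact InnerProductSpace.gramSchmidt_def'' ℝ u k
  · intro a ha
    induction ha using Submodule.span_induction with
    | mem x hx =>
      obtain ⟨i, hi, rfl⟩ := hx
      exact InnerProductSpace.gramSchmidt_inv_triangular ℝ u hi
    | zero => exact inner_zero_right _
    | add x y _ _ hx hy => rw [inner_add_right, hx, hy, add_zero]
    | smul c x _ hx => rw [inner_smul_right, hx, mul_zero]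

theorem gsSq_le (U : Matrix (Fin d) (Fin n) ℝ) (k : ℕ) : gsSq U k ≤ ∑ j, ‖colVec U j‖ ^ 2 := by
  rcases lt_or_ge k n with hk | hk
  · refine le_trans ?_ (norm_sq_colVec_le U ⟨k, hk⟩)
    obtain ⟨v, hv, huv, horth⟩ := exists_gramSchmidt_decomp (colVec U) ⟨k, hk⟩
    rw [gsSq_eq U hk, huv, sq, sq, norm_add_sq_eq_norm_sq_add_norm_sq_real (horth v hv)]
    exact le_add_of_nonneg_right (mul_self_nonneg _)
  · rw [gsSq_of_le U hk]
    exact Finset.sum_nonneg fun _ _ => sq_nonneg _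

theorem normConst_pos (U : Matrix (Fin d) (Fin n) ℝ) {k : ℕ} (hk : 0 < gsSq U k) :
    0 < normConst U := by
  have hkn : k < n := by
    by_contra h
    rw [gsSq_of_le U (not_lt.mp h)] at hk
    exact lt_irrefl _ hk
  have := hk.trans_le (gsSq_le U k)
  have hn : (0 : ℝ) < n := by exact_mod_cast (by omega : 0 < n)
  rw [normConst_eq]
  positivity

theorem floors_pos (U : Matrix (Fin d) (Fin n) ℝ) {δ : ℝ} (hδ : 0 < δ) (k : ℕ) :
    0 < floors U δ k := by
  induction k with
  | zero => exact one_pos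
  | succ k ih =>
    change 0 < (if gsSq U k ≤ 0 then floors U δ k else
      floors U δ k * (gsSq U k * δ / normConst U))
    split_ifs with h
    · exact ih
    · have h1 := not_le.mp h
      have h2 := normConst_pos U h1
      positivity

theorem floors_succ_of_eq_zero (U : Matrix (Fin d) (Fin n) ℝ) (δ : ℝ) {k : ℕ}
    (hk : gsSq U k = 0) : floors U δ (k + 1) = floors U δ k :=
  if_pos hk.le

theorem floors_succ_of_pos (U : Matrix (Fin d) (Fin n) ℝ) (δ : ℝ) {k : ℕ} (hk : 0 < gsSq U k) :
    floors U δ (k + 1) = floors U δ k * (gsSq U k * δ / normConst U) :=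
  if_neg (not_le.mpr hk)

theorem floors_succ_le (U : Matrix (Fin d) (Fin n) ℝ) {δ : ℝ} (hδ : 0 < δ) (hδ1 : δ ≤ 1) (k : ℕ) :
    floors U δ (k + 1) ≤ floors U δ k := by
  rcases (gsSq_nonneg U k).eq_or_lt with h | h
  · rw [floors_succ_of_eq_zero U δ h.symm]
  · rw [floors_succ_of_pos U δ h]
    have hn : (1 : ℝ) ≤ n := by
      have : k < n := by
        by_contra hk
        rw [gsSq_of_le U (not_lt.mp hk)] at h
        exact lt_irrefl _ h
      exact_mod_cast (by omega : 1 ≤ n)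
    have hR := gsSq_le U k
    have hR0 := h.trans_le hR
    refine mul_le_of_le_one_right (floors_pos U hδ k).le ?_
    rw [div_le_one (normConst_pos U h), normConst_eq]
    nlinarith [mul_le_mul hR hδ1 hδ.le hR0.le]

theorem floors_antitone (U : Matrix (Fin d) (Fin n) ℝ) {δ : ℝ} (hδ : 0 < δ) (hδ1 : δ ≤ 1) :
    Antitone (floors U δ) :=
  antitone_nat_of_succ_le (floors_succ_le U hδ hδ1)

variable {U : Matrix (Fin d) (Fin n) ℝ} {z : Fin n → ℝ} {δ : ℝ}

theorem scales_succ (U : Matrix (Fin d) (Fin n) ℝ) (z : Fin n → ℝ) (δ : ℝ) (k : ℕ) :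
    scales U z δ (k + 1) = max (scales U z δ k * extendVec z (k + 1) / extendVec z k)
      (floors U δ (k + 1)) :=
  (max_def _ _).symm

theorem floors_le_scales (U : Matrix (Fin d) (Fin n) ℝ) (z : Fin n → ℝ) (δ : ℝ) (k : ℕ) :
    floors U δ k ≤ scales U z δ k := by
  cases k with
  | zero => exact le_rfl
  | succ k =>
    rw [scales_succ]
    exact le_max_right _ _

theorem scales_pos (U : Matrix (Fin d) (Fin n) ℝ) (z : Fin n → ℝ) (hδ : 0 < δ) (k : ℕ) :
    0 < scales U z δ k :=
  (floors_pos U hδ k).trans_le (floors_le_scales U z δ k)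

theorem extendVec_pos (hz : ∀ j, 0 < z j) (k : ℕ) : 0 < extendVec z k := by
  rw [extendVec]
  split_ifs
  · exact hz _
  · exact one_pos

theorem extendVec_anti (hanti : Antitone z) {k l : ℕ} (hkl : k ≤ l) (hl : l < n) :
    extendVec z l ≤ extendVec z k := by
  rw [extendVec_of_lt z hl, extendVec_of_lt z (hkl.trans_lt hl)]
  exact hanti hkl

theorem scales_succ_le (hδ : 0 < δ) (hδ1 : δ ≤ 1) (hz : ∀ j, 0 < z j) (hanti : Antitone z)
    {k : ℕ} (hk : k + 1 < n) : scales U z δ (k + 1) ≤ scales U z δ k := by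
  rw [scales_succ]
  refine max_le ?_ ((floors_succ_le U hδ hδ1 k).trans (floors_le_scales U z δ k))
  rw [div_le_iff₀ (extendVec_pos hz k)]
  exact mul_le_mul_of_nonneg_left (extendVec_anti hanti (by omega) hk) (scales_pos U z hδ k).le

theorem scales_le_one (hδ : 0 < δ) (hδ1 : δ ≤ 1) (hz : ∀ j, 0 < z j) (hanti : Antitone z)
    {k : ℕ} (hk : k < n) : scales U z δ k ≤ 1 := by
  induction k with
  | zero => exact le_rfl
  | succ k ih => exact (scales_succ_le hδ hδ1 hz hanti hk).trans (ih (by omega))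

/-- Between equal keys no gap is truncated, because the floors decrease. Hence the output does not
depend on which of several equal keys the final search finds. -/
theorem scales_eq_of_eq (hδ : 0 < δ) (hδ1 : δ ≤ 1) (hz : ∀ j, 0 < z j) (hanti : Antitone z)
    {k l : ℕ} (hkl : k ≤ l) (hl : l < n) (h : extendVec z k = extendVec z l) :
    scales U z δ k = scales U z δ l := by
  induction l, hkl using Nat.le_induction with
  | base => rfl
  | succ l hkl ih =>
    have h1 := extendVec_anti hanti hkl (by omega : l < n)
    have h2 := extendVec_anti hanti l.le_succ hl
    have h3 : extendVec z k = extendVec z l := le_antisymm (h ▸ h2) h1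
    have h4 := extendVec_pos hz l
    rw [ih (by omega) h3, scales_succ, ← h, h3, mul_div_assoc, div_self h4.ne', mul_one,
      max_eq_left]
    exact (floors_succ_le U hδ hδ1 l).trans (floors_le_scales U z δ l)

/-- The first `k` indices. -/
def initialIdx (n k : ℕ) : Finset (Fin n) := Finset.univ.filter fun j => (j : ℕ) < k

theorem mem_initialIdx {k : ℕ} {j : Fin n} : j ∈ initialIdx n k ↔ (j : ℕ) < k := by
  simp [initialIdx]

theorem initialIdx_succ {k : ℕ} (hk : k < n) :
    initialIdx n (k + 1) = insert ⟨k, hk⟩ (initialIdx n k) := by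
  ext j
  simp only [Finset.mem_insert, mem_initialIdx, Fin.ext_iff]
  omega

theorem coe_initialIdx {k : ℕ} (hk : k < n) :
    (initialIdx n k : Set (Fin n)) = Set.Iio ⟨k, hk⟩ := by
  ext j
  simp [mem_initialIdx, Fin.lt_def]

/-- The inductive step for one new column u = v + e with e orthogonal to the earlier span. Here p =
a + s e, A = |a|², E = |e|², x = ⟨v, a⟩, and T is the form of the earlier columns. The new
coefficient is F E / 5. Now E A ≤ R A and (sE)² ≤ 2(x + sE)² + 2RA add up to at most 3RA + 2(x +
sE)², which the constant 5 covers; R F A is paid for by T, and F (x + sE)² by the new column. -/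
theorem quad_step {m R F δ y A E s x T : ℝ} (hδ : 0 < δ) (hδ1 : δ ≤ 1) (hm : 1 ≤ m) (hR : 0 < R)
    (hF : 0 < F) (hFy : F ≤ y) (hA : 0 ≤ A) (hE : 0 < E) (hER : E ≤ R) (hx : x ^ 2 ≤ R * A)
    (hT : m * R * F / δ * A ≤ T) :
    m * R * (F * (E * δ / (m * R * 5))) / δ * (A + s ^ 2 * E) ≤ y * (x + s * E) ^ 2 + T := by
  have hcoef : m * R * (F * (E * δ / (m * R * 5))) / δ = F * (E / 5) := by
    have : m ≠ 0 := by positivity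
    field_simp
  have h1 : R * F * A ≤ m * R * F / δ * A := by
    have : R * F ≤ m * R * F / δ := by
      rw [le_div_iff₀ hδ]
      calc R * F * δ ≤ R * F * 1 := by gcongr
        _ ≤ R * F * m := by gcongr
        _ = m * R * F := by ring
    gcongr
  have h2 : F * (x + s * E) ^ 2 ≤ y * (x + s * E) ^ 2 := by gcongr
  have h3 : E / 5 * (A + s ^ 2 * E) ≤ R * A + (x + s * E) ^ 2 := by
    have h4 : E * A ≤ R * A := by gcongr
    have h5 : (s * E) ^ 2 ≤ 2 * (x + s * E) ^ 2 + 2 * x ^ 2 := by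
      nlinarith [sq_nonneg (2 * x + s * E)]
    have h6 := sq_nonneg (x + s * E)
    have h7 : 0 ≤ R * A := by positivity
    calc E / 5 * (A + s ^ 2 * E) = (E * A + (s * E) ^ 2) / 5 := by ring
      _ ≤ _ := by linarith
  rw [hcoef]
  calc F * (E / 5) * (A + s ^ 2 * E) = F * (E / 5 * (A + s ^ 2 * E)) := by ring
    _ ≤ F * (R * A + (x + s * E) ^ 2) := by gcongr
    _ = F * (x + s * E) ^ 2 + R * F * A := by ring
    _ ≤ _ := add_le_add h2 (h1.trans hT)

/-- On the span of the first `k` columns, their frame operator with truncated scale factors is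
bounded below in terms of `floors U δ k`. -/
theorem floors_mul_norm_sq_le (hδ : 0 < δ) (hδ1 : δ ≤ 1) {k : ℕ} (hk : k ≤ n)
    {p : EuclideanSpace ℝ (Fin d)} (hp : p ∈ Submodule.span ℝ (colVec U '' initialIdx n k)) :
    n * (∑ j, ‖colVec U j‖ ^ 2) * floors U δ k / δ * ‖p‖ ^ 2 ≤
      ∑ j ∈ initialIdx n k, scales U z δ j * ⟪colVec U j, p⟫ ^ 2 := by
  set R := ∑ j, ‖colVec U j‖ ^ 2 with hRdef
  induction k generalizing p with
  | zero =>
    have h0 : initialIdx n 0 = ∅ := by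
      ext j
      simp [mem_initialIdx]
    rw [h0] at hp ⊢
    have hp0 : p = 0 := by simpa using hp
    simp [hp0]
  | succ k ih =>
    have hkn : k < n := hk
    obtain ⟨v, hv, huv, horth⟩ := exists_gramSchmidt_decomp (colVec U) ⟨k, hkn⟩
    rw [← coe_initialIdx hkn] at hv horth
    set e := gramSchmidt ℝ (colVec U) ⟨k, hkn⟩ with he
    have hE := gsSq_eq U hkn
    rw [← he] at hE
    have hnot : (⟨k, hkn⟩ : Fin n) ∉ initialIdx n k := by simp [mem_initialIdx]
    -- Write p = s u_k + a' = a + s e with a in the span of the earlier columns. Since e is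
    -- orthogonal to that span, the earlier columns see only a, and the induction hypothesis applies
    -- to a.
    rw [initialIdx_succ hkn, Finset.coe_insert, Set.image_insert_eq,
      Submodule.mem_span_insert] at hp
    obtain ⟨s, a', ha', hpa⟩ := hp
    set a := s • v + a' with ha
    have haV : a ∈ Submodule.span ℝ (colVec U '' initialIdx n k) :=
      Submodule.add_mem _ (Submodule.smul_mem _ _ hv) ha'
    have hpe : p = a + s • e := by
      rw [hpa, huv, ha, smul_add]
      abel
    clear_value a
    rw [initialIdx_succ hkn, Finset.sum_insert hnot]
    have hyk := scales_pos U z hδ k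
    have hFk := floors_pos U hδ k
    rcases (gsSq_nonneg U k).eq_or_lt with h | h
    · have he0 : e = 0 := by
        rw [← h] at hE
        simpa using hE.symm
      rw [he0, smul_zero, add_zero] at hpe
      rw [floors_succ_of_eq_zero U δ h.symm, hpe]
      exact (ih (by omega) haV).trans (le_add_of_nonneg_left (by positivity))
    · rw [floors_succ_of_pos U δ h, normConst_eq, ← hRdef, hE]
      rw [hE] at h
      have hER : ‖e‖ ^ 2 ≤ R := hE ▸ gsSq_le U k
      have hR : 0 < R := h.trans_le hER
      have hn : (1 : ℝ) ≤ n := by exact_mod_cast (by omega : 1 ≤ n)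
      have hvR : ‖v‖ ^ 2 ≤ R := by
        refine le_trans ?_ (norm_sq_colVec_le U ⟨k, hkn⟩)
        rw [huv, sq, sq, norm_add_sq_eq_norm_sq_add_norm_sq_real (horth v hv)]
        exact le_add_of_nonneg_left (mul_self_nonneg _)
      have hea := horth a haV
      have hev := horth v hv
      have hnorm : ‖p‖ ^ 2 = ‖a‖ ^ 2 + s ^ 2 * ‖e‖ ^ 2 := by
        have h0 : ⟪a, s • e⟫ = 0 := by rw [inner_smul_right, real_inner_comm, hea, mul_zero]
        rw [hpe, sq, norm_add_sq_eq_norm_sq_add_norm_sq_real h0, norm_smul]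
        rw [Real.norm_eq_abs]
        nlinarith [sq_abs s]
      set x := ⟪v, a⟫ with hx
      have hxR : x ^ 2 ≤ R * ‖a‖ ^ 2 := by
        have h1 : x ^ 2 ≤ ‖v‖ ^ 2 * ‖a‖ ^ 2 := by
          rw [← mul_pow, sq_le_sq]
          exact (abs_real_inner_le_norm _ _).trans (le_abs_self _)
        exact h1.trans (by gcongr)
      have hlast : ⟪colVec U ⟨k, hkn⟩, p⟫ = x + s * ‖e‖ ^ 2 := by
        rw [huv, hpe, inner_add_left, inner_add_right, inner_add_right, hea, inner_smul_right,
          inner_smul_right, real_inner_comm e v, hev, real_inner_self_eq_norm_sq]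
        ring
      have hfirst : ∑ j ∈ initialIdx n k, scales U z δ j * ⟪colVec U j, p⟫ ^ 2 =
          ∑ j ∈ initialIdx n k, scales U z δ j * ⟪colVec U j, a⟫ ^ 2 := by
        refine Finset.sum_congr rfl fun j hj => ?_
        have : ⟪colVec U j, e⟫ = 0 := by
          rw [real_inner_comm]
          exact horth _ (Submodule.subset_span ⟨j, hj, rfl⟩)
        rw [hpe, inner_add_right, inner_smul_right, this, mul_zero, add_zero]
      rw [hfirst, hlast, hnorm]
      exact quad_step hδ hδ1 hn hR hFk (floors_le_scales U z δ k) (sq_nonneg _) h hER hxR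
        (ih (by omega) haV)

/-- The scale factors in which the first `k` gaps are truncated. -/
def hybrid (U : Matrix (Fin d) (Fin n) ℝ) (z : Fin n → ℝ) (δ : ℝ) (k : ℕ) (j : Fin n) : ℝ :=
  scales U z δ (min j k) / extendVec z (min j k) * z j

theorem hybrid_pos (hδ : 0 < δ) (hz : ∀ j, 0 < z j) (k : ℕ) (j : Fin n) :
    0 < hybrid U z δ k j :=
  mul_pos (div_pos (scales_pos U z hδ _) (extendVec_pos hz _)) (hz j)

theorem hybrid_of_le (hz : ∀ j, 0 < z j) {k : ℕ} {j : Fin n} (hj : (j : ℕ) ≤ k) :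
    hybrid U z δ k j = scales U z δ j := by
  rw [hybrid, min_eq_left hj, extendVec_of_lt z j.2, div_mul_cancel₀ _ (hz j).ne']

theorem hybrid_of_ge {k : ℕ} {j : Fin n} (hj : k ≤ (j : ℕ)) :
    hybrid U z δ k j = scales U z δ k / extendVec z k * z j := by
  rw [hybrid, min_eq_right hj]

/-- If the gap is not truncated, the two weight vectors coincide. Otherwise they agree on the first
k + 1 columns and are proportional on the others, where the larger weights are at most τ = F_{k+1}.
With μ = n R F_{k+1} / δ the gap estimate 2 n τ R / μ equals 2δ. -/
theorem sum_abs_lev_hybrid_succ_le (hU : IsFrame U) (hd : 0 < d) (hδ : 0 < δ) (hδ1 : δ ≤ 1)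
    (hz : ∀ j, 0 < z j) (hanti : Antitone z) {k : ℕ} (hk : k + 1 < n) :
    ∑ j, |lev U (hybrid U z δ k) j - lev U (hybrid U z δ (k + 1)) j| ≤ 2 * δ := by
  have hzk := extendVec_pos hz k
  have hzk1 := extendVec_pos hz (k + 1)
  have hyk := scales_pos U z hδ k
  have hyk1 := scales_pos U z hδ (k + 1)
  rcases le_total (floors U δ (k + 1)) (scales U z δ k * extendVec z (k + 1) / extendVec z k)
    with h | h
  · have heq : hybrid U z δ (k + 1) = hybrid U z δ k := by
      have h1 : scales U z δ (k + 1) / extendVec z (k + 1) = scales U z δ k / extendVec z k := by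
        rw [scales_succ, max_eq_left h]
        field_simp
      ext j
      rcases le_or_gt (j : ℕ) k with hj | hj
      · rw [hybrid_of_le hz hj, hybrid_of_le hz (by omega)]
      · rw [hybrid_of_ge hj, hybrid_of_ge hj.le, h1]
    rw [heq]
    simp only [sub_self, abs_zero, Finset.sum_const_zero]
    positivity
  · have hy : scales U z δ (k + 1) = floors U δ (k + 1) := by rw [scales_succ, max_eq_right h]
    have hR : 0 < ∑ j, ‖colVec U j‖ ^ 2 := by
      refine (Finset.sum_nonneg fun _ _ => sq_nonneg _).lt_of_ne' fun h0 => ?_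
      have h1 : ∀ j, colVec U j = 0 := fun j => by
        have := (Finset.sum_eq_zero_iff_of_nonneg fun j _ => sq_nonneg ‖colVec U j‖).mp h0 j
          (Finset.mem_univ j)
        simpa using this
      have h2 := hU.eq_zero_of_inner_eq_zero (x := EuclideanSpace.single ⟨0, hd⟩ 1) fun j => by
        rw [h1, inner_zero_left]
      have h3 := congrArg (fun x : EuclideanSpace ℝ (Fin d) => x ⟨0, hd⟩) h2
      simp at h3
    have hn : (0 : ℝ) < n := by exact_mod_cast (by omega : 0 < n)
    have hF := floors_pos U hδ (k + 1)
    have hgap := sum_abs_lev_sub_le_of_gap hU (hybrid_pos (U := U) hδ hz (k + 1))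
      (hybrid_pos (U := U) hδ hz k)
      (initialIdx n (k + 1))
      (t := (scales U z δ (k + 1) / extendVec z (k + 1)) / (scales U z δ k / extendVec z k))
      (μ := n * (∑ j, ‖colVec U j‖ ^ 2) * floors U δ (k + 1) / δ) (τ := floors U δ (k + 1))
      ?_ ?_ ?_ (by positivity) hF.le ?_ ?_
    · refine hgap.trans (le_of_eq ?_)
      field_simp
    · rw [hy, one_le_div (by positivity), div_le_div_iff₀ hzk hzk1]
      rwa [div_le_iff₀ hzk] at h
    · intro j hj
      rw [mem_initialIdx] at hj
      rw [hybrid_of_le hz (by omega), hybrid_of_le hz (by omega)]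
    · intro j hj
      rw [mem_initialIdx] at hj
      rw [hybrid_of_ge (by omega), hybrid_of_ge (by omega)]
      field_simp
    · intro p hp
      refine (floors_mul_norm_sq_le (z := z) hδ hδ1 hk.le hp).trans (le_of_eq ?_)
      refine Finset.sum_congr rfl fun j hj => ?_
      rw [mem_initialIdx] at hj
      rw [hybrid_of_le hz (by omega)]
    · intro j hj
      rw [mem_initialIdx, not_lt] at hj
      rw [hybrid_of_ge hj, hy, div_mul_eq_mul_div, div_le_iff₀ hzk1]
      refine mul_le_mul_of_nonneg_left ?_ hF.le
      have := extendVec_anti hanti hj j.2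
      rwa [extendVec_of_lt z j.2] at this

/-- The hybrids telescope: the one with index 0 is a multiple of z, and the one with index n - 1 is
the fully truncated vector. -/
theorem sum_abs_lev_scales_le (hU : IsFrame U) (hd : 0 < d) (hn : 0 < n) (hδ : 0 < δ)
    (hδ1 : δ ≤ 1) (hz : ∀ j, 0 < z j) (hanti : Antitone z) :
    ∑ j : Fin n, |lev U z j - lev U (fun j => scales U z δ j) j| ≤ 2 * n * δ := by
  have key : ∀ k < n, ∑ j, |lev U z j - lev U (hybrid U z δ k) j| ≤ 2 * k * δ := by
    intro k
    induction k with
    | zero =>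
      intro _
      have h0 : hybrid U z δ 0 = fun j => (1 / extendVec z 0) * z j := by
        ext j
        rw [hybrid_of_ge (Nat.zero_le _)]
        rfl
      have h1 : ∀ j, lev U (hybrid U z δ 0) j = lev U z j := fun j => by
        rw [h0, lev_smul hU hz (div_pos one_pos (extendVec_pos hz 0))]
      simp [h1]
    | succ k ih =>
      intro hk
      calc ∑ j, |lev U z j - lev U (hybrid U z δ (k + 1)) j|
          ≤ ∑ j, (|lev U z j - lev U (hybrid U z δ k) j| +
            |lev U (hybrid U z δ k) j - lev U (hybrid U z δ (k + 1)) j|) :=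
            Finset.sum_le_sum fun j _ => abs_sub_le _ _ _
        _ ≤ 2 * k * δ + 2 * δ := by
            rw [Finset.sum_add_distrib]
            exact add_le_add (ih (by omega)) (sum_abs_lev_hybrid_succ_le hU hd hδ hδ1 hz hanti hk)
        _ = _ := by push_cast; ring
  have hlast : hybrid U z δ (n - 1) = fun j : Fin n => scales U z δ j := by
    ext j
    exact hybrid_of_le hz (by omega)
  rw [← hlast]
  refine (key (n - 1) (by omega)).trans ?_
  have : ((n - 1 : ℕ) : ℝ) ≤ n := by exact_mod_cast Nat.sub_le _ _
  gcongr

/-! ### Rounding -/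

theorem abs_roundTo_zero_sub_le (x : ℝ) : |roundTo x 0 - x| ≤ 1 / 2 := by
  rw [roundTo, pow_zero, mul_one, div_one, abs_sub_comm]
  exact abs_sub_round x

/-- The rounded scale factors of sorted columns. -/
def rounded (U : Matrix (Fin d) (Fin n) ℝ) (z : Fin n → ℝ) (δ : ℝ) (k : ℕ) : ℝ :=
  roundTo (scales U z δ k / (floors U δ n * δ)) 0

/-- Division by F_n δ lifts every scale factor to at least 1/δ, so the absolute error 1/2 of
rounding to an integer is a relative error of at most δ/2. -/
theorem one_le_scaled (hδ : 0 < δ) (hδ1 : δ ≤ 1) {k : ℕ} (hk : k < n) :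
    1 ≤ δ * (scales U z δ k / (floors U δ n * δ)) := by
  have hF := floors_pos U hδ n
  have h1 : floors U δ n ≤ scales U z δ k :=
    (floors_antitone U hδ hδ1 hk.le).trans (floors_le_scales U z δ k)
  have : δ * (scales U z δ k / (floors U δ n * δ)) = scales U z δ k / floors U δ n := by
    field_simp
  rwa [this, one_le_div hF]

theorem abs_rounded_sub_le (hδ : 0 < δ) (hδ1 : δ ≤ 1) {k : ℕ} (hk : k < n) :
    |rounded U z δ k - scales U z δ k / (floors U δ n * δ)| ≤
      δ / 2 * (scales U z δ k / (floors U δ n * δ)) := by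
  refine (abs_roundTo_zero_sub_le _).trans ?_
  linarith [one_le_scaled (U := U) (z := z) hδ hδ1 hk]

theorem rounded_pos (hδ : 0 < δ) (hδ1 : δ ≤ 1) {k : ℕ} (hk : k < n) :
    0 < rounded U z δ k := by
  have h1 := (abs_le.mp (abs_rounded_sub_le (U := U) (z := z) hδ hδ1 hk)).1
  have h2 : 0 < scales U z δ k / (floors U δ n * δ) :=
    div_pos (scales_pos U z hδ k) (mul_pos (floors_pos U hδ n) hδ)
  nlinarith

theorem sum_abs_lev_rounded_le (hU : IsFrame U) (hd : 0 < d) (hn : 0 < n) (hδ : 0 < δ)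
    (hδ1 : δ ≤ 1) (hz : ∀ j, 0 < z j) (hanti : Antitone z) :
    ∑ j : Fin n, |lev U z j - lev U (fun j => rounded U z δ j) j| ≤ 5 * (n * d * δ) := by
  have hH : 0 < (floors U δ n * δ)⁻¹ := inv_pos.mpr (mul_pos (floors_pos U hδ n) hδ)
  set y : Fin n → ℝ := fun j => (floors U δ n * δ)⁻¹ * scales U z δ j with hy
  have hs : ∀ j : Fin n, 0 < scales U z δ j := fun j => scales_pos U z hδ j
  have hy0 : ∀ j, 0 < y j := fun j => mul_pos hH (hs j)
  have hyq : ∀ j : Fin n, scales U z δ j / (floors U δ n * δ) = y j := fun j => by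
    rw [hy, div_eq_inv_mul]
  have h1 := sum_abs_lev_scales_le hU hd hn hδ hδ1 hz hanti
  have h2 := sum_abs_lev_sub_le_of_close hU hy0
    (w' := fun j => rounded U z δ j) (fun j => rounded_pos hδ hδ1 j.2) hδ.le hδ1 ?_ ?_
  · calc ∑ j : Fin n, |lev U z j - lev U (fun j => rounded U z δ j) j|
        ≤ ∑ j : Fin n, (|lev U z j - lev U (fun j => scales U z δ j) j| +
          |lev U y j - lev U (fun j => rounded U z δ j) j|) := by
          refine Finset.sum_le_sum fun j _ => ?_
          rw [hy, lev_smul hU hs hH]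
          exact abs_sub_le _ _ _
      _ ≤ 2 * n * δ + 3 * d * δ := by
          rw [Finset.sum_add_distrib]
          exact add_le_add h1 h2
      _ ≤ 5 * (n * d * δ) := by
          have hd1 : (1 : ℝ) ≤ d := by exact_mod_cast hd
          have hn1 : (1 : ℝ) ≤ n := by exact_mod_cast hn
          have h3 : (n : ℝ) ≤ n * d := le_mul_of_one_le_right (by linarith) hd1
          have h4 : (d : ℝ) ≤ n * d := le_mul_of_one_le_left (by linarith) hn1
          nlinarith
  · intro j
    have := (abs_le.mp (abs_rounded_sub_le (U := U) (z := z) hδ hδ1 j.2)).2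
    rw [hyq] at this
    nlinarith [hy0 j]
  · intro j
    have := (abs_le.mp (abs_rounded_sub_le (U := U) (z := z) hδ hδ1 j.2)).1
    rw [hyq] at this
    -- The factor 1 + δ undoes 1 - δ/2, since (1 + δ)(1 - δ/2) ≥ 1 for 0 < δ ≤ 1.
    have h3 : (1 - δ / 2) * y j ≤ rounded U z δ j := by linarith
    have h4 : y j ≤ (1 + δ) * ((1 - δ / 2) * y j) := by
      have : (1 : ℝ) ≤ (1 + δ) * (1 - δ / 2) := by nlinarith
      nlinarith [hy0 j]
    exact h4.trans (by gcongr)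

/-! ### Permuting the columns -/

theorem lev_submatrix (U : Matrix (Fin d) (Fin n) ℝ) (z : Fin n → ℝ) (σ : Equiv.Perm (Fin n))
    (j : Fin n) : lev (U.submatrix id σ) (z ∘ σ) j = lev U z (σ j) := by
  have h : U.submatrix id σ * Matrix.diagonal (z ∘ σ) * (U.submatrix id σ).transpose =
      U * Matrix.diagonal z * U.transpose := by
    ext i l
    rw [Matrix.mul_apply, Matrix.mul_apply]
    simp only [Matrix.mul_diagonal, Matrix.transpose_apply, Matrix.submatrix_apply, id,
      Function.comp]
    exact Equiv.sum_comp σ fun j => U i j * z j * U l j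
  rw [lev, lev, h]
  rfl

theorem IsFrame.submatrix (hU : IsFrame U) (σ : Equiv.Perm (Fin n)) :
    IsFrame (U.submatrix id σ) := by
  have h := Matrix.rank_submatrix U (Equiv.refl _) σ
  rw [IsFrame] at hU
  rw [hU] at h
  exact h

end

/-! ### Sizes of rational numbers -/

/-- The real number `x` is a fraction whose numerator and denominator are at most `2 ^ s`. -/
def IsFrac (x : ℝ) (s : ℕ) : Prop :=
  ∃ (a : ℤ) (c : ℕ), 0 < c ∧ x = a / c ∧ |a| ≤ 2 ^ s ∧ c ≤ 2 ^ s

namespace IsFrac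

variable {x y : ℝ} {s t : ℕ}

theorem mono (h : IsFrac x s) (hst : s ≤ t) : IsFrac x t := by
  obtain ⟨a, c, h1, h2, h3, h4⟩ := h
  exact ⟨a, c, h1, h2, h3.trans (pow_le_pow_right₀ (by norm_num) hst),
    h4.trans (Nat.pow_le_pow_right (by norm_num) hst)⟩

theorem of_hasBitComplexity {b : ℕ} (h : HasBitComplexity x b) : IsFrac x b := by
  obtain ⟨q, rfl, hq⟩ := h
  have hq : ratBits q ≤ b := by exact_mod_cast hq
  rw [ratBits] at hq
  refine ⟨q.num, q.den, q.pos, Rat.cast_def q, ?_, ?_⟩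
  · have h1 : q.num.natAbs < 2 ^ b := Nat.size_le.mp (by omega)
    rw [Int.abs_eq_natAbs]
    exact_mod_cast h1.le
  · exact (Nat.size_le.mp (by omega)).le

/-- Reduction to lowest terms does not increase numerator or denominator. A number of size at most 2
^ s has at most s + 1 binary digits, and the sign adds 1. -/
theorem hasBitComplexity (h : IsFrac x s) {b : ℝ} (hb : ((2 * s + 3 : ℕ) : ℝ) ≤ b) :
    HasBitComplexity x b := by
  obtain ⟨a, c, h1, rfl, h3, h4⟩ := h
  refine ⟨Rat.divInt a c, ?_, le_trans ?_ hb⟩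
  · rw [Rat.divInt_eq_div]
    push_cast
    rfl
  · have hc : (c : ℤ) ≠ 0 := by exact_mod_cast h1.ne'
    have hden : (Rat.divInt a c).den ≤ c := by
      exact_mod_cast Int.le_of_dvd (by exact_mod_cast h1) (Rat.den_dvd a c)
    have hnum : (Rat.divInt a c).num.natAbs ≤ 2 ^ s := by
      have h5 : a.natAbs ≤ 2 ^ s := by
        rw [Int.abs_eq_natAbs] at h3
        exact_mod_cast h3
      rcases eq_or_ne a 0 with rfl | ha
      · simp
      · exact (Nat.le_of_dvd (Int.natAbs_pos.mpr ha)
          (Int.natAbs_dvd_natAbs.mpr (Rat.num_dvd a hc))).trans h5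
    have hpow : 2 ^ s < 2 ^ (s + 1) := Nat.pow_lt_pow_right (by norm_num) (by omega)
    have h6 : Nat.size (Rat.divInt a c).num.natAbs ≤ s + 1 := Nat.size_le.mpr (by omega)
    have h7 : Nat.size (Rat.divInt a c).den ≤ s + 1 := Nat.size_le.mpr (by omega)
    rw [ratBits]
    exact_mod_cast (by omega)

theorem natCast (k : ℕ) : IsFrac k k := by
  refine ⟨k, 1, one_pos, by simp, ?_, Nat.one_le_two_pow⟩
  rw [Nat.abs_cast]
  exact_mod_cast Nat.lt_two_pow_self.le

theorem zero : IsFrac 0 0 := by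
  simpa using natCast 0

theorem one : IsFrac 1 0 :=
  ⟨1, 1, one_pos, by simp, by simp, by simp⟩

theorem mul (hx : IsFrac x s) (hy : IsFrac y t) : IsFrac (x * y) (s + t) := by
  obtain ⟨a, c, h1, rfl, h3, h4⟩ := hx
  obtain ⟨b, e, g1, rfl, g3, g4⟩ := hy
  refine ⟨a * b, c * e, Nat.mul_pos h1 g1, by push_cast; rw [div_mul_div_comm], ?_, ?_⟩
  · rw [abs_mul, pow_add]
    gcongr
  · rw [pow_add]
    gcongr

theorem inv (hx : IsFrac x s) : IsFrac x⁻¹ s := by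
  obtain ⟨a, c, h1, rfl, h3, h4⟩ := hx
  rcases lt_trichotomy a 0 with ha | rfl | ha
  · refine ⟨-c, a.natAbs, Int.natAbs_pos.mpr ha.ne, ?_, ?_, ?_⟩
    · rw [Nat.cast_natAbs, abs_of_neg ha, inv_div]
      push_cast
      rw [neg_div_neg_eq]
    · rw [abs_neg, Nat.abs_cast]
      exact_mod_cast h4
    · rw [Int.abs_eq_natAbs] at h3
      exact_mod_cast h3
  -- The inverse of 0 is 0 by convention, so division needs no hypothesis.
  · simpa using zero.mono (Nat.zero_le s)
  · refine ⟨c, a.natAbs, Int.natAbs_pos.mpr ha.ne', ?_, ?_, ?_⟩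
    · rw [Nat.cast_natAbs, abs_of_pos ha, inv_div]
      push_cast
      rfl
    · rw [Nat.abs_cast]
      exact_mod_cast h4
    · rw [Int.abs_eq_natAbs] at h3
      exact_mod_cast h3

theorem div (hx : IsFrac x s) (hy : IsFrac y t) : IsFrac (x / y) (s + t) := by
  rw [div_eq_mul_inv]
  exact hx.mul hy.inv

theorem add (hx : IsFrac x s) (hy : IsFrac y t) : IsFrac (x + y) (s + t + 1) := by
  obtain ⟨a, c, h1, rfl, h3, h4⟩ := hx
  obtain ⟨b, e, g1, rfl, g3, g4⟩ := hy
  refine ⟨a * e + c * b, c * e, Nat.mul_pos h1 g1, ?_, ?_, ?_⟩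
  · push_cast
    rw [div_add_div _ _ (by exact_mod_cast h1.ne') (by exact_mod_cast g1.ne')]
  · have h5 : |a * e| ≤ 2 ^ s * 2 ^ t := by
      rw [abs_mul, Nat.abs_cast]
      have : (e : ℤ) ≤ 2 ^ t := by exact_mod_cast g4
      gcongr
    have h6 : |(c : ℤ) * b| ≤ 2 ^ s * 2 ^ t := by
      rw [abs_mul, Nat.abs_cast]
      have : (c : ℤ) ≤ 2 ^ s := by exact_mod_cast h4
      gcongr
    calc |a * e + c * b| ≤ |a * e| + |(c : ℤ) * b| := abs_add_le _ _
      _ ≤ 2 ^ s * 2 ^ t + 2 ^ s * 2 ^ t := add_le_add h5 h6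
      _ = 2 ^ (s + t + 1) := by ring
  · calc c * e ≤ 2 ^ s * 2 ^ t := Nat.mul_le_mul h4 g4
      _ = 2 ^ (s + t) := (pow_add _ _ _).symm
      _ ≤ 2 ^ (s + t + 1) := Nat.pow_le_pow_right (by norm_num) (by omega)

theorem neg (hx : IsFrac x s) : IsFrac (-x) s := by
  obtain ⟨a, c, h1, rfl, h3, h4⟩ := hx
  exact ⟨-a, c, h1, by push_cast; rw [neg_div], by rwa [abs_neg], h4⟩

theorem sub (hx : IsFrac x s) (hy : IsFrac y t) : IsFrac (x - y) (s + t + 1) := by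
  rw [sub_eq_add_neg]
  exact hx.add hy.neg

theorem sum {ι : Type*} (S : Finset ι) {f : ι → ℝ} (h : ∀ i ∈ S, IsFrac (f i) s) :
    IsFrac (∑ i ∈ S, f i) (S.card * (s + 1)) := by
  classical
  induction S using Finset.induction_on with
  | empty => simpa using zero
  | insert i S hi ih =>
    rw [Finset.sum_insert hi, Finset.card_insert_of_notMem hi]
    refine ((h i (Finset.mem_insert_self _ _)).add
      (ih fun j hj => h j (Finset.mem_insert_of_mem hj))).mono (le_of_eq (by ring))

theorem abs_le (hx : IsFrac x s) : |x| ≤ 2 ^ s := by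
  obtain ⟨a, c, h1, rfl, h3, -⟩ := hx
  have hc : (1 : ℝ) ≤ c := by exact_mod_cast h1
  rw [abs_div, Nat.abs_cast, div_le_iff₀ (by linarith)]
  have h5 : |(a : ℝ)| ≤ 2 ^ s := by exact_mod_cast h3
  calc |(a : ℝ)| ≤ 2 ^ s * 1 := by rwa [mul_one]
    _ ≤ _ := by gcongr

theorem roundTo (hx : IsFrac x s) : IsFrac (roundTo x 0) (s + 1) := by
  refine ⟨round x, 1, one_pos, ?_, ?_, Nat.one_le_two_pow⟩
  · simp [FrameScaling.roundTo]
  · have h1 := abs_sub_round x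
    have h2 := hx.abs_le
    have h3 : |(round x : ℝ)| ≤ |x| + 1 / 2 := by
      have := abs_sub_abs_le_abs_sub (round x : ℝ) x
      rw [abs_sub_comm] at this
      linarith
    have h4 : (1 : ℝ) ≤ 2 ^ s := one_le_pow₀ (by norm_num)
    have h5 : |(round x : ℝ)| ≤ 2 ^ (s + 1) := by
      rw [pow_succ]
      linarith
    exact_mod_cast h5

end IsFrac

/-- The determinant of a matrix of fractions is a fraction with a denominator at most
`2 ^ (r * (r * s))`. -/
theorem exists_det_eq_div {r s : ℕ} {M : Matrix (Fin r) (Fin r) ℝ}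
    (hM : ∀ i j, IsFrac (M i j) s) :
    ∃ (N : ℤ) (D : ℕ), 0 < D ∧ M.det = N / D ∧ D ≤ 2 ^ (r * (r * s)) ∧
      |N| ≤ 2 ^ (r * r + (s + r * s) * r) := by
  choose a c hc hac ha hc2 using hM
  -- Each row is multiplied by the product of its denominators. The determinant then becomes an
  -- integer, and its denominator is at most the product of r row factors.
  set D : Fin r → ℕ := fun i => ∏ j, c i j with hD
  have hDpos : ∀ i, 0 < D i := fun i => Finset.prod_pos fun j _ => hc i j
  have hDle : ∀ i, D i ≤ 2 ^ (r * s) := fun i => by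
    calc D i ≤ ∏ _j : Fin r, 2 ^ s := Finset.prod_le_prod' fun j _ => hc2 i j
      _ = 2 ^ (r * s) := by
        rw [Finset.prod_const, Finset.card_univ, Fintype.card_fin, ← pow_mul, mul_comm]
  set N : Matrix (Fin r) (Fin r) ℤ := Matrix.of fun i j => a i j * (D i / c i j : ℕ) with hN
  have hdiv : ∀ i j, c i j ∣ D i := fun i j => Finset.dvd_prod_of_mem _ (Finset.mem_univ j)
  have hNM : N.map (Int.cast : ℤ → ℝ) = Matrix.of fun i j => (D i : ℝ) * M i j := by
    ext i j
    have h1 : (c i j : ℝ) ≠ 0 := by exact_mod_cast (hc i j).ne'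
    simp only [hN, Matrix.map_apply, Matrix.of_apply, hac]
    rw [Int.cast_mul, Int.cast_natCast, Nat.cast_div (hdiv i j) h1]
    field_simp
  have hdet : (N.det : ℝ) = (∏ i, (D i : ℝ)) * M.det := by
    rw [← Matrix.det_mul_column, ← hNM]
    exact (Int.castRingHom ℝ).map_det N
  have hprod : 0 < ∏ i, D i := Finset.prod_pos fun i _ => hDpos i
  refine ⟨N.det, ∏ i, D i, hprod, ?_, ?_, ?_⟩
  · rw [hdet]
    push_cast
    have : (∏ i, (D i : ℝ)) ≠ 0 := by exact_mod_cast hprod.ne'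
    field_simp
  · calc ∏ i, D i ≤ ∏ _i : Fin r, 2 ^ (r * s) := Finset.prod_le_prod' fun i _ => hDle i
      _ = 2 ^ (r * (r * s)) := by
        rw [Finset.prod_const, Finset.card_univ, Fintype.card_fin, ← pow_mul, mul_comm]
  · have hentry : ∀ i j, AbsoluteValue.abs (N i j) ≤ 2 ^ (s + r * s) := by
      intro i j
      change |a i j * (D i / c i j : ℕ)| ≤ _
      rw [abs_mul, Nat.abs_cast, pow_add]
      have h1 : ((D i / c i j : ℕ) : ℤ) ≤ 2 ^ (r * s) := by
        exact_mod_cast (Nat.div_le_self _ _).trans (hDle i)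
      have := ha i j
      gcongr
    have h2 := Matrix.det_le hentry
    rw [Fintype.card_fin, nsmul_eq_mul, ← pow_mul] at h2
    refine le_trans h2 ?_
    rw [pow_add]
    have h3 : r.factorial ≤ 2 ^ (r * r) := by
      calc r.factorial ≤ r ^ r := Nat.factorial_le_pow r
        _ ≤ (2 ^ r) ^ r := Nat.pow_le_pow_left Nat.lt_two_pow_self.le r
        _ = _ := (pow_mul _ _ _).symm
    have h4 : (r.factorial : ℤ) ≤ 2 ^ (r * r) := by exact_mod_cast h3
    gcongr

theorem IsFrac.det {r s : ℕ} {M : Matrix (Fin r) (Fin r) ℝ} (hM : ∀ i j, IsFrac (M i j) s) :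
    IsFrac M.det (r * r + (s + r * s) * r) := by
  obtain ⟨N, D, h1, h2, h3, h4⟩ := exists_det_eq_div hM
  refine ⟨N, D, h1, h2, h4, h3.trans (Nat.pow_le_pow_right (by norm_num) ?_)⟩
  nlinarith [Nat.zero_le (s * r), Nat.zero_le (r * r)]

/-! ### Sizes of Gram-Schmidt vectors -/

open scoped RealInnerProductSpace
open InnerProductSpace (gramSchmidt)

/-- The vector v is the orthogonal projection of u to the span of g, so its coefficients solve the
normal equations with the Gram matrix; Cramer's rule gives them as quotients of determinants. -/
theorem exists_cramer_coeff {E : Type*} [NormedAddCommGroup E] [InnerProductSpace ℝ E] {r : ℕ}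
    (g : Fin r → E) (hg : LinearIndependent ℝ g) {v u : E} (hv : v ∈ Submodule.span ℝ (Set.range g))
    (huv : ∀ l, ⟪g l, u - v⟫ = 0) :
    v = ∑ l, ((Matrix.gram ℝ g).cramer (fun l => ⟪g l, u⟫) l / (Matrix.gram ℝ g).det) • g l := by
  have hdet : (Matrix.gram ℝ g).det ≠ 0 := Matrix.det_gram_ne_zero_iff_linearIndependent.mpr hg
  obtain ⟨c, rfl⟩ := (Submodule.mem_span_range_iff_exists_fun ℝ).mp hv
  have h1 : (Matrix.gram ℝ g).mulVec c = fun l => ⟪g l, u⟫ := by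
    ext l
    have h2 := huv l
    rw [inner_sub_right, sub_eq_zero, inner_sum] at h2
    rw [h2, Matrix.mulVec, dotProduct]
    refine Finset.sum_congr rfl fun m _ => ?_
    rw [inner_smul_right, Matrix.gram_apply, mul_comm]
  refine Finset.sum_congr rfl fun l _ => ?_
  congr 1
  rw [← h1, Matrix.cramer_eq_adjugate_mulVec, Matrix.mulVec_mulVec, Matrix.adjugate_mul,
    Matrix.smul_mulVec, Matrix.one_mulVec, Pi.smul_apply, smul_eq_mul, mul_div_cancel_left₀ _ hdet]

theorem IsFrac.inner_colVec {d n s : ℕ} {U : Matrix (Fin d) (Fin n) ℝ}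
    (hU : ∀ i j, IsFrac (U i j) s) (j k : Fin n) :
    IsFrac ⟪colVec U j, colVec U k⟫ (d * (s + s + 1)) := by
  rw [FrameScaling.inner_colVec, dotProduct]
  have := IsFrac.sum Finset.univ (f := fun i : Fin d => U i j * U i k)
    fun i _ => (hU i j).mul (hU i k)
  rw [Finset.card_univ, Fintype.card_fin] at this
  exact this

/-- A bound for the bit lengths of determinants of matrices of size at most `d` whose entries are
inner products of vectors with entries of bit length `s`. -/
def detBits (d s : ℕ) : ℕ :=
  d * d + (d * (s + s + 1) + d * (d * (s + s + 1))) * d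

/-- A bound for the bit lengths of entries of Gram-Schmidt vectors. -/
def gsBits (d s : ℕ) : ℕ :=
  s + d * (detBits d s + detBits d s + s + 1) + 1

/-- A basis of the span is picked among the columns themselves. It has at most d elements, so the
Gram determinants have size at most d, whatever n is. -/
theorem exists_linearIndependent_columns {d n : ℕ} (U : Matrix (Fin d) (Fin n) ℝ)
    (S : Set (Fin n)) :
    ∃ r ≤ d, ∃ j : Fin r → Fin n, LinearIndependent ℝ (fun l => colVec U (j l)) ∧
      Submodule.span ℝ (Set.range fun l => colVec U (j l)) = Submodule.span ℝ (colVec U '' S) := by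
  obtain ⟨f, hf, hspan, hind⟩ := Submodule.exists_fun_fin_finrank_span_eq ℝ (colVec U '' S)
  have hrd := Submodule.finrank_le (Submodule.span ℝ (colVec U '' S))
  rw [finrank_euclideanSpace_fin] at hrd
  choose j hj hjf using hf
  obtain rfl : (fun l => colVec U (j l)) = f := funext hjf
  exact ⟨_, hrd, j, hind, hspan⟩

theorem isFrac_gram_det {d n s r : ℕ} {U : Matrix (Fin d) (Fin n) ℝ}
    (hU : ∀ i j, IsFrac (U i j) s) (hr : r ≤ d) (j : Fin r → Fin n) (k : Fin n) :
    IsFrac (Matrix.gram ℝ fun l => colVec U (j l)).det (detBits d s) ∧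
      ∀ l, IsFrac ((Matrix.gram ℝ fun l => colVec U (j l)).cramer
        (fun l => ⟪colVec U (j l), colVec U k⟫) l) (detBits d s) := by
  have hmono : r * r + (d * (s + s + 1) + r * (d * (s + s + 1))) * r ≤ detBits d s := by
    rw [detBits]
    gcongr
  refine ⟨(IsFrac.det fun l m => IsFrac.inner_colVec hU _ _).mono hmono, fun l => ?_⟩
  rw [Matrix.cramer_apply]
  refine (IsFrac.det fun p q => ?_).mono hmono
  rw [Matrix.updateCol_apply]
  split_ifs <;> exact IsFrac.inner_colVec hU _ _

/-- Following the Gram-Schmidt recursion would let the bounds compound. Instead each vector is u_k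
minus the projection of u_k to the span of its predecessors, computed at once by Cramer's rule. -/
theorem isFrac_gramSchmidtCols {d n s : ℕ} {U : Matrix (Fin d) (Fin n) ℝ}
    (hU : ∀ i j, IsFrac (U i j) s) (i : Fin d) (k : Fin n) :
    IsFrac (gramSchmidtCols U i k) (gsBits d s) := by
  obtain ⟨v, hv, huv, horth⟩ := exists_gramSchmidt_decomp (colVec U) k
  obtain ⟨r, hrd, j, hind, hspan⟩ := exists_linearIndependent_columns U (Set.Iio k)
  rw [← hspan] at hv horth
  have hcr := exists_cramer_coeff (fun l => colVec U (j l)) hind hv (u := colVec U k) fun l => by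
    rw [huv, add_sub_cancel_right, real_inner_comm]
    exact horth _ (Submodule.subset_span ⟨l, rfl⟩)
  obtain ⟨hdet, hcram⟩ := isFrac_gram_det hU hrd j k
  have hgs : gramSchmidtCols U i k = U i k - v i := by
    have : gramSchmidt ℝ (colVec U) k = colVec U k - v := by rw [huv, add_sub_cancel_right]
    exact congrArg (fun x : EuclideanSpace ℝ (Fin d) => x i) this
  have hvi : v i = ∑ l, (Matrix.gram ℝ fun l => colVec U (j l)).cramer
      (fun l => ⟪colVec U (j l), colVec U k⟫) l / (Matrix.gram ℝ fun l => colVec U (j l)).det *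
        U i (j l) := by
    have h1 := congrArg (fun x : EuclideanSpace ℝ (Fin d) => x i) hcr
    simp only [WithLp.ofLp_sum, Finset.sum_apply, PiLp.smul_apply, smul_eq_mul] at h1
    exact h1
  have hvb : IsFrac (v i) (d * (detBits d s + detBits d s + s + 1)) := by
    rw [hvi]
    refine (IsFrac.sum (s := detBits d s + detBits d s + s) _ fun l _ => ?_).mono ?_
    · exact ((hcram l).div hdet).mul (hU i _)
    · rw [Finset.card_univ, Fintype.card_fin]
      gcongr
  rw [hgs, gsBits]
  exact (hU i k).sub hvb

/-! ### A lower bound for the truncated scale factors -/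

section

variable {d n : ℕ} {U : Matrix (Fin d) (Fin n) ℝ} {δ : ℝ}

open scoped RealInnerProductSpace
open InnerProductSpace (gramSchmidt)

/-- The indices of the nonzero Gram-Schmidt vectors. -/
def gsIdx (U : Matrix (Fin d) (Fin n) ℝ) : Finset (Fin n) :=
  Finset.univ.filter fun k => gramSchmidt ℝ (colVec U) k ≠ 0

theorem mem_gsIdx {k : Fin n} : k ∈ gsIdx U ↔ gramSchmidt ℝ (colVec U) k ≠ 0 := by
  simp [gsIdx]

theorem floors_eq_prod (U : Matrix (Fin d) (Fin n) ℝ) (δ : ℝ) :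
    floors U δ n = ∏ k ∈ gsIdx U,
      (‖gramSchmidt ℝ (colVec U) k‖ ^ 2 * δ / normConst U) := by
  have h1 : ∀ k, floors U δ k =
      ∏ j ∈ Finset.range k, if gsSq U j ≤ 0 then 1 else gsSq U j * δ / normConst U := by
    intro k
    induction k with
    | zero => rfl
    | succ k ih =>
      rw [Finset.prod_range_succ, ← ih]
      split_ifs with h
      · rw [mul_one]
        exact if_pos h
      · exact if_neg h
  rw [h1, Finset.prod_range, gsIdx, Finset.prod_filter]
  refine Finset.prod_congr rfl fun k _ => ?_
  rw [gsSq_eq U k.2]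
  by_cases h : gramSchmidt ℝ (colVec U) k = 0
  · rw [if_neg (not_not.mpr h), if_pos (by simp [h])]
  · rw [if_pos h, if_neg (not_le.mpr (by positivity))]

theorem IsFrame.span_eq_top (hU : IsFrame U) :
    Submodule.span ℝ (Set.range (colVec U)) = ⊤ := by
  rw [← Submodule.orthogonal_eq_bot_iff, Submodule.eq_bot_iff]
  intro x hx
  exact hU.eq_zero_of_inner_eq_zero fun j =>
    (Submodule.mem_orthogonal _ x).mp hx _ (Submodule.subset_span ⟨j, rfl⟩)

/-- The nonzero Gram-Schmidt vectors are orthogonal and span the whole space. -/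
theorem IsFrame.card_gsIdx (hU : IsFrame U) : (gsIdx U).card = d := by
  have hind : LinearIndependent ℝ fun k : gsIdx U => gramSchmidt ℝ (colVec U) k :=
    linearIndependent_of_ne_zero_of_inner_eq_zero (fun k => mem_gsIdx.mp k.2)
      fun k l hkl => InnerProductSpace.gramSchmidt_orthogonal ℝ _
        fun h => hkl (Subtype.ext h)
  have h1 := finrank_span_eq_card hind
  have h2 : Submodule.span ℝ (Set.range fun k : gsIdx U => gramSchmidt ℝ (colVec U) k) = ⊤ := by
    rw [eq_top_iff, ← hU.span_eq_top, ← InnerProductSpace.span_gramSchmidt ℝ (colVec U),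
      Submodule.span_le]
    rintro _ ⟨k, rfl⟩
    by_cases h : gramSchmidt ℝ (colVec U) k = 0
    · rw [h]
      exact Submodule.zero_mem _
    · exact Submodule.subset_span ⟨⟨k, mem_gsIdx.mpr h⟩, rfl⟩
  rw [h2, finrank_top, finrank_euclideanSpace_fin, Fintype.card_coe] at h1
  exact h1.symm

theorem IsFrame.le (hU : IsFrame U) : d ≤ n := by
  have := Finset.card_le_univ (gsIdx U)
  rwa [hU.card_gsIdx, Fintype.card_fin] at this

theorem IsFrame.normConst_pos (hU : IsFrame U) (hd : 0 < d) : 0 < normConst U := by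
  obtain ⟨k, hk⟩ : (gsIdx U).Nonempty := by
    rw [← Finset.card_pos, hU.card_gsIdx]
    exact hd
  refine FrameScaling.normConst_pos U (k := k) ?_
  rw [gsSq_eq U k.2]
  have := mem_gsIdx.mp hk
  positivity

theorem eq_sum_gsIdx (U : Matrix (Fin d) (Fin n) ℝ) (k : Fin n) :
    colVec U k = ∑ l ∈ gsIdx U, (⟪gramSchmidt ℝ (colVec U) l, colVec U k⟫ /
      ‖gramSchmidt ℝ (colVec U) l‖ ^ 2) • gramSchmidt ℝ (colVec U) l := by
  set e := gramSchmidt ℝ (colVec U) with he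
  have h1 := InnerProductSpace.gramSchmidt_def'' ℝ (colVec U) k
  rw [← he] at h1
  have hself : e k = (⟪e k, colVec U k⟫ / ‖e k‖ ^ 2) • e k := by
    by_cases h : e k = 0
    · rw [h, smul_zero]
    · obtain ⟨v, hv, huv, horth⟩ := exists_gramSchmidt_decomp (colVec U) k
      rw [← he] at huv horth
      have h2 : ‖e k‖ ^ 2 ≠ 0 := by positivity
      rw [huv, inner_add_right, horth v hv, add_zero, real_inner_self_eq_norm_sq, div_self h2,
        one_smul]
  have hsub : ∑ l ∈ gsIdx U, (⟪e l, colVec U k⟫ / ‖e l‖ ^ 2) • e l =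
      ∑ l, (⟪e l, colVec U k⟫ / ‖e l‖ ^ 2) • e l := by
    refine Finset.sum_subset (Finset.subset_univ _) fun l _ hl => ?_
    rw [mem_gsIdx, not_not] at hl
    rw [he, hl, smul_zero]
  rw [hsub]
  have hIic : ∑ l ∈ Finset.Iic k, (⟪e l, colVec U k⟫ / ‖e l‖ ^ 2) • e l =
      ∑ l, (⟪e l, colVec U k⟫ / ‖e l‖ ^ 2) • e l := by
    refine Finset.sum_subset (Finset.subset_univ _) fun l _ hl => ?_
    rw [Finset.mem_Iic, not_le] at hl
    rw [he, InnerProductSpace.gramSchmidt_inv_triangular ℝ _ hl, zero_div, zero_smul]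
  rw [← hIic, ← Finset.Iio_insert, Finset.sum_insert (by simp), ← hself]
  exact h1

/-- The product of the squared norms of the nonzero Gram-Schmidt vectors is the square of a
maximal minor. -/
theorem IsFrame.exists_minor (hU : IsFrame U) :
    ∃ g : Fin d → Fin n, (U.submatrix id g).det ^ 2 =
      ∏ k ∈ gsIdx U, ‖gramSchmidt ℝ (colVec U) k‖ ^ 2 := by
  set e := gramSchmidt ℝ (colVec U) with he
  set g := (gsIdx U).orderEmbOfFin hU.card_gsIdx with hg
  have hprod : ∀ f : Fin n → ℝ, ∏ k ∈ gsIdx U, f k = ∏ j, f (g j) := fun f => by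
    rw [← Finset.prod_image (s := Finset.univ) (g := g) (fun _ _ _ _ h => g.injective h)]
    congr 1
    ext k
    rw [← Finset.mem_coe, ← Finset.range_orderEmbOfFin (gsIdx U) hU.card_gsIdx]
    simp [hg]
  have hsum : ∀ f : Fin n → EuclideanSpace ℝ (Fin d), ∑ k ∈ gsIdx U, f k = ∑ j, f (g j) :=
    fun f => by
    rw [← Finset.sum_image (s := Finset.univ) (g := g) (fun _ _ _ _ h => g.injective h)]
    congr 1
    ext k
    rw [← Finset.mem_coe, ← Finset.range_orderEmbOfFin (gsIdx U) hU.card_gsIdx]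
    simp [hg]
  refine ⟨g, ?_⟩
  rw [hprod]
  set E : Matrix (Fin d) (Fin d) ℝ := Matrix.of fun i j => e (g j) i with hE
  set T : Matrix (Fin d) (Fin d) ℝ :=
    Matrix.of fun l j => ⟪e (g l), colVec U (g j)⟫ / ‖e (g l)‖ ^ 2 with hT
  -- On the columns with nonzero Gram-Schmidt vector, U factors into these vectors (the columns of
  -- E) and a unitriangular T, so the squared minor is det(Eᵀ E), a determinant of a diagonal
  -- matrix.
  have hfac : U.submatrix id g = E * T := by
    ext i j
    have h1 := congrArg (fun x : EuclideanSpace ℝ (Fin d) => x i) (eq_sum_gsIdx U (g j))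
    rw [hsum] at h1
    simp only [WithLp.ofLp_sum, Finset.sum_apply, PiLp.smul_apply, smul_eq_mul] at h1
    rw [Matrix.mul_apply]
    refine Eq.trans h1 (Finset.sum_congr rfl fun l _ => ?_)
    rw [mul_comm]
    rfl
  have hTdet : T.det = 1 := by
    rw [Matrix.det_of_isUpperTriangular]
    · refine Finset.prod_eq_one fun j _ => ?_
      have hne : e (g j) ≠ 0 := mem_gsIdx.mp (Finset.orderEmbOfFin_mem _ _ _)
      obtain ⟨v, hv, huv, horth⟩ := exists_gramSchmidt_decomp (colVec U) (g j)
      rw [← he] at huv horth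
      have h2 : ‖e (g j)‖ ^ 2 ≠ 0 := by positivity
      rw [hT, Matrix.of_apply, huv, inner_add_right, horth v hv, add_zero,
        real_inner_self_eq_norm_sq, div_self h2]
    · intro l j hlj
      have hlj : j < l := hlj
      rw [hT, Matrix.of_apply, he,
        InnerProductSpace.gramSchmidt_inv_triangular ℝ _ (g.strictMono hlj), zero_div]
  have hEE : E.transpose * E = Matrix.diagonal fun j => ‖e (g j)‖ ^ 2 := by
    ext l j
    have h3 : (E.transpose * E) l j = ⟪e (g l), e (g j)⟫ := by
      rw [Matrix.mul_apply, PiLp.inner_apply]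
      refine Finset.sum_congr rfl fun i _ => ?_
      simp [hE, mul_comm]
    rw [h3, Matrix.diagonal_apply]
    split_ifs with h
    · rw [h, real_inner_self_eq_norm_sq]
    · exact InnerProductSpace.gramSchmidt_orthogonal ℝ _ fun h' => h (g.injective h')
  rw [hfac, Matrix.det_mul, hTdet, mul_one, sq]
  nth_rewrite 1 [← Matrix.det_transpose]
  rw [← Matrix.det_mul, hEE, Matrix.det_diagonal]

/-- Exactly d factors enter the floor, so it equals det² · (δ/W)^d for a nonzero maximal minor det
and W = `normConst U`. The minor is a nonzero integer over a denominator of at most 2^(d²b), and W ≤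
5 n³ 2^(2b) because d ≤ n. -/
theorem neg_log_floors_le (hU : IsFrame U) (hδ : 0 < δ) (hn : 0 < n) {b : ℕ}
    (hb : ∀ i j, IsFrac (U i j) b) :
    -Real.log (floors U δ n) ≤
      d * (Real.log 5 + 3 * Real.log n + 2 * b + Real.log (1 / δ)) + 2 * (d * (d * b)) := by
  obtain ⟨g, hg⟩ := hU.exists_minor
  have hpos : 0 < ∏ k ∈ gsIdx U, ‖gramSchmidt ℝ (colVec U) k‖ ^ 2 :=
    Finset.prod_pos fun k hk => by
      have := mem_gsIdx.mp hk
      positivity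
  have hdet : (U.submatrix id g).det ≠ 0 := fun h => by
    rw [← hg, h] at hpos
    simp at hpos
  have hlog2 : Real.log 2 ≤ 1 := by
    have := Real.log_le_sub_one_of_pos (show (0 : ℝ) < 2 by norm_num)
    linarith
  have hlog20 : 0 ≤ Real.log 2 := Real.log_nonneg (by norm_num)
  have hdetlog : -(d * (d * b) : ℝ) ≤ Real.log |(U.submatrix id g).det| := by
    obtain ⟨N, D, h1, h2, h3, -⟩ := exists_det_eq_div (M := U.submatrix id g)
      (fun i j => hb i (g j))
    have hN : N ≠ 0 := fun h => hdet (by rw [h2, h]; simp)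
    have hN1 : (1 : ℝ) ≤ |(N : ℝ)| := by exact_mod_cast Int.one_le_abs hN
    have hD : (D : ℝ) ≤ 2 ^ (d * (d * b)) := by exact_mod_cast h3
    have hD0 : (0 : ℝ) < D := by exact_mod_cast h1
    have h4 : ((2 : ℝ) ^ (d * (d * b)))⁻¹ ≤ |(U.submatrix id g).det| := by
      rw [h2, abs_div, Nat.abs_cast, inv_eq_one_div]
      gcongr
    have h5 := Real.log_le_log (by positivity) h4
    rw [Real.log_inv, Real.log_pow] at h5
    push_cast at h5
    have h6 : (d * (d * b) : ℝ) * Real.log 2 ≤ d * (d * b) * 1 := by gcongr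
    linarith
  have hnR : (1 : ℝ) ≤ n := by exact_mod_cast hn
  have hlogn : 0 ≤ Real.log n := Real.log_nonneg hnR
  have hlog5 : 0 ≤ Real.log 5 := Real.log_nonneg (by norm_num)
  have hdW : d * Real.log (normConst U) ≤ d * (Real.log 5 + 3 * Real.log n + 2 * b) := by
    rcases Nat.eq_zero_or_pos d with rfl | hd
    · simp
    refine mul_le_mul_of_nonneg_left ?_ (Nat.cast_nonneg d)
    have hW : normConst U ≤ 5 * (n : ℝ) ^ 3 * (2 ^ b) ^ 2 := by
      rw [normConst_eq]
      have h1 : ∀ j, ‖colVec U j‖ ^ 2 ≤ n * (2 ^ b) ^ 2 := fun j => by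
        rw [EuclideanSpace.real_norm_sq_eq]
        calc ∑ i, (colVec U j i) ^ 2 ≤ ∑ _i : Fin d, (2 ^ b : ℝ) ^ 2 :=
              Finset.sum_le_sum fun i _ => by
                rw [sq_le_sq, abs_of_nonneg (by positivity : (0 : ℝ) ≤ 2 ^ b)]
                exact (hb i j).abs_le
          _ = d * (2 ^ b) ^ 2 := by simp
          _ ≤ n * (2 ^ b) ^ 2 := by
              have : (d : ℝ) ≤ n := by exact_mod_cast hU.le
              gcongr
      have h2 : ∑ j, ‖colVec U j‖ ^ 2 ≤ n * (n * (2 ^ b) ^ 2) := by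
        calc ∑ j, ‖colVec U j‖ ^ 2 ≤ ∑ _j : Fin n, n * (2 ^ b : ℝ) ^ 2 :=
              Finset.sum_le_sum fun j _ => h1 j
          _ = _ := by simp
      calc (n : ℝ) * (∑ j, ‖colVec U j‖ ^ 2) * 5 ≤ n * (n * (n * (2 ^ b) ^ 2)) * 5 := by gcongr
        _ = _ := by ring
    have hWpos := hU.normConst_pos hd
    have h3 := Real.log_le_log hWpos hW
    rw [Real.log_mul (by positivity) (by positivity), Real.log_mul (by norm_num) (by positivity),
      Real.log_pow, Real.log_pow, Real.log_pow] at h3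
    push_cast at h3
    have h4 : (b : ℝ) * Real.log 2 ≤ b * 1 := by gcongr
    linarith
  have hfloor : Real.log (floors U δ n) =
      2 * Real.log |(U.submatrix id g).det| + d * (Real.log δ - Real.log (normConst U)) := by
    rcases Nat.eq_zero_or_pos d with rfl | hd
    · have h0 : gsIdx U = ∅ := by
        rw [← Finset.card_eq_zero, hU.card_gsIdx]
      rw [floors_eq_prod, h0]
      simp
    have hWpos := hU.normConst_pos hd
    have h1 : floors U δ n =
        |(U.submatrix id g).det| ^ 2 * (δ / normConst U) ^ d := by
      rw [floors_eq_prod, sq_abs, hg]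
      simp only [mul_div_assoc]
      rw [Finset.prod_mul_distrib, Finset.prod_const, hU.card_gsIdx]
    rw [h1, Real.log_mul (by positivity) (by positivity), Real.log_pow, Real.log_pow,
      Real.log_div hδ.ne' hWpos.ne']
    push_cast
    ring
  rw [hfloor, one_div, Real.log_inv]
  linarith

end

/-! ### Sizes of the computed numbers -/

section

variable {d n : ℕ} {U : Matrix (Fin d) (Fin n) ℝ} {z : Fin n → ℝ} {δ : ℝ}

theorem rounded_hasBitComplexity (hU : IsFrame U) (hδ : 0 < δ) (hδ2 : δ < 1 / 2)
    (hz : ∀ j, 0 < z j) (hanti : Antitone z) {b : ℕ} (hb : ∀ i j, IsFrac (U i j) b) {k : ℕ}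
    (hk : k < n) :
    HasBitComplexity (rounded U z δ k)
      (200 * ((n : ℝ) * ((d : ℝ) * (b : ℝ) + Real.log (n : ℝ) + Real.log (1 / δ)))) := by
  have hδ1 : δ ≤ 1 := by linarith
  have hF := floors_pos U hδ n
  have hpos := rounded_pos (U := U) (z := z) hδ hδ1 hk
  have hle : rounded U z δ k ≤ 2 * ((floors U δ n)⁻¹ * δ⁻¹) := by
    have h1 := (abs_le.mp (abs_rounded_sub_le (U := U) (z := z) hδ hδ1 hk)).2
    have h2 : scales U z δ k / (floors U δ n * δ) ≤ (floors U δ n)⁻¹ * δ⁻¹ := by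
      rw [← mul_inv, ← one_div]
      have := scales_le_one (U := U) hδ hδ1 hz hanti hk
      gcongr
    have h3 : 0 < scales U z δ k / (floors U δ n * δ) :=
      div_pos (scales_pos U z hδ k) (mul_pos hF hδ)
    nlinarith
  obtain ⟨m, hm⟩ : ∃ m : ℤ, rounded U z δ k = m :=
    ⟨_, by rw [rounded, roundTo, pow_zero, mul_one, div_one]⟩
  rw [hm] at hpos hle ⊢
  have hm0 : 0 < m := by exact_mod_cast hpos
  have hlog2 := Real.log_two_gt_d9
  have hlog2' : Real.log 2 ≤ 1 := by
    have := Real.log_le_sub_one_of_pos (show (0 : ℝ) < 2 by norm_num)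
    linarith
  have hlog5 : Real.log 5 ≤ 4 := by
    have := Real.log_le_sub_one_of_pos (show (0 : ℝ) < 5 by norm_num)
    linarith
  -- For an integer, the sign and the denominator 1 cost two bits; the factor 2 bounds 1 / log 2.
  have hbits : (ratBits (m : ℚ) : ℝ) ≤ 3 + 2 * Real.log m := by
    have hsz : 0 < Nat.size m.natAbs := Nat.size_pos.mpr (Int.natAbs_pos.mpr hm0.ne')
    have h1 : 2 ^ (Nat.size m.natAbs - 1) ≤ m.natAbs := Nat.lt_size.mp (by omega)
    have h2 : (2 : ℝ) ^ (Nat.size m.natAbs - 1) ≤ m := by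
      have h3 : ((m.natAbs : ℕ) : ℝ) = m := by
        rw [Nat.cast_natAbs, abs_of_pos hm0]
      rw [← h3]
      exact_mod_cast h1
    have h3 := Real.log_le_log (by positivity) h2
    rw [Real.log_pow] at h3
    have h4 : ((Nat.size m.natAbs : ℕ) : ℝ) = ((Nat.size m.natAbs - 1 : ℕ) : ℝ) + 1 := by
      exact_mod_cast (Nat.sub_add_cancel hsz).symm
    have h5 : (0 : ℝ) ≤ ((Nat.size m.natAbs - 1 : ℕ) : ℝ) := Nat.cast_nonneg _
    rw [ratBits]
    simp only [Rat.num_intCast, Rat.den_intCast, Nat.size_one]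
    push_cast
    rw [h4]
    nlinarith
  refine ⟨m, by simp, hbits.trans ?_⟩
  have hlogm := Real.log_le_log hpos hle
  rw [Real.log_mul (by norm_num) (by positivity), Real.log_mul (by positivity) (by positivity),
    Real.log_inv, ← one_div] at hlogm
  have hfl := neg_log_floors_le hU hδ (by omega) hb
  set ℓ := Real.log (1 / δ) with hℓ
  -- This is where δ < 1/2 matters: additive constants are absorbed by log(1/δ).
  have hℓ2 : 1 / 2 ≤ ℓ := by
    have h1 : (2 : ℝ) ≤ 1 / δ := by
      rw [le_div_iff₀ hδ]
      linarith
    have h2 := Real.log_le_log (by norm_num) h1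
    linarith
  have hn1 : (1 : ℝ) ≤ n := by exact_mod_cast (by omega : 1 ≤ n)
  have hlogn : 0 ≤ Real.log n := Real.log_nonneg hn1
  have hdn : (d : ℝ) ≤ n := by exact_mod_cast hU.le
  have hd0 : (0 : ℝ) ≤ d := Nat.cast_nonneg d
  have hb0 : (0 : ℝ) ≤ b := Nat.cast_nonneg b
  have e1 : (d : ℝ) * (Real.log 5 + 3 * Real.log n + 2 * b + ℓ) ≤
      n * (9 * ℓ + 3 * Real.log n) + 2 * (d * b) := by
    have h1 : (d : ℝ) * (Real.log 5 + 3 * Real.log n + ℓ) ≤ n * (9 * ℓ + 3 * Real.log n) := by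
      apply mul_le_mul hdn (by linarith) _ (by linarith)
      have := Real.log_nonneg (show (1 : ℝ) ≤ 5 by norm_num)
      linarith
    linarith
  have e2 : (d : ℝ) * b ≤ n * (d * b) := le_mul_of_one_le_left (by positivity) hn1
  have e3 : (d : ℝ) * (d * b) ≤ n * (d * b) := by gcongr
  have e4 : ℓ ≤ n * ℓ := le_mul_of_one_le_left (by linarith) hn1
  have e5 : 0 ≤ (n : ℝ) * Real.log n := by positivity
  have e6 : (0 : ℝ) ≤ n * (d * b) := by positivity
  linarith

theorem gsBits_le {d B X : ℕ} (h : d + B + 1 ≤ X) : gsBits d B ≤ 14 * X ^ 5 := by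
  have hX1 : 1 ≤ X := by omega
  have hd : d ≤ X := by omega
  have hB : B ≤ X := by omega
  have hB2 : B + B + 1 ≤ 2 * X := by omega
  have p1 : X ≤ X ^ 2 := Nat.le_self_pow (by norm_num) X
  have p2 : X ^ 2 ≤ X ^ 3 := Nat.pow_le_pow_right hX1 (by norm_num)
  have p3 : X ^ 3 ≤ X ^ 4 := Nat.pow_le_pow_right hX1 (by norm_num)
  have p4 : X ^ 4 ≤ X ^ 5 := Nat.pow_le_pow_right hX1 (by norm_num)
  have hdet : detBits d B ≤ 5 * X ^ 4 := by
    calc detBits d B ≤ X * X + (X * (2 * X) + X * (X * (2 * X))) * X := by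
          rw [detBits]
          gcongr
      _ = X ^ 2 + 2 * X ^ 3 + 2 * X ^ 4 := by ring
      _ ≤ _ := by omega
  calc gsBits d B ≤ X + X * (5 * X ^ 4 + 5 * X ^ 4 + X + 1) + 1 := by
        rw [gsBits]
        gcongr
    _ = 10 * X ^ 5 + X ^ 2 + 2 * X + 1 := by ring
    _ ≤ _ := by omega

theorem isFrac_colSq {g : ℕ → ℕ → ℝ} {s k d : ℕ} (hg : ∀ i < d, IsFrac (g i k) s) {i : ℕ}
    (hi : i ≤ d) : IsFrac (colSq i g k) (i * (s + s + 1)) := by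
  have := IsFrac.sum (Finset.range i) (f := fun i => g i k * g i k) fun l hl =>
    (hg l (by have := Finset.mem_range.mp hl; omega)).mul
      (hg l (by have := Finset.mem_range.mp hl; omega))
  rwa [Finset.card_range] at this

theorem isFrac_extendMat {A : Matrix (Fin d) (Fin n) ℝ} {s : ℕ} (hA : ∀ i j, IsFrac (A i j) s)
    (i k : ℕ) : IsFrac (extendMat A i k) s := by
  rw [extendMat]
  split_ifs
  · exact hA _ _
  · exact IsFrac.zero.mono (Nat.zero_le _)

theorem isFrac_extendVec {s : ℕ} (hz : ∀ j, IsFrac (z j) s) (k : ℕ) :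
    IsFrac (extendVec z k) s := by
  rw [extendVec]
  split_ifs
  · exact hz _
  · exact IsFrac.one.mono (Nat.zero_le _)

theorem isFrac_floorSeq {W : ℝ} {e : ℕ → ℝ} {s : ℕ} (h : ∀ k, IsFrac (e k * δ / W) s) (k : ℕ) :
    IsFrac (floorSeq δ W e k) (k * s) := by
  induction k with
  | zero => exact IsFrac.one.mono (Nat.zero_le _)
  | succ k ih =>
    rw [floorSeq]
    split_ifs
    · exact ih.mono (by gcongr; omega)
    · exact (ih.mul (h k)).mono (le_of_eq (by ring))

/-- A truncation restarts the sequence at a floor, of size at most s; since the last restart only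
ratios of consecutive keys are multiplied on. Thus floor sizes do not accumulate. -/
theorem isFrac_scaleSeq {F z : ℕ → ℝ} {s t m : ℕ} (hF : ∀ k ≤ m, IsFrac (F k) s)
    (hz : ∀ k, IsFrac (z k) t) {k : ℕ} (hk : k ≤ m) :
    IsFrac (scaleSeq F z k) (s + k * (t + t)) := by
  induction k with
  | zero => exact IsFrac.one.mono (Nat.zero_le _)
  | succ k ih =>
    rw [scaleSeq]
    split_ifs
    · exact (hF _ hk).mono (by omega)
    · exact (((ih (by omega)).mul (hz _)).div (hz _)).mono (le_of_eq (by ring))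

/-- All computed numbers are fractions of polynomial size. -/
theorem allValues_isFrac {B X : ℕ} (hX : X = n + d + B + 1) (hU : ∀ i j, IsFrac (U i j) B)
    (hz : ∀ j, IsFrac (z j) B) (hδ : IsFrac δ B) :
    AllValues (fun x => IsFrac x (85 * X ^ 7)) U z δ := by
  have hX1 : 1 ≤ X := by omega
  have hn : n ≤ X := by omega
  have hd : d ≤ X := by omega
  have hB : B ≤ X := by omega
  have hB2 : B + B + 1 ≤ 2 * X := by omega
  have p1 : X ≤ X ^ 2 := Nat.le_self_pow (by norm_num) X
  have p2 : X ^ 2 ≤ X ^ 3 := Nat.pow_le_pow_right hX1 (by norm_num)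
  have p3 : X ^ 3 ≤ X ^ 4 := Nat.pow_le_pow_right hX1 (by norm_num)
  have p4 : X ^ 4 ≤ X ^ 5 := Nat.pow_le_pow_right hX1 (by norm_num)
  have p5 : X ^ 5 ≤ X ^ 6 := Nat.pow_le_pow_right hX1 (by norm_num)
  have p6 : X ^ 6 ≤ X ^ 7 := Nat.pow_le_pow_right hX1 (by norm_num)
  have hgs : ∀ i j, IsFrac (gramSchmidtCols U i j) (14 * X ^ 5) := fun i j =>
    (isFrac_gramSchmidtCols hU i j).mono (gsBits_le (by omega))
  have hGS := isFrac_extendMat hgs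
  have hE := isFrac_extendMat hU
  have hgsSum : ∀ k, ∀ i ≤ d, IsFrac (colSq i (extendMat (gramSchmidtCols U)) k) (29 * X ^ 6) := by
    intro k i hi
    refine (isFrac_colSq (fun i _ => hGS i k) hi).mono ?_
    calc i * (14 * X ^ 5 + 14 * X ^ 5 + 1) ≤ X * (14 * X ^ 5 + 14 * X ^ 5 + 1) := by
          gcongr
          omega
      _ = 28 * X ^ 6 + X := by ring
      _ ≤ _ := by omega
  have hgsMul : ∀ k, IsFrac (gsSq U k * δ) (30 * X ^ 6) := fun k =>
    ((hgsSum k d le_rfl).mul hδ).mono (by omega)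
  have hcol : ∀ k, ∀ i ≤ d, IsFrac (colSq i (extendMat U) k) (2 * X ^ 2) := by
    intro k i hi
    refine (isFrac_colSq (fun i _ => hE i k) hi).mono ?_
    calc i * (B + B + 1) ≤ X * (2 * X) := by
          gcongr
          omega
      _ = _ := by ring
  have htot : ∀ k ≤ n, IsFrac (totalSq d k (extendMat U)) (3 * X ^ 3) := by
    intro k hk
    have := IsFrac.sum (Finset.range k) fun l _ => hcol l d le_rfl
    rw [Finset.card_range] at this
    refine this.mono ?_
    calc k * (2 * X ^ 2 + 1) ≤ X * (2 * X ^ 2 + 1) := by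
          gcongr
          omega
      _ = 2 * X ^ 3 + X := by ring
      _ ≤ _ := by omega
  have hmul : ∀ k ≤ n, IsFrac (k * totalSq d n (extendMat U)) (4 * X ^ 3) := fun k hk =>
    (((IsFrac.natCast k).mul (htot n le_rfl))).mono (by omega)
  have hW : IsFrac (normConst U) (9 * X ^ 3) := by
    refine ((hmul n le_rfl).mul (IsFrac.natCast 5)).mono (by omega)
  have hdiv : ∀ k, IsFrac (gsSq U k * δ / normConst U) (39 * X ^ 6) := fun k =>
    ((hgsMul k).div hW).mono (by omega)
  have hF : ∀ k ≤ n, IsFrac (floors U δ k) (39 * X ^ 7) := by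
    intro k hk
    refine (isFrac_floorSeq hdiv k).mono ?_
    calc k * (39 * X ^ 6) ≤ X * (39 * X ^ 6) := by
          gcongr
          omega
      _ = _ := by ring
  have hzv := isFrac_extendVec hz
  have hy : ∀ k ≤ n, IsFrac (scales U z δ k) (41 * X ^ 7) := by
    intro k hk
    refine (isFrac_scaleSeq hF hzv hk).mono ?_
    calc 39 * X ^ 7 + k * (B + B) ≤ 39 * X ^ 7 + X * (2 * X) := by
          gcongr
          · omega
          · omega
      _ = 39 * X ^ 7 + 2 * X ^ 2 := by ring
      _ ≤ _ := by omega
  have hlast : IsFrac (floors U δ n * δ) (40 * X ^ 7) := ((hF n le_rfl).mul hδ).mono (by omega)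
  have hquot : ∀ c < n, IsFrac (scales U z δ c / (floors U δ n * δ)) (81 * X ^ 7) := fun c hc =>
    ((hy c hc.le).div hlast).mono (by omega)
  exact
    { gs := fun i j => (hgs i j).mono (by omega)
      sq := fun k _ i _ => ((hE i k).mul (hE i k)).mono (by omega)
      sum := fun k hk i hi => ((htot k hk.le).add (hcol k i hi)).mono (by omega)
      mul := fun k hk => (hmul k hk).mono (by omega)
      norm := hW.mono (by omega)
      gsSq := fun k _ i _ => ((hGS i k).mul (hGS i k)).mono (by omega)
      gsSum := fun k _ i hi => (hgsSum k i hi).mono (by omega)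
      gsMul := fun k _ => (hgsMul k).mono (by omega)
      gsDiv := fun k _ => (hdiv k).mono (by omega)
      floor := fun k hk => (hF k hk.le).mono (by omega)
      floorMul := fun k hk => ((hF k hk.le).mul (hdiv k)).mono (by omega)
      scaleMul := fun c hc => ((hy c (by omega)).mul (hzv _)).mono (by omega)
      scaleDiv := fun c hc => (((hy c (by omega)).mul (hzv _)).div (hzv _)).mono (by omega)
      last := hlast.mono (by omega)
      quot := fun c hc => (hquot c hc).mono (by omega)
      out := fun c hc => (hquot c hc).roundTo.mono (by omega) }

/-- Moves the quantifier over the input size into the predicate on written numbers, so that one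
analysis of the run serves all sizes. -/
theorem AllValues.of_forall {ι : Type*} {H : ι → Prop} {w : ι → ℝ → Prop}
    (h : ∀ B, H B → AllValues (w B) U z δ) : AllValues (fun x => ∀ B, H B → w B x) U z δ where
  gs i j B hB := (h B hB).gs i j
  sq k hk i hi B hB := (h B hB).sq k hk i hi
  sum k hk i hi B hB := (h B hB).sum k hk i hi
  mul k hk B hB := (h B hB).mul k hk
  norm B hB := (h B hB).norm
  gsSq k hk i hi B hB := (h B hB).gsSq k hk i hi
  gsSum k hk i hi B hB := (h B hB).gsSum k hk i hi
  gsMul k hk B hB := (h B hB).gsMul k hk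
  gsDiv k hk B hB := (h B hB).gsDiv k hk
  floor k hk B hB := (h B hB).floor k hk
  floorMul k hk B hB := (h B hB).floorMul k hk
  scaleMul c hc B hB := (h B hB).scaleMul c hc
  scaleDiv c hc B hB := (h B hB).scaleDiv c hc
  last B hB := (h B hB).last
  quot c hc B hB := (h B hB).quot c hc
  out c hc B hB := (h B hB).out c hc

/-- With 2 ^ L ≤ 2n this makes the quadratic overhead of one binary search O(n) steps. -/
theorem sq_le_two_mul_two_pow (L : ℕ) : L * L ≤ 2 * 2 ^ L := by
  rcases lt_or_ge L 3 with h | h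
  · interval_cases L <;> norm_num
  · induction L, h using Nat.le_induction with
    | base => norm_num
    | succ L h ih =>
      rw [pow_succ]
      nlinarith

end

end FrameScaling

end

/-! ### The case of at most one column, and the corollary -/

namespace FrameScaling

/-- A single score equals the sum of all scores, which is d for all scale factors. -/
theorem lev_eq_lev_of_le_one {d n : ℕ} (hn : n ≤ 1) {U : Matrix (Fin d) (Fin n) ℝ} (hU : IsFrame U)
    {z w : Fin n → ℝ} (hz : ∀ j, 0 < z j) (hw : ∀ j, 0 < w j) (j : Fin n) :
    lev U z j = lev U w j := by
  have hsub : ∀ f : Fin n → ℝ, ∑ i, f i = f j := fun f =>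
    Fintype.sum_eq_single j fun i hi => absurd (Fin.ext (by omega)) hi
  rw [← hsub (lev U z), ← hsub (lev U w), sum_lev hU hz, sum_lev hU hw]

theorem hasBitComplexity_one {b : ℝ} (hb : 3 ≤ b) : HasBitComplexity 1 b := by
  refine ⟨1, by simp, le_trans ?_ hb⟩
  norm_num [ratBits]

theorem half_le_log_inv {δ : ℝ} (hδ : 0 < δ) (hδ2 : δ < 1 / 2) : 1 / 2 ≤ Real.log (1 / δ) := by
  have h1 : (2 : ℝ) ≤ 1 / δ := by
    rw [le_div_iff₀ hδ]
    linarith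
  have h2 := Real.log_le_log (by norm_num) h1
  have h3 := Real.log_two_gt_d9
  linarith

end FrameScaling

open FrameScaling in
theorem mainTheorem4 :
    ∃ (P : FrameScaling.Prog) (C : ℝ) (K : ℕ), 0 < C ∧
      ∀ (d n b : ℕ) (U : Matrix (Fin d) (Fin n) ℝ) (z : Fin n → ℝ) (δ : ℝ),
        FrameScaling.IsFrame U →
        (∀ i j, FrameScaling.HasBitComplexity (U i j) (b : ℝ)) →
        (∀ j, 0 < z j) →
        0 < δ → δ < 1 / 2 →
        ∃ zhat : Fin n → ℝ,
          (∀ j, 0 < zhat j) ∧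
          (∀ j, FrameScaling.HasBitComplexity (zhat j)
            (C * ((n : ℝ) * ((d : ℝ) * (b : ℝ) + Real.log (n : ℝ) + Real.log (1 / δ))))) ∧
          (∑ j, |FrameScaling.lev U z j - FrameScaling.lev U zhat j|
            ≤ C * ((n : ℝ) * (d : ℝ) * δ)) ∧
          -- the program computes `zhat`
          (P.run U z δ).legal ∧
          (P.run U z δ).output n = zhat ∧
          -- operation counts
          ((P.run U z δ).comparisons : ℝ) ≤ C * ((n : ℝ) * Real.log (n : ℝ)) ∧
          ((P.run U z δ).matrixOps : ℝ) ≤ C * (n : ℝ) ∧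
          ((P.run U z δ).roundings : ℝ) ≤ C * (n : ℝ) ∧
          ((P.run U z δ).steps : ℝ) ≤ C * (((n : ℝ) + 1) ^ 2 * ((d : ℝ) + 1) ^ 2) ∧
          -- all intermediate quantities have polynomial bit complexity
          (∀ B : ℕ,
            (∀ i j, FrameScaling.HasBitComplexity (U i j) (B : ℝ)) →
            (∀ j, FrameScaling.HasBitComplexity (z j) (B : ℝ)) →
            FrameScaling.HasBitComplexity δ (B : ℝ) →
            ∀ x ∈ (P.run U z δ).written,
              FrameScaling.HasBitComplexity x (C * ((n : ℝ) + (d : ℝ) + (B : ℝ) + 1) ^ K)) := by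
  refine ⟨frameProg, 200, 7, by norm_num, fun d n b U z δ hU hb hz hδ hδ2 => ?_⟩
  have hδ1 : δ ≤ 1 := by linarith
  have hℓ := half_le_log_inv hδ hδ2
  rcases Nat.lt_or_ge n 2 with hn | hn
  · obtain ⟨hout, hlegal, hcounts, hwritten⟩ := frameProg_ensures (d := d) (n := n)
      (w := fun x => x = 1) (by omega) Nat.cast_one (initialConf U z δ).idx
      (initialConf U z δ).mem (initialConf U z δ) rfl rfl
    change (frameProg.run U z δ).counts ≤ _ at hcounts
    simp only [Conf.counts, initialConf, Prod.mk_add_mk, Prod.mk_le_mk] at hcounts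
    obtain ⟨c1, c2, c3, c4⟩ := hcounts
    have hone : ∀ j : Fin n, (0 : ℝ) < (fun _ => 1 : Fin n → ℝ) j := fun _ => one_pos
    refine ⟨fun _ => 1, hone, fun j => hasBitComplexity_one ?_, ?_, hlegal trivial,
      funext fun j => hout j j.2, ?_, ?_, ?_, ?_, ?_⟩
    · obtain rfl : n = 1 := by have := j.2; omega
      have : (0 : ℝ) ≤ d * b := by positivity
      simp only [Nat.cast_one, Real.log_one, add_zero, one_mul]
      linarith
    · rw [Finset.sum_eq_zero fun j _ => by
        rw [lev_eq_lev_of_le_one (by omega) hU hz hone, sub_self, abs_zero]]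
      positivity
    · rw [show (frameProg.run U z δ).comparisons = 0 by omega]
      have : 0 ≤ Real.log n := Real.log_natCast_nonneg n
      simp only [Nat.cast_zero]
      positivity
    · rw [show (frameProg.run U z δ).matrixOps = 0 by omega]
      simp
    · rw [show (frameProg.run U z δ).roundings = 0 by omega]
      simp
    · have h1 : (frameProg.run U z δ).steps ≤ 200 * ((n + 1) ^ 2 * (d + 1) ^ 2) := by
        have h2 : 1 ≤ (n + 1) ^ 2 * (d + 1) ^ 2 := Nat.one_le_iff_ne_zero.mpr (by positivity)
        omega
      exact_mod_cast h1
    · intro B _ _ _ x hx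
      rcases hwritten x hx with h | rfl
      · exact absurd h (Set.notMem_empty x)
      · refine hasBitComplexity_one ?_
        have h1 : (1 : ℝ) ≤ ((n : ℝ) + d + B + 1) ^ 7 := one_le_pow₀ (by
          have : (0 : ℝ) ≤ (n : ℝ) + d + B := by positivity
          linarith)
        linarith
  · set H : ℕ → Prop := fun B => (∀ i j, HasBitComplexity (U i j) B) ∧
      (∀ j, HasBitComplexity (z j) B) ∧ HasBitComplexity δ B with hH
    -- All sizes B are treated at once; if the input is not rational, no B qualifies and the
    -- predicate is vacuous.
    set w : ℝ → Prop := fun x => ∀ B, H B → IsFrac x (85 * (n + d + B + 1) ^ 7) with hw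
    have hpow : ∀ B, n + d + B + 1 ≤ 85 * (n + d + B + 1) ^ 7 := fun B => by
      have : n + d + B + 1 ≤ (n + d + B + 1) ^ 7 := Nat.le_self_pow (by norm_num) _
      omega
    obtain ⟨L, hL1, hL2, hens⟩ := sortedProg_ensures (w := w) hn U z δ hz
      (fun B _ => (IsFrac.natCast 0).mono (Nat.zero_le _))
      (fun B _ => (IsFrac.natCast 1).mono (by have := hpow B; omega))
      (fun B _ => (IsFrac.natCast 5).mono (by
        have : 1 ≤ (n + d + B + 1) ^ 7 := Nat.one_le_pow _ _ (by omega)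
        omega))
      (fun i j B hB => (IsFrac.of_hasBitComplexity (hB.1 i j)).mono (by have := hpow B; omega))
      (fun j B hB => (IsFrac.of_hasBitComplexity (hB.2.1 j)).mono (by have := hpow B; omega))
      (fun σ => AllValues.of_forall fun B hB => allValues_isFrac rfl
        (fun i j => IsFrac.of_hasBitComplexity (hB.1 i (σ j)))
        (fun j => IsFrac.of_hasBitComplexity (hB.2.1 (σ j)))
        (IsFrac.of_hasBitComplexity hB.2.2))
      (fun σ k _ hk => (normConst_pos _ hk).ne')
      (fun σ => (mul_pos (floors_pos _ hδ n) hδ).ne')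
    obtain ⟨⟨σ, hanti, hout⟩, hlegal, hcounts, hwritten⟩ :=
      Ensures.ifIdx (e := .cols) (f := .const 1)
        (s := .loop 2 .cols (.const ⟨3, .const 0, .var 2⟩ 1))
        (fun h => absurd h (by simp only [IExpr.eval]; omega)) (fun _ => hens)
        (initialConf U z δ) rfl rfl
    change (frameProg.run U z δ).counts ≤ _ at hcounts
    simp only [Conf.counts, initialConf, Prod.mk_add_mk, Prod.mk_le_mk] at hcounts
    obtain ⟨c1, c2, c3, c4⟩ := hcounts
    have hUσ := hU.submatrix σ
    have hzσ : ∀ j, 0 < (z ∘ σ) j := fun j => hz _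
    have hval : ∀ c : Fin n, (frameProg.run U z δ).output n (σ c) =
        rounded (U.submatrix id σ) (z ∘ σ) δ c := by
      intro c
      obtain ⟨p, hp, hpo⟩ := hout (σ c)
      refine Eq.trans hpo ?_
      -- The search may have found another position p with the same key; the truncated scale factors
      -- there agree.
      have hpc : extendVec (z ∘ σ) p = extendVec (z ∘ σ) c := by
        rw [extendVec_of_lt _ p.2, extendVec_of_lt _ c.2]
        exact hp
      rw [rounded]
      congr 2
      rcases le_total (p : ℕ) c with h | h
      · exact scales_eq_of_eq hδ hδ1 hzσ hanti h c.2 hpc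
      · exact (scales_eq_of_eq hδ hδ1 hzσ hanti h p.2 hpc.symm).symm
    have hval' : ∀ j : Fin n, (frameProg.run U z δ).output n j =
        rounded (U.submatrix id σ) (z ∘ σ) δ (σ.symm j) := fun j => by
      rw [← hval, Equiv.apply_symm_apply]
    have hnR : (2 : ℝ) ≤ n := by exact_mod_cast hn
    -- Since n ≥ 2, log n is bounded below, and the terms linear in n are absorbed into n log n.
    have hlogn : Real.log 2 ≤ Real.log n := Real.log_le_log (by norm_num) hnR
    have hlog2 := Real.log_two_gt_d9
    have hLlog : (L : ℝ) ≤ 1 + 2 * Real.log n := by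
      have h1 : ((2 : ℝ) ^ L) ≤ 2 * n := by exact_mod_cast hL2
      have h2 := Real.log_le_log (by positivity) h1
      rw [Real.log_pow, Real.log_mul (by norm_num) (by positivity)] at h2
      by_contra hcon
      rw [not_le] at hcon
      nlinarith
    refine ⟨(frameProg.run U z δ).output n, fun j => ?_, fun j => ?_, ?_, hlegal trivial, rfl,
      ?_, ?_, ?_, ?_, ?_⟩
    · rw [hval']
      exact rounded_pos hδ hδ1 (σ.symm j).2
    · rw [hval']
      exact rounded_hasBitComplexity hUσ hδ hδ2 hzσ hanti
        (fun i j => IsFrac.of_hasBitComplexity (hb i (σ j))) (σ.symm j).2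
    · rcases Nat.eq_zero_or_pos d with rfl | hd
      -- For d = 0 all scores are empty sums; the estimate for truncated scale factors needs R > 0
      -- and hence d > 0.
      · have h0 : ∀ y : Fin n → ℝ, ∀ j, lev U y j = 0 := fun y j => by simp [lev]
        simp [h0]
      · have h1 := sum_abs_lev_rounded_le hUσ hd (by omega) hδ hδ1 hzσ hanti
        have h2 : (fun j : Fin n => rounded (U.submatrix id σ) (z ∘ σ) δ j) =
            (frameProg.run U z δ).output n ∘ σ := funext fun c => (hval c).symm
        simp only [h2, lev_submatrix] at h1
        rw [Equiv.sum_comp σ fun j =>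
          |lev U z j - lev U ((frameProg.run U z δ).output n) j|] at h1
        refine h1.trans ?_
        have : 0 ≤ (n : ℝ) * d * δ := by positivity
        linarith
    · have h1 : ((frameProg.run U z δ).comparisons : ℝ) ≤ 2 * n * L + 2 * n := by
        exact_mod_cast (by omega : (frameProg.run U z δ).comparisons ≤ 2 * n * L + 2 * n)
      nlinarith
    · have h1 : (frameProg.run U z δ).matrixOps ≤ 200 * n := by omega
      exact_mod_cast h1
    · have h1 : (frameProg.run U z δ).roundings ≤ 200 * n := by omega
      exact_mod_cast h1
    · have h1 : L * (2 * L + 6) ≤ 32 * n := by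
        have h2 := sq_le_two_mul_two_pow L
        nlinarith [Nat.zero_le L, Nat.le_mul_self L]
      have h2 : (frameProg.run U z δ).steps ≤ 200 * ((n + 1) ^ 2 * (d + 1) ^ 2) := by
        have h3 : n * (11 + 2 * (L * (2 * L + 6)) + n * (2 + (d + 1) * 2) + d * 2) ≤
            n * (11 + 2 * (32 * n) + n * (2 + (d + 1) * 2) + d * 2) := by gcongr
        refine c1.trans (le_trans ?_ (?_ : 14 + 12 * n + n * (4 + d * 3) + n * (6 + d * 3) +
          n * (11 + 2 * (32 * n) + n * (2 + (d + 1) * 2) + d * 2) ≤ _))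
        · omega
        · ring_nf
          nlinarith [Nat.zero_le (n * d), Nat.zero_le (n ^ 2 * d), Nat.zero_le (n ^ 2 * d ^ 2),
            Nat.zero_le (n * d ^ 2), Nat.zero_le (d ^ 2)]
      exact_mod_cast h2
    · intro B hB1 hB2 hB3 x hx
      rcases hwritten x hx with h | h
      · exact absurd h (Set.notMem_empty x)
      · refine (h B ⟨hB1, hB2, hB3⟩).hasBitComplexity ?_
        have h1 : 2 * (85 * (n + d + B + 1) ^ 7) + 3 ≤ 200 * (n + d + B + 1) ^ 7 := by
          have : 1 ≤ (n + d + B + 1) ^ 7 := Nat.one_le_pow _ _ (by omega)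
          omega
        exact_mod_cast h1
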